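/- **Conventions.** Groups are abelian. $\mathrm{Mult}\,G=\mathrm{Hom}(G\otimes G,G)$, under addition, is the group of multiplications $\mu$ on $G$; write $x\times y=\mu(x\otimes y)$. An *ACD-group* is a torsion-free group $G$ of finite rank having a completely decomposable subgroup (a finite direct sum of rank-one groups) of finite index. Its regulator $\mathrm{Reg}\,G$ is the intersection of its completely decomposable subgroups of least index, and $n(G)=|G/\mathrm{Reg}\,G|$. $\mathrm{Reg}_\tau G$ is the sum of the rank-one summands of type $\tau$ of $\mathrm{Reg}\,G$, and $T(G)=\{\tau\mid \mathrm{Reg}_\tau G\neq 0\}$. $G$ is *block-rigid* if the types in $T(G)$ are pairwise incomparable, *rigid* if moreover $r(\mathrm{Reg}_\tau G)=1$ for all $\tau\in T(G)$, *of ring type* if all $\tau\in T(G)$ are idempotent, and a *CRQ-group* if $G/\mathrm{Reg}\,G$ is cyclic. $\mathcal A_0$ is the class of reduced block-rigid CRQ-groups of ring type. For a block-rigid CRQ-group $G$ let $d+\mathrm{Reg}\,G$ generate $G/\mathrm{Reg}\,G$; then $m_\tau(G)$ is the order of $\pi_\tau(d)+\mathrm{Reg}\,G$ in $\tilde G/\mathrm{Reg}\,G$,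 where $\tilde G$ is the divisible hull of $G$ and $\pi_\tau$ its projection onto the divisible hull of $\mathrm{Reg}_\tau G$ (this does not depend on $d$). Put $T_0(G)=\{\tau\in T(G)\mid m_\tau(G)>1\}$. A $P_0(\tau)$-integer is an integer having no prime divisor $p$ with $\tau(p)=\infty$. For idempotent $\tau$, $R_\tau$ is the unital subring of $\mathbb Q$ whose additive group has type $\tau$. A *main decomposition* of $G$ is a decomposition $G=G_1\oplus C$ with $C$ completely decomposable and $G_1$ a rigid CRQ-group such that $T(G_1)=T_0(G)$ and $m_\tau(G_1)=m_\tau(G)$ for $\tau\in T(G_1)$. Put $B=\mathrm{Reg}\,G_1$. A *$B$-basis* defined by an element $d\in G_1$ that generates $G$ modulo $\mathrm{Reg}\,G$ is a system $e_0^{(\tau)}\in B_\tau=\mathrm{Reg}_\tau G_1$ $(\tau\in T_0(G))$ such that $B=\bigoplus_{\tau}R_\tau e_0^{(\tau)}$, the characteristic of $e_0^{(\tau)}$ belongs to $\tau$ and consists of zeros and symbols $\infty$ only, and in $\tilde G$ $$d=\sum_{\tau\in T_0(G)}\frac{s_\tau}{m_\tau}e_0^{(\tau)},\qquad m_\tau=m_\tau(G),$$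 with integers $s_\tau$ satisfying $\gcd(s_\tau,m_\tau)=1$, where $s_\tau,m_\tau$ are $P_0(\tau)$-integers and $n(G)=\mathrm{lcm}\{m_\tau\mid\tau\in T_0(G)\}$; this formula for $d$ is the related *standard representation*. Put $A=\mathrm{Reg}\,G$, $A_\tau=\mathrm{Reg}_\tau G$, $C_\tau=\mathrm{Reg}_\tau C$, $k_\tau=r(C_\tau)$, and let $I_\tau$ be $\{0,1,\dots,k_\tau\}$ if $\tau\in T_0(G)$ and $\{1,\dots,k_\tau\}$ if $\tau\in T(G)\setminus T_0(G)$. An *$A$-basis* is a system $e_i^{(\tau)}\in A_\tau$ $(\tau\in T(G),\ i\in I_\tau)$, with characteristics in $\tau$ consisting of zeros and symbols $\infty$ only, such that $A=\bigoplus_{\tau}\bigoplus_{i\in I_\tau}R_\tau e_i^{(\tau)}$ and $\{e_0^{(\tau)}\mid\tau\in T_0(G)\}$ is a $B$-basis. **Theorem.** Let $G\in\mathcal A_0$, $A=\mathrm{Reg}\,G$. 1. $\mathrm{Mult}\,G\in\mathcal A_0$, and its regulator is $\mathrm{Hom}(G\otimes G,A)$. 2. $T(\mathrm{Mult}\,G)=T(G)$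 and $T_0(\mathrm{Mult}\,G)=T_0(G)$. 3. $m_\tau(\mathrm{Mult}\,G)=m_\tau(G)$ for all $\tau\in T(G)$, and $n(\mathrm{Mult}\,G)=n(G)$. 4. $r(\mathrm{Reg}_\tau(\mathrm{Mult}\,G))=(r(\mathrm{Reg}_\tau G))^3$ for all $\tau\in T(G)$. Moreover, let $G=G_1\oplus C$ be any main decomposition, $\{e_i^{(\tau)}\}$ any $A$-basis whose $B$-basis is defined by $d=\sum_{\tau\in T_0(G)}\frac{s_\tau}{m_\tau}e_0^{(\tau)}$, and for $\tau\in T_0(G)$ let $s_\tau^{-1}$ be any integer inverse to $s_\tau$ modulo $m_\tau$. To a multiplication $\times$ on $G$ assign the family of matrices $\bigl(e_i^{(\tau)}\times e_j^{(\tau)}\bigr)_{i,j\in I_\tau}$, $\tau\in T(G)$. Let $M^{(2)}$, $M''$ and $K$ be the groups of families of matrices indexed by $I_\tau\times I_\tau$ $(\tau\in T(G))$ defined as follows. For $M^{(2)}$, the $(0,0)$ entry lies in $m_\tau^2A_\tau$, the other entries of row $0$ and column $0$ lie in $m_\tau A_\tau$, and all remaining entries lie in $A_\tau$. For $M''$ the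 conditions are the same, except that the $(0,0)$ entry lies in $m_\tau^2C_\tau$. For $K$, the $(0,0)$ entry lies in $m_\tau^2B_\tau$ and all other entries are $0$. (If $\tau\notin T_0(G)$, there is no row or column $0$.) Let $X$ be the family whose $(0,0)$ entry is $m_\tau s_\tau^{-1}e_0^{(\tau)}$ for each $\tau\in T_0(G)$ and whose other entries are all $0$. Then the assignment is an isomorphism of $\mathrm{Mult}\,G$ onto $\langle X,M^{(2)}\rangle$ that maps the regulator of $\mathrm{Mult}\,G$ onto $M^{(2)}$, and, identifying $\mathrm{Mult}\,G$ with $\langle X,M^{(2)}\rangle$: 5. $\mathrm{Mult}\,G=M'\oplus M''$ with $M'=\langle X,K\rangle$ is a main decomposition of $\mathrm{Mult}\,G$; moreover $T(M')=T_0(G)$ and $\mathrm{Reg}\,M'=K$. 6. Suppose in addition that every $s_\tau^{-1}$ is a $P_0(\tau)$-integer. For $\tau\in T_0(G)$ let $E_0^{(\tau)}$ be the family whose $(0,0)$ entry at $\tau$ is $m_\tau^2e_0^{(\tau)}$ and whose other entries are all $0$. Then, for the main decomposition in 5, $\{E_0^{(\tau)}\mid\tau\in T_0(G)\}$ is a $B$-basis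 of $\mathrm{Mult}\,G$ defined by $X$, with standard representation $$X=\sum_{\tau\in T_0(G)}\frac{s_\tau^{-1}}{m_\tau}E_0^{(\tau)}.$$ -/

import Mathlib

open scoped TensorProduct

noncomputable section

namespace CRQ

/-! ### Characteristics and types -/

/-- A characteristic: a function from the primes to `{0, 1, 2, …, ∞}`. -/
abbrev Characteristic : Type := Nat.Primes → ℕ∞

/-- Two characteristics are equivalent if they differ at finitely many primes only and
are both finite wherever they differ. -/
def charEquiv (χ ψ : Characteristic) : Prop :=
  {p | χ p ≠ ψ p}.Finite ∧ ∀ p, χ p ≠ ψ p → χ p ≠ ⊤ ∧ ψ p ≠ ⊤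

/-- Equivalence of characteristics is an equivalence relation. -/
instance charSetoid : Setoid Characteristic where
  r := charEquiv
  iseqv :=
    { refl := fun χ => by simp [charEquiv]
      symm := by
        rintro χ ψ ⟨h, h'⟩
        refine ⟨by simpa only [ne_comm] using h, fun p hp => (h' p hp.symm).symm⟩
      trans := by
        rintro χ ψ ω ⟨h, h'⟩ ⟨k, k'⟩
        refine ⟨(h.union k).subset fun p hp => ?_, fun p hp => ?_⟩
        · by_cases e : χ p = ψ p
          · exact Or.inr fun e' => hp (e.trans e')
          · exact Or.inl e
        · by_cases e : χ p = ψ p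
          · have e2 : ψ p ≠ ω p := fun e' => hp (e.trans e')
            exact ⟨e ▸ (k' p e2).1, (k' p e2).2⟩
          · by_cases e2 : ψ p = ω p
            · exact ⟨(h' p e).1, e2 ▸ (h' p e).2⟩
            · exact ⟨(h' p e).1, (k' p e2).2⟩ }

/-- Types: equivalence classes of characteristics. -/
def GType : Type := Quotient charSetoid

/-- The type of a characteristic. -/
def GType.mk (χ : Characteristic) : GType := Quotient.mk charSetoid χ

/-- `τ ≤ σ` if some characteristic in `τ` is pointwise at most some characteristic in `σ`. -/
instance : LE GType where
  le τ σ := ∃ χ ψ : Characteristic, GType.mk χ = τ ∧ GType.mk ψ = σ ∧ χ ≤ ψ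

/-- A characteristic consisting of zeros and symbols `∞` only. -/
def IsZeroInfty (χ : Characteristic) : Prop := ∀ p, χ p = 0 ∨ χ p = ⊤

/-- Idempotent types: those containing a characteristic with values `0` and `∞` only. -/
def GType.IsIdempotent (τ : GType) : Prop := ∃ χ, GType.mk χ = τ ∧ IsZeroInfty χ

/-- `P_∞(τ)`, the set of primes `p` with `τ(p) = ∞` (the value `∞` does not depend on the
characteristic chosen in `τ`). -/
def PInf (τ : GType) : Set ℕ := {p | ∃ (hp : p.Prime) (χ : Characteristic),
  GType.mk χ = τ ∧ χ ⟨p, hp⟩ = ⊤}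

/-- `z` is a `P₀(τ)`-integer: no prime divisor of `z` lies in `P_∞(τ)`. -/
def IsP0Integer (τ : GType) (z : ℤ) : Prop := ∀ p : ℕ, p.Prime → (p : ℤ) ∣ z → p ∉ PInf τ

/-- For an idempotent type `τ`, the unital subring `R_τ` of `ℚ` whose additive group is of
type `τ`: the fractions whose denominator has prime divisors in `P_∞(τ)` only. -/
def typeRing (τ : GType) : Subring ℚ where
  carrier := {q | ∀ p : ℕ, p.Prime → p ∣ q.den → p ∈ PInf τ}
  zero_mem' := fun p hp h => absurd (Nat.dvd_one.mp (by simpa using h)) hp.ne_one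
  one_mem' := fun p hp h => absurd (Nat.dvd_one.mp (by simpa using h)) hp.ne_one
  add_mem' := fun {a b} ha hb p hp h =>
    ((Nat.Prime.dvd_mul hp).mp (h.trans (Rat.add_den_dvd a b))).elim (ha p hp) (hb p hp)
  mul_mem' := fun {a b} ha hb p hp h =>
    ((Nat.Prime.dvd_mul hp).mp (h.trans (Rat.mul_den_dvd a b))).elim (ha p hp) (hb p hp)
  neg_mem' := fun {a} ha p hp h => ha p hp (by simpa using h)

section Groups

variable (G : Type*) [AddCommGroup G]

/-- The `p`-height of `g` in `G`: the supremum of all `k` with `g ∈ p ^ k G`. -/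
def height {G : Type*} [AddCommGroup G] (p : ℕ) (g : G) : ℕ∞ :=
  ⨆ (k : ℕ) (_ : ∃ x : G, p ^ k • x = g), (k : ℕ∞)

/-- The characteristic `χ(g)` of `g` in `G`. -/
def charOf {G : Type*} [AddCommGroup G] (g : G) : Characteristic := fun p => height (p : ℕ) g

/-- All nonzero elements of `G` are of type `τ`; used for groups of rank one, where it says
that `G` is of type `τ`. -/
def HasType (τ : GType) : Prop := ∀ g : G, g ≠ 0 → GType.mk (charOf g) = τ

/-! ### Completely decomposable groups, regulators, critical types -/

/-- `G` is the direct sum of its subgroups `L i`, all of rank one. -/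
structure IsRankOneDecomposition {n : ℕ} (L : Fin n → AddSubgroup G) : Prop where
  rank_one : ∀ i, Module.rank ℤ (L i) = 1
  indep : iSupIndep L
  sup : ⨆ i, L i = ⊤

/-- Completely decomposable torsion-free group of finite rank: a finite direct sum of
torsion-free groups of rank one. -/
def IsCompletelyDecomposable : Prop :=
  IsAddTorsionFree G ∧ ∃ (n : ℕ) (L : Fin n → AddSubgroup G), IsRankOneDecomposition G L

/-- Almost completely decomposable groups (`ACD`-groups): torsion-free groups of finite rank
with a completely decomposable subgroup of finite index. -/
structure IsACD : Prop where
  torsionFree : IsAddTorsionFree G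
  finiteRank : Module.rank ℤ G < Cardinal.aleph0
  exists_cd : ∃ H : AddSubgroup G, IsCompletelyDecomposable H ∧ H.FiniteIndex

/-- `H` is a completely decomposable subgroup of `G` of least (finite) index. -/
structure IsRegulating (H : AddSubgroup G) : Prop where
  cd : IsCompletelyDecomposable H
  finiteIndex : H.FiniteIndex
  least : ∀ H' : AddSubgroup G, IsCompletelyDecomposable H' → H'.FiniteIndex → H.index ≤ H'.index

/-- The regulator `Reg G`: the intersection of all completely decomposable subgroups of
least index. -/
def regulator : AddSubgroup G := sInf {H | IsRegulating G H}

/-- The regulator index `n(G)`. -/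
def regIndex : ℕ := (regulator G).index

/-- `Reg_τ G`: the sum of the rank-one summands of type `τ` in the direct decompositions of
`Reg G` into groups of rank one. For block-rigid groups the sum of the summands of type `τ` is
the same for all these decompositions. -/
def regPart (τ : GType) : AddSubgroup G :=
  (sSup {S : AddSubgroup (regulator G) | ∃ (n : ℕ) (L : Fin n → AddSubgroup (regulator G)),
    IsRankOneDecomposition (regulator G) L ∧ ∃ i, HasType (L i) τ ∧ S = L i}).map
    (regulator G).subtype

/-- The set `T(G)` of critical types of `G`. -/
def critTypes : Set GType := {τ | regPart G τ ≠ ⊥}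

/-- Block-rigid groups: `ACD`-groups with pairwise incomparable critical types. -/
structure IsBlockRigid : Prop extends IsACD G where
  antichain : IsAntichain (· ≤ ·) (critTypes G)

/-- Rigid groups: block-rigid groups with `Reg_τ G` of rank one for all critical types `τ`. -/
structure IsRigid : Prop extends IsBlockRigid G where
  rank_one : ∀ τ ∈ critTypes G, Module.rank ℤ (regPart G τ) = 1

/-- `CRQ`-groups: `ACD`-groups with cyclic regulator quotient. -/
structure IsCRQ : Prop extends IsACD G where
  cyclic : IsAddCyclic (G ⧸ regulator G)

/-- Groups of ring type: all critical types are idempotent. -/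
def IsRingType : Prop := ∀ τ ∈ critTypes G, τ.IsIdempotent

/-- Reduced groups: the only divisible subgroup is zero. -/
def IsReduced : Prop := ∀ D : AddSubgroup G,
  (∀ n : ℕ, n ≠ 0 → ∀ x ∈ D, ∃ y ∈ D, n • y = x) → D = ⊥

/-- The class `𝒜₀` of reduced block-rigid `CRQ`-groups of ring type. -/
structure InA0 : Prop extends IsBlockRigid G, IsCRQ G where
  reduced : IsReduced G
  ringType : IsRingType G

/-! ### The invariants `m_τ` -/

/-- The image of the regulator in the divisible hull of `G`. -/
def hullRegulator : AddSubgroup (DivisibleHull G) :=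
  (regulator G).map (DivisibleHull.coeAddMonoidHom G)

/-- The divisible hull of `Reg_τ G` inside the divisible hull of `G`. -/
def hullPart (τ : GType) : Submodule ℚ (DivisibleHull G) :=
  Submodule.span ℚ (DivisibleHull.coeAddMonoidHom G '' regPart G τ)

open Classical in
/-- The natural projection `π_τ` of the divisible hull of `G`, which for block-rigid `G` is the
direct sum of the divisible hulls of all `Reg_σ G`, onto the divisible hull of `Reg_τ G`. -/
def typeProj (τ : GType) : DivisibleHull G →ₗ[ℚ] DivisibleHull G :=
  if h : IsCompl (hullPart G τ) (⨆ (σ : GType) (_ : σ ≠ τ), hullPart G σ) then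
    (hullPart G τ).projection _ h
  else 0

/-- The element `d + Reg G` generates `G / Reg G`. -/
def GeneratesQuotient {G : Type*} [AddCommGroup G] (d : G) : Prop :=
  AddSubgroup.zmultiples (QuotientAddGroup.mk d : G ⧸ regulator G) = ⊤

/-- The order of `π_τ(d) + Reg G` in the quotient of the divisible hull of `G` by `Reg G`. -/
def componentOrder {G : Type*} [AddCommGroup G] (τ : GType) (d : G) : ℕ :=
  addOrderOf (QuotientAddGroup.mk (typeProj G τ (DivisibleHull.coeAddMonoidHom G d)) :
    DivisibleHull G ⧸ hullRegulator G)

open Classical in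
/-- The near-isomorphism invariant `m_τ(G)`: the order of `π_τ(d) + Reg G`, where `d + Reg G` is
a generator of `G / Reg G` (the order does not depend on the generator). -/
def mInv (τ : GType) : ℕ :=
  if h : ∃ d : G, GeneratesQuotient d then componentOrder τ h.choose else 0

/-- `T₀(G)`: the critical types `τ` with `m_τ(G) > 1`. -/
def critTypes0 : Set GType := {τ | τ ∈ critTypes G ∧ 1 < mInv G τ}

/-! ### Main decompositions, bases, standard representations -/

/-- `G = G₁ ⊕ C` is a main decomposition of `G`. -/
structure IsMainDecomposition (G₁ C : AddSubgroup G) : Prop where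
  compl : IsCompl G₁ C
  cd : IsCompletelyDecomposable C
  rigid : IsRigid G₁
  crq : IsCRQ G₁
  types : ∀ τ, τ ∈ critTypes G₁ ↔ τ ∈ critTypes G ∧ 1 < mInv G τ
  inv : ∀ τ ∈ critTypes G₁, mInv G₁ τ = mInv G τ

variable {G}

/-- For a subgroup `H` of `G`, the subgroup `Reg_τ H`, as a subgroup of `G`. -/
def subRegPart (H : AddSubgroup G) (τ : GType) : AddSubgroup G := (regPart H τ).map H.subtype

/-- The subgroup `R_τ e` of the divisible hull of `G`. -/
def cyclicPart (τ : GType) (e : G) : AddSubgroup (DivisibleHull G) :=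
  (typeRing τ).toAddSubgroup.map
    (LinearMap.toSpanSingleton ℚ (DivisibleHull G)
      (DivisibleHull.coeAddMonoidHom G e)).toAddMonoidHom

/-- Given a main decomposition `G = G₁ ⊕ C` and `B = Reg G₁`, the system
`{e τ | τ ∈ T(B)}` is a `B`-basis of `G` defined by the element `d`, and
`d = ∑ (s τ / m_τ) e τ` is the standard representation of `G` related to it. -/
structure IsBBasis (G₁ : AddSubgroup G) (d : G) (s : GType → ℤ) (e : GType → G) : Prop where
  /-- `d ∈ D`, that is, `d` lies in `G₁` and generates `G` modulo the regulator. -/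
  d_mem : d ∈ G₁
  d_gen : GeneratesQuotient d
  e_mem : ∀ τ ∈ critTypes G₁, e τ ∈ subRegPart G₁ τ
  char_zeroInfty : ∀ τ ∈ critTypes G₁, IsZeroInfty (charOf (e τ))
  char_type : ∀ τ ∈ critTypes G₁, GType.mk (charOf (e τ)) = τ
  /-- `B` is the direct sum of the groups `R_τ e τ`. -/
  indep : iSupIndep fun τ : critTypes G₁ => cyclicPart (τ : GType) (e τ)
  sup : ⨆ τ : critTypes G₁, cyclicPart (τ : GType) (e τ) =
    ((regulator G₁).map G₁.subtype).map (DivisibleHull.coeAddMonoidHom G)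
  /-- The standard representation of `d`; the sum is finite. -/
  finite : (critTypes G₁).Finite
  repr : DivisibleHull.coeAddMonoidHom G d =
    ∑ᶠ τ ∈ critTypes G₁, ((s τ : ℚ) / (mInv G τ : ℚ)) • DivisibleHull.coeAddMonoidHom G (e τ)
  /-- `n(G)` is the least common multiple of all `m_τ`. -/
  lcm : ∀ k : ℕ, regIndex G ∣ k ↔ ∀ τ ∈ critTypes G₁, mInv G τ ∣ k
  gcd : ∀ τ ∈ critTypes G₁, IsCoprime (s τ) (mInv G τ : ℤ)
  s_int : ∀ τ ∈ critTypes G₁, IsP0Integer τ (s τ)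
  m_int : ∀ τ ∈ critTypes G₁, IsP0Integer τ (mInv G τ)

open Classical in
/-- The index set `I_τ`: it contains `0` if and only if `τ ∈ T(B)`, and besides the integers
`1, …, k_τ`, where `k_τ` is the rank of `C_τ`. -/
def idx (G₁ C : AddSubgroup G) (τ : GType) : Finset ℕ :=
  (if τ ∈ critTypes G₁ then {0} else ∅) ∪ Finset.Icc 1 (Module.finrank ℤ (regPart C τ))

/-- Given a main decomposition `G = G₁ ⊕ C`, the system `{E τ i | τ ∈ T(G), i ∈ I_τ}` is an
`A`-basis of `G` (where `A = Reg G`) whose subsystem `{E τ 0 | τ ∈ T(B)}` is a `B`-basis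
defined by `d`, with standard representation `d = ∑ (s τ / m_τ) E τ 0`. -/
structure IsABasis (G₁ C : AddSubgroup G) (d : G) (s : GType → ℤ) (E : GType → ℕ → G) :
    Prop where
  bbasis : IsBBasis G₁ d s (fun τ => E τ 0)
  mem : ∀ τ ∈ critTypes G, ∀ i ∈ idx G₁ C τ, E τ i ∈ regPart G τ
  char_zeroInfty : ∀ τ ∈ critTypes G, ∀ i ∈ idx G₁ C τ, IsZeroInfty (charOf (E τ i))
  char_type : ∀ τ ∈ critTypes G, ∀ i ∈ idx G₁ C τ, GType.mk (charOf (E τ i)) = τ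
  /-- `A` is the direct sum of the groups `R_τ (E τ i)`. -/
  indep : iSupIndep fun x : (τ : critTypes G) × idx G₁ C τ => cyclicPart (x.1 : GType) (E x.1 x.2)
  sup : ⨆ x : (τ : critTypes G) × idx G₁ C τ, cyclicPart (x.1 : GType) (E x.1 x.2) =
    hullRegulator G

/-! ### Multiplications and their matrices -/

variable (G) in
/-- The group `Mult G` of all multiplications on `G`. -/
abbrev Mult : Type _ := G ⊗[ℤ] G →+ G

variable (G) in
/-- `Hom(G ⊗ G, A)` as a subgroup of `Mult G`, where `A = Reg G`. -/
def regulatorMult : AddSubgroup (Mult G) where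
  carrier := {μ | ∀ x, μ x ∈ regulator G}
  zero_mem' := fun _ => zero_mem _
  add_mem' := fun ha hb x => add_mem (ha x) (hb x)
  neg_mem' := fun ha x => neg_mem (ha x)

/-- Families, indexed by `T(G)`, of square matrices over `G` with rows and columns indexed
by `I_τ`. -/
abbrev MatrixFamily (G₁ C : AddSubgroup G) : Type _ :=
  (τ : critTypes G) → Matrix (idx G₁ C τ) (idx G₁ C τ) G

/-- The map sending a multiplication `×` to the family of matrices with
entries `E τ i × E τ j`. -/
def multMatrix (G₁ C : AddSubgroup G) (E : GType → ℕ → G) : Mult G →+ MatrixFamily G₁ C where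
  toFun μ := fun τ => Matrix.of fun i j => μ (E τ i ⊗ₜ[ℤ] E τ j)
  map_zero' := rfl
  map_add' _ _ := rfl

/-- The group of those families of matrices whose `(i, j)` entry at `τ` lies in `S τ i j`. -/
def entrywise (G₁ C : AddSubgroup G) (S : GType → ℕ → ℕ → AddSubgroup G) :
    AddSubgroup (MatrixFamily G₁ C) where
  carrier := {U | ∀ (τ : critTypes G) (i j : idx G₁ C τ), U τ i j ∈ S τ i j}
  zero_mem' := fun _ _ _ => zero_mem _
  add_mem' := fun ha hb τ i j => add_mem (ha τ i j) (hb τ i j)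
  neg_mem' := fun ha τ i j => neg_mem (ha τ i j)

/-- The subgroup `k H` of `G`. -/
def mulSubgroup (k : ℕ) (H : AddSubgroup G) : AddSubgroup G := H.map (nsmulAddMonoidHom k)

/-- `M⁽²⁾`: matrices over `A_τ = Reg_τ G` with entries in `m_τ² A_τ` at position `(0, 0)`, in
`m_τ A_τ` elsewhere in row `0` and column `0`, and in `A_τ` at all other positions. -/
def M2 (G₁ C : AddSubgroup G) : AddSubgroup (MatrixFamily G₁ C) :=
  entrywise G₁ C fun τ i j =>
    if i = 0 ∧ j = 0 then mulSubgroup (mInv G τ ^ 2) (regPart G τ)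
    else if i = 0 ∨ j = 0 then mulSubgroup (mInv G τ) (regPart G τ)
    else regPart G τ

/-- `K`: matrices with entries in `m_τ² B_τ` at position `(0, 0)` and zeros elsewhere. -/
def K (G₁ C : AddSubgroup G) : AddSubgroup (MatrixFamily G₁ C) :=
  entrywise G₁ C fun τ i j =>
    if i = 0 ∧ j = 0 then mulSubgroup (mInv G τ ^ 2) (subRegPart G₁ τ) else ⊥

/-- `M''`: matrices with entries in `m_τ² C_τ` at position `(0, 0)`, in `m_τ A_τ` elsewhere in
row `0` and column `0`, and in `A_τ` at all other positions. -/
def MDoublePrime (G₁ C : AddSubgroup G) : AddSubgroup (MatrixFamily G₁ C) :=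
  entrywise G₁ C fun τ i j =>
    if i = 0 ∧ j = 0 then mulSubgroup (mInv G τ ^ 2) (subRegPart C τ)
    else if i = 0 ∨ j = 0 then mulSubgroup (mInv G τ) (regPart G τ)
    else regPart G τ

/-- `X`: the `(0, 0)` entry at `τ` is `m_τ t_τ E τ 0`, and all other entries vanish. -/
def X (G₁ C : AddSubgroup G) (t : GType → ℤ) (E : GType → ℕ → G) : MatrixFamily G₁ C :=
  fun τ => Matrix.of fun i j =>
    if (i : ℕ) = 0 ∧ (j : ℕ) = 0 then ((mInv G τ : ℤ) * t τ) • E τ 0 else 0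

open Classical in
/-- `E₀` at `σ`: the `(0, 0)` entry at `σ` is `m_σ² E σ 0`, and all other entries vanish. -/
def basisMatrix (G₁ C : AddSubgroup G) (E : GType → ℕ → G) (σ : GType) : MatrixFamily G₁ C :=
  fun τ => Matrix.of fun i j =>
    if (τ : GType) = σ ∧ (i : ℕ) = 0 ∧ (j : ℕ) = 0 then (mInv G σ ^ 2) • E σ 0 else 0

/-- `M(d, E₀) = ⟨X, M⁽²⁾⟩`. -/
def MGroup (G₁ C : AddSubgroup G) (t : GType → ℤ) (E : GType → ℕ → G) :
    AddSubgroup (MatrixFamily G₁ C) :=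
  AddSubgroup.closure {X G₁ C t E} ⊔ M2 G₁ C

/-- `M' = ⟨X, K⟩`. -/
def MPrime (G₁ C : AddSubgroup G) (t : GType → ℤ) (E : GType → ℕ → G) :
    AddSubgroup (MatrixFamily G₁ C) :=
  AddSubgroup.closure {X G₁ C t E} ⊔ K G₁ C

/-- The subgroup of `Mult G` formed by the multiplications whose family of matrices with respect
to `E` lies in `N`. -/
def multOf (G₁ C : AddSubgroup G) (E : GType → ℕ → G) (N : AddSubgroup (MatrixFamily G₁ C)) :
    AddSubgroup (Mult G) :=
  N.comap (multMatrix G₁ C E)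

end Groups

end CRQ

end

noncomputable section

namespace CRQ

/-! ### Types and sets of primes -/

/-! For an idempotent type τ, the elements of type at least τ are those divisible by all products of
primes in `PInf τ`. This subgroup A_τ, called `typePart`, is defined without any decomposition, is
pure, and is respected by every homomorphism. All structural information is packed into `BlockData`:
for τ in a finite set T the A_τ are finitely generated over R_τ, independent, and of finite index
together. A rank-one summand of a completely decomposable subgroup of finite index must then lie in
a single A_τ. So the sum of the A_τ is the largest such subgroup, hence the regulator, and Reg_τ =
A_τ. `InA0.exists_blockData` provides these data for G, `BlockData.retract` for direct summands,
`AdaptedBasis.blockData_mult` for Mult G.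

For σ ≠ τ the product of A_σ and A_τ lies in A_σ ∩ A_τ = 0, so a multiplication is determined by its
matrices over bases of the A_τ. The restrictions on these matrices come from d, whose τ-component is
(s/m)e₀. For y in A_τ one gets s(e₀ × y) = m(d × y), and since s is prime to m, row and column 0 lie
in mA_τ. If d × d ≡ kd modulo A, comparing τ-components gives s²(e₀ × e₀) ≡ kms e₀ modulo m²A_τ,
hence e₀ × e₀ ≡ kmt e₀ modulo m²A_τ, where t inverts s (`AdaptedBasis.isEntry`). Conversely,
matrices of this shape with one common k define a bilinear map into the divisible hull, and the same
computation read backwards shows that it maps G ⊗ G into G (`AdaptedBasis.exists_mult`). This is the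
isomorphism of Mult G with ⟨X, M⁽²⁾⟩.

The integer k, modulo n(G), is the class of d × d in G/A. A multiplication lies in the regulator iff
d × d does (`AdaptedBasis.mem_divSum_mult_iff`), so evaluation at d ⊗ d identifies the two regulator
quotients and sends the class of X to that of d. The part of Mult G of type τ has one basis element
for each position (i, j) and each basis element of A_τ, whence the cube of the rank. From X = ∑
(t/m)E₀ the invariants m_τ are read off. Splitting only the free part of the corner entry along A_τ
= B_τ ⊕ C_τ separates M' from M''. -/

theorem mem_PInf_mk {χ : Characteristic} {p : ℕ} (hp : p.Prime) :
    p ∈ PInf (GType.mk χ) ↔ χ ⟨p, hp⟩ = ⊤ := by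
  constructor
  · rintro ⟨hp', ψ, h, e⟩
    by_contra hne
    exact (((Quotient.exact h : charEquiv ψ χ).2 ⟨p, hp⟩) (fun h' => hne (h' ▸ e))).1 e
  · exact fun h => ⟨hp, χ, rfl, h⟩

theorem prime_of_mem_PInf {τ : GType} {p : ℕ} (h : p ∈ PInf τ) : p.Prime := h.1

theorem PInf_subset_of_le {σ τ : GType} (h : σ ≤ τ) : PInf σ ⊆ PInf τ := by
  obtain ⟨χ, ψ, rfl, rfl, hle⟩ := h
  intro p hp
  have hp' := hp.1
  rw [mem_PInf_mk hp'] at hp ⊢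
  exact top_le_iff.1 (hp ▸ hle _)

/-- A characteristic of zeros and ∞ in σ imposes a condition only where it is ∞. Comparison of types
thus becomes inclusion of sets of primes, and only the smaller type has to be idempotent. -/
theorem le_of_PInf_subset {σ τ : GType} (hσ : σ.IsIdempotent) (h : PInf σ ⊆ PInf τ) : σ ≤ τ := by
  obtain ⟨χ, rfl, hχ⟩ := hσ
  obtain ⟨ψ, rfl⟩ := Quotient.exists_rep τ
  refine ⟨χ, ψ, rfl, rfl, fun p => ?_⟩
  rcases hχ p with h0 | h0
  · simp [h0]
  · have := (mem_PInf_mk (χ := ψ) p.2).1 (h ((mem_PInf_mk p.2).2 h0))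
    rw [show ψ p = ⊤ from this]
    exact le_top

/-- `n` is a nonzero natural number with prime divisors in `S` only. -/
def IsSUnit (S : Set ℕ) (n : ℕ) : Prop := n ≠ 0 ∧ ∀ p : ℕ, p.Prime → p ∣ n → p ∈ S

theorem isSUnit_one (S : Set ℕ) : IsSUnit S 1 :=
  ⟨one_ne_zero, fun _ hp h => absurd (Nat.dvd_one.1 h) hp.ne_one⟩

theorem IsSUnit.mul {S : Set ℕ} {m n : ℕ} (hm : IsSUnit S m) (hn : IsSUnit S n) :
    IsSUnit S (m * n) :=
  ⟨mul_ne_zero hm.1 hn.1, fun p hp h => ((hp.dvd_mul).1 h).elim (hm.2 p hp) (hn.2 p hp)⟩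

theorem IsSUnit.of_dvd {S : Set ℕ} {m n : ℕ} (hn : IsSUnit S n) (h : m ∣ n) : IsSUnit S m :=
  ⟨fun h0 => hn.1 (by simpa [h0] using h), fun p hp h' => hn.2 p hp (h'.trans h)⟩

theorem IsSUnit.mono {S S' : Set ℕ} {n : ℕ} (hn : IsSUnit S n) (h : S ⊆ S') : IsSUnit S' n :=
  ⟨hn.1, fun p hp h' => h (hn.2 p hp h')⟩

theorem IsSUnit.prod {S : Set ℕ} {ι : Type*} {s : Finset ι} {f : ι → ℕ}
    (h : ∀ i ∈ s, IsSUnit S (f i)) : IsSUnit S (∏ i ∈ s, f i) := by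
  classical
  induction s using Finset.induction_on with
  | empty => simpa using isSUnit_one S
  | insert a s ha ih =>
    rw [Finset.prod_insert ha]
    exact (h a (by simp)).mul (ih fun i hi => h i (by simp [hi]))

theorem isSUnit_prime_pow {S : Set ℕ} {p : ℕ} (hp : p.Prime) (h : p ∈ S) (k : ℕ) :
    IsSUnit S (p ^ k) :=
  ⟨pow_ne_zero _ hp.ne_zero, fun _ hq hd =>
    ((Nat.prime_dvd_prime_iff_eq hq hp).1 (hq.dvd_of_dvd_pow hd)) ▸ h⟩

theorem isSUnit_prime {S : Set ℕ} {p : ℕ} (hp : p.Prime) (h : p ∈ S) : IsSUnit S p := by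
  simpa using isSUnit_prime_pow hp h 1

theorem mem_typeRing {τ : GType} {q : ℚ} : q ∈ typeRing τ ↔ IsSUnit (PInf τ) q.den :=
  ⟨fun h => ⟨q.den_nz, h⟩, fun h => h.2⟩

theorem div_mem_typeRing {τ : GType} (z : ℤ) {n : ℕ} (hn : IsSUnit (PInf τ) n) :
    (z : ℚ) / n ∈ typeRing τ := by
  refine mem_typeRing.2 (hn.of_dvd ?_)
  have := Rat.den_dvd z n
  exact_mod_cast this

/-! ### Divisibility in torsion-free groups -/

section DivPart

variable (M : Type*) [AddCommGroup M]

/-- The subgroup of all elements divisible by all products of primes from `S`. -/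
def divPart (S : Set ℕ) : AddSubgroup M where
  carrier := {x | ∀ n, IsSUnit S n → ∃ y, n • y = x}
  zero_mem' := fun n _ => ⟨0, by simp⟩
  add_mem' := fun ha hb n hn => by
    obtain ⟨y, rfl⟩ := ha n hn
    obtain ⟨z, rfl⟩ := hb n hn
    exact ⟨y + z, by simp⟩
  neg_mem' := fun ha n hn => by
    obtain ⟨y, rfl⟩ := ha n hn
    exact ⟨-y, by simp⟩

variable {M}

theorem divPart_anti {S S' : Set ℕ} (h : S ⊆ S') : divPart M S' ≤ divPart M S :=
  fun _ hx n hn => hx n (hn.mono h)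

theorem map_mem_divPart {M' : Type*} [AddCommGroup M'] (f : M →+ M') {S : Set ℕ} {x : M}
    (hx : x ∈ divPart M S) : f x ∈ divPart M' S := fun n hn => by
  obtain ⟨y, rfl⟩ := hx n hn
  exact ⟨f y, by simp⟩

variable [IsAddTorsionFree M]

theorem nsmul_cancel {n : ℕ} (hn : n ≠ 0) {x y : M} (h : n • x = n • y) : x = y :=
  (nsmul_right_inj hn).1 h

theorem zsmul_cancel {n : ℤ} (hn : n ≠ 0) {x y : M} (h : n • x = n • y) : x = y :=
  (zsmul_right_inj hn).1 h

/-- Quotients are unique in a torsion-free group, so dividing first by n and then by k agrees with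
dividing by nk. This makes `divPart M S` a module over the ring of fractions with denominators from
`S`. -/
theorem exists_mem_divPart_nsmul_eq {S : Set ℕ} {x : M} (hx : x ∈ divPart M S) {n : ℕ}
    (hn : IsSUnit S n) : ∃ y ∈ divPart M S, n • y = x := by
  obtain ⟨y, hy⟩ := hx n hn
  refine ⟨y, fun k hk => ?_, hy⟩
  obtain ⟨z, hz⟩ := hx (n * k) (hn.mul hk)
  exact ⟨z, nsmul_cancel hn.1 (by rw [← mul_smul, hz, hy])⟩

omit [IsAddTorsionFree M] in
-- With am + bn = 1 one has x = a(mx) + bnx = n(ay + bx).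
theorem exists_nsmul_eq_of_coprime {m n : ℕ} (h : Nat.Coprime m n) {x y : M}
    (hxy : m • x = n • y) : ∃ z, n • z = x := by
  have hb := Nat.gcd_eq_gcd_ab m n
  rw [h.gcd_eq_one] at hb
  refine ⟨m.gcdA n • y + m.gcdB n • x, ?_⟩
  have hxy' : (m : ℤ) • x = (n : ℤ) • y := by simpa using hxy
  have : (n : ℤ) • (m.gcdA n • y + m.gcdB n • x) = x := by
    rw [smul_add, smul_comm, ← hxy', smul_smul, smul_smul, ← add_smul, mul_comm (m.gcdA n), ← hb]
    simp
  simpa using this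

/-- Purity, one prime factor of n at a time: a prime in `S` is cancelled by asking for one more
factor of it, and a prime outside `S` is coprime to all the divisors in question. -/
theorem mem_divPart_of_nsmul_mem {S : Set ℕ} {n : ℕ} (hn : n ≠ 0) {x : M}
    (h : n • x ∈ divPart M S) : x ∈ divPart M S := by
  induction n using induction_on_primes generalizing x with
  | zero => exact absurd rfl hn
  | one => simpa using h
  | prime_mul p a hp ih =>
    refine ih (right_ne_zero_of_mul hn) ?_
    rw [mul_smul] at h
    generalize a • x = x at h
    intro k hk
    by_cases hpS : p ∈ S
    · obtain ⟨y, hy⟩ := h (p * k) ((isSUnit_prime hp hpS).mul hk)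
      exact ⟨y, nsmul_cancel hp.ne_zero (by rw [← mul_smul, hy])⟩
    · obtain ⟨y, hy⟩ := h k hk
      refine exists_nsmul_eq_of_coprime ?_ hy.symm
      exact (hp.coprime_iff_not_dvd).2 fun hd => hpS (hk.2 p hp hd)

theorem mem_divPart_of_zsmul_mem {S : Set ℕ} {n : ℤ} (hn : n ≠ 0) {x : M}
    (h : n • x ∈ divPart M S) : x ∈ divPart M S := by
  obtain ⟨k, rfl | rfl⟩ := n.eq_nat_or_neg
  · exact mem_divPart_of_nsmul_mem (n := k) (by simpa using hn) (by simpa using h)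
  · exact mem_divPart_of_nsmul_mem (n := k) (by simpa using hn) (by simpa using h)

theorem mem_divPart_of_forall_prime {S : Set ℕ} {x : M}
    (h : ∀ p ∈ S, p.Prime → x ∈ divPart M {p}) : x ∈ divPart M S := by
  intro n hn
  -- The induction over the factorization must also carry the divisibility of the quotient, which
  -- purity preserves.
  have key : ∃ y, (∀ p ∈ S, p.Prime → y ∈ divPart M {p}) ∧ n • y = x := by
    induction n using induction_on_primes with
    | zero => exact absurd rfl hn.1
    | one => exact ⟨x, h, by simp⟩
    | prime_mul p a hp ih =>
      obtain ⟨y, hy, rfl⟩ := ih (hn.of_dvd (Dvd.intro_left _ rfl))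
      have hpS := hn.2 p hp (Dvd.intro _ rfl)
      obtain ⟨z, -, rfl⟩ := exists_mem_divPart_nsmul_eq (hy p hpS hp)
        (isSUnit_prime hp (Set.mem_singleton p))
      exact ⟨z, fun q hq hq' => mem_divPart_of_nsmul_mem hp.ne_zero (hy q hq hq'), by
        rw [mul_comm, mul_smul]⟩
  exact key.imp fun y => And.right

/-- A subgroup with torsion-free quotient. -/
def IsPureIn {M : Type*} [AddCommGroup M] (H : AddSubgroup M) : Prop :=
  ∀ (n : ℕ) (x : M), n ≠ 0 → n • x ∈ H → x ∈ H

/-! ### Heights and characteristics -/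

omit [IsAddTorsionFree M] in
-- The exponents k with x in p^k M form an initial segment, so a failure at k bounds the supremum by
-- k - 1.
theorem le_height_iff {p k : ℕ} {x : M} : (k : ℕ∞) ≤ height p x ↔ ∃ y, p ^ k • y = x := by
  constructor
  · intro h
    by_contra hne
    have hk : k ≠ 0 := by
      rintro rfl
      exact hne ⟨x, by simp⟩
    have : height p x ≤ ((k - 1 : ℕ) : ℕ∞) := by
      refine iSup₂_le fun j ⟨y, hy⟩ => ?_
      rw [Nat.cast_le]
      by_contra hlt
      refine hne ⟨p ^ (j - k) • y, ?_⟩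
      rw [← mul_smul, ← pow_add, ← hy]
      congr 2
      omega
    have h2 := h.trans this
    rw [Nat.cast_le] at h2
    omega
  · exact fun h => le_iSup₂ (f := fun (k : ℕ) (_ : ∃ y : M, p ^ k • y = x) => (k : ℕ∞)) k h

omit [IsAddTorsionFree M] in
theorem height_eq_top_iff {p : ℕ} (hp : p.Prime) {x : M} :
    height p x = ⊤ ↔ x ∈ divPart M {p} := by
  rw [ENat.eq_top_iff_forall_ge]
  simp_rw [le_height_iff]
  constructor
  · intro h n hn
    obtain ⟨k, rfl⟩ : ∃ k, n = p ^ k :=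
      ⟨_, Nat.eq_prime_pow_of_unique_prime_dvd hn.1 fun {d} hd h' => hn.2 d hd h'⟩
    exact h k
  · exact fun h k => h _ (isSUnit_prime_pow hp (Set.mem_singleton p) k)

omit [IsAddTorsionFree M] in
theorem mem_PInf_type_iff {p : ℕ} (hp : p.Prime) {x : M} :
    p ∈ PInf (GType.mk (charOf x)) ↔ x ∈ divPart M {p} := by
  rw [mem_PInf_mk hp]
  exact height_eq_top_iff hp

theorem mem_divPart_of_type_eq {τ : GType} {x : M} (h : GType.mk (charOf x) = τ) :
    x ∈ divPart M (PInf τ) :=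
  mem_divPart_of_forall_prime fun p hp hp' => by
    rw [← h] at hp
    exact (mem_PInf_type_iff hp').1 hp

omit [IsAddTorsionFree M] in
theorem PInf_subset_type {S : Set ℕ} {x : M} (hS : ∀ p ∈ S, p.Prime) (h : x ∈ divPart M S) :
    S ⊆ PInf (GType.mk (charOf x)) := fun p hp =>
  (mem_PInf_type_iff (hS p hp)).2 (divPart_anti (by simpa using hp) h)

/-- Heights can change only at the finitely many primes dividing n. At those, being infinite is
unaffected by the factor n because `divPart M {p}` is pure. -/
theorem type_nsmul {n : ℕ} (hn : n ≠ 0) (x : M) :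
    GType.mk (charOf (n • x)) = GType.mk (charOf x) := by
  refine Quotient.sound (s := charSetoid) ⟨?_, fun p hp => ?_⟩
  · refine Set.Finite.subset (s := {p : Nat.Primes | (p : ℕ) ∣ n}) ?_ fun p hp => ?_
    · exact Set.Finite.preimage (f := fun p : Nat.Primes => (p : ℕ))
        (fun _ _ _ _ h => Subtype.ext h)
        ((Set.finite_Iic n).subset fun k (hk : k ∣ n) => Nat.le_of_dvd (Nat.pos_of_ne_zero hn) hk)
    · by_contra hd
      refine hp (ENat.eq_of_forall_natCast_le_iff fun k => ?_)
      simp only [charOf]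
      rw [le_height_iff, le_height_iff]
      constructor
      · rintro ⟨y, hy⟩
        exact exists_nsmul_eq_of_coprime
          (((p.2.coprime_iff_not_dvd).2 hd).symm.pow_right k) hy.symm
      · rintro ⟨y, rfl⟩
        exact ⟨n • y, smul_comm _ _ _⟩
  · have : charOf (n • x) p = ⊤ ↔ charOf x p = ⊤ := by
      simp only [charOf]
      rw [height_eq_top_iff p.2, height_eq_top_iff p.2]
      exact ⟨mem_divPart_of_nsmul_mem hn, fun h => nsmul_mem h n⟩
    constructor
    · exact fun h => hp (h.trans (this.1 h).symm)
    · exact fun h => hp ((this.2 h).trans h.symm)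

theorem type_zsmul {n : ℤ} (hn : n ≠ 0) (x : M) :
    GType.mk (charOf (n • x)) = GType.mk (charOf x) := by
  have hneg : ∀ y : M, charOf (-y) = charOf y := fun y => by
    ext1 p
    refine ENat.eq_of_forall_natCast_le_iff fun k => ?_
    simp only [charOf]
    rw [le_height_iff, le_height_iff]
    constructor <;> rintro ⟨z, hz⟩ <;> exact ⟨-z, by simp [hz]⟩
  obtain ⟨k, rfl | rfl⟩ := n.eq_nat_or_neg
  · rw [natCast_zsmul, type_nsmul (by simpa using hn)]
  · rw [neg_smul, hneg, natCast_zsmul, type_nsmul (by simpa using hn)]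

end DivPart

/-! ### Ranks -/

section Rank

variable {M : Type*} [AddCommGroup M]

theorem rank_eq_of_torsion_quotient (N : Submodule ℤ M)
    (h : ∀ x : M, ∃ n : ℤ, n ≠ 0 ∧ n • x ∈ N) : Module.rank ℤ M = Module.rank ℤ N := by
  rw [← rank_quotient_add_rank_of_isDomain N, rank_eq_zero_iff.2, zero_add]
  intro x
  obtain ⟨x, rfl⟩ := N.mkQ_surjective x
  obtain ⟨n, hn, hx⟩ := h x
  exact ⟨n, hn, by
    rw [← map_smul, Submodule.mkQ_apply, Submodule.Quotient.mk_eq_zero]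
    exact hx⟩

theorem exists_smul_eq_of_rank_one (h : Module.rank ℤ M = 1) (x y : M) :
    ∃ u v : ℤ, (u ≠ 0 ∨ v ≠ 0) ∧ u • x = v • y := by
  by_contra hne
  push Not at hne
  have hli : LinearIndependent ℤ ![x, y] := by
    rw [LinearIndependent.pair_iff]
    intro s t hst
    by_contra hst'
    refine hne s (-t) ?_ ?_
    · by_contra h'
      simp only [not_or, not_not, neg_eq_zero] at h'
      exact hst' h'
    · rw [neg_smul, eq_neg_iff_add_eq_zero, hst]
  have := hli.cardinal_lift_le_rank
  rw [h] at this
  simp at this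

variable [IsAddTorsionFree M]

theorem exists_smul_eq_of_rank_one' (h : Module.rank ℤ M = 1) {x y : M} (hx : x ≠ 0)
    (hy : y ≠ 0) : ∃ u v : ℤ, u ≠ 0 ∧ v ≠ 0 ∧ u • x = v • y := by
  obtain ⟨u, v, huv, e⟩ := exists_smul_eq_of_rank_one h x y
  refine ⟨u, v, ?_, ?_, e⟩
  · rintro rfl
    rw [zero_smul, eq_comm, smul_eq_zero_iff_left hy] at e
    simp [e] at huv
  · rintro rfl
    rw [zero_smul, smul_eq_zero_iff_left hx] at e
    simp [e] at huv

theorem rank_eq_one_of_forall {e : M} (he : e ≠ 0)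
    (h : ∀ x : M, ∃ n z : ℤ, n ≠ 0 ∧ n • x = z • e) : Module.rank ℤ M = 1 := by
  rw [rank_eq_of_torsion_quotient (Submodule.span ℤ {e})]
  · have hli : LinearIndependent ℤ (fun _ : Unit => e) := LinearIndependent.of_subsingleton () he
    have := rank_span hli
    rw [Set.range_const] at this
    simpa using this
  · intro x
    obtain ⟨n, z, hn, e'⟩ := h x
    exact ⟨n, hn, Submodule.mem_span_singleton.2 ⟨z, e'.symm⟩⟩

/-- In a group of rank one all nonzero elements have the same type. -/
theorem exists_hasType (h : Module.rank ℤ M = 1) : ∃ τ, HasType M τ := by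
  have : Nontrivial M := by
    rw [← not_subsingleton_iff_nontrivial]
    intro hs
    simp at h
  obtain ⟨x, hx⟩ := exists_ne (0 : M)
  refine ⟨GType.mk (charOf x), fun g hg => ?_⟩
  obtain ⟨u, v, hu, hv, e⟩ := exists_smul_eq_of_rank_one' h hg hx
  rw [← type_zsmul hu g, e, type_zsmul hv x]

end Rank

/-! ### Independent families of subgroups -/

section Independence

variable {M : Type*} [AddCommGroup M]

theorem iSupIndep_iff_sum {ι : Type*} [Fintype ι] {L : ι → AddSubgroup M} :
    iSupIndep L ↔ ∀ v : ι → M, (∀ i, v i ∈ L i) → ∑ i, v i = 0 → ∀ i, v i = 0 := by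
  classical
  rw [← iSupIndep_map_orderIso_iff (AddSubgroup.toIntSubmodule (M := M)),
    iSupIndep_iff_finsetSum_eq_zero_imp_eq_zero]
  constructor
  · exact fun h v hv h0 i => h Finset.univ v (fun i _ => hv i) h0 i (Finset.mem_univ i)
  · intro h s v hv h0 i hi
    have := h (fun i => if i ∈ s then v i else 0) (fun i => ?_) ?_ i
    · simpa [hi] using this
    · split_ifs with h'
      · exact hv i h'
      · exact zero_mem _
    · simpa [Finset.sum_ite_mem] using h0

theorem mem_iSup_iff_sum {ι : Type*} [Fintype ι] {L : ι → AddSubgroup M} {x : M} :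
    x ∈ ⨆ i, L i ↔ ∃ v : ι → M, (∀ i, v i ∈ L i) ∧ ∑ i, v i = x := by
  classical
  constructor
  · intro h
    refine AddSubgroup.iSup_induction L (C := fun x => ∃ v : ι → M, (∀ i, v i ∈ L i) ∧
      ∑ i, v i = x) h (fun i x hx => ?_) ⟨0, fun _ => zero_mem _, by simp⟩ ?_
    · refine ⟨Pi.single i x, fun j => ?_, by simp⟩
      rcases eq_or_ne j i with rfl | hj
      · simpa using hx
      · simp [hj]
    · rintro _ _ ⟨v, hv, rfl⟩ ⟨w, hw, rfl⟩
      exact ⟨v + w, fun i => add_mem (hv i) (hw i), by simp [Finset.sum_add_distrib]⟩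
  · rintro ⟨v, hv, rfl⟩
    exact sum_mem fun i _ => AddSubgroup.mem_iSup_of_mem i (hv i)

/-- Components in an internal direct sum, as endomorphisms; their additivity is the uniqueness of
the representation. -/
theorem exists_projections {ι : Type*} [Fintype ι] {L : ι → AddSubgroup M} (ind : iSupIndep L)
    (sup : ⨆ i, L i = ⊤) : ∃ π : ι → M →+ M, (∀ i x, π i x ∈ L i) ∧ (∀ x, ∑ i, π i x = x) ∧
      ∀ i, ∀ x ∈ L i, π i x = x ∧ ∀ j, j ≠ i → π j x = 0 := by
  classical
  have hex : ∀ x : M, ∃ v : ι → M, (∀ i, v i ∈ L i) ∧ ∑ i, v i = x := fun x =>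
    mem_iSup_iff_sum.1 (sup ▸ AddSubgroup.mem_top x)
  choose v hv hsum using hex
  have huniq : ∀ (a b : ι → M), (∀ i, a i ∈ L i) → (∀ i, b i ∈ L i) →
      ∑ i, a i = ∑ i, b i → a = b := by
    intro a b ha hb hab
    funext i
    have := iSupIndep_iff_sum.1 ind (fun i => a i - b i) (fun i => sub_mem (ha i) (hb i))
      (by rw [Finset.sum_sub_distrib, hab, sub_self]) i
    exact sub_eq_zero.1 this
  have hadd : ∀ x y, v (x + y) = v x + v y := fun x y =>
    huniq _ _ (hv _) (fun i => add_mem (hv x i) (hv y i))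
      (by simp [Finset.sum_add_distrib, hsum])
  refine ⟨fun i => AddMonoidHom.mk' (fun x => v x i) fun x y => by simp [hadd], fun i x => hv x i,
    hsum, fun i x hx => ?_⟩
  have := huniq (v x) (Pi.single i x) (hv x) (fun j => ?_) (by simp [hsum])
  · simp only [AddMonoidHom.mk'_apply, this]
    exact ⟨by simp, fun j hj => by simp [hj]⟩
  · rcases eq_or_ne j i with rfl | hj
    · simpa using hx
    · simp [hj]

/-- The smallest pure subgroup containing `H`. -/
def pureClosure (H : AddSubgroup M) : AddSubgroup M where
  carrier := {x | ∃ n : ℤ, n ≠ 0 ∧ n • x ∈ H}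
  zero_mem' := ⟨1, one_ne_zero, by simp⟩
  add_mem' := by
    rintro x y ⟨m, hm, hx⟩ ⟨n, hn, hy⟩
    refine ⟨m * n, mul_ne_zero hm hn, ?_⟩
    rw [smul_add, mul_smul, mul_smul, smul_comm m n x]
    exact add_mem (zsmul_mem hx n) (zsmul_mem hy m)
  neg_mem' := by
    rintro x ⟨m, hm, hx⟩
    exact ⟨m, hm, by simpa using hx⟩

theorem le_pureClosure (H : AddSubgroup M) : H ≤ pureClosure H :=
  fun x hx => ⟨1, one_ne_zero, by simpa using hx⟩

theorem mem_pureClosure_of_zsmul {H : AddSubgroup M} {n : ℤ} (hn : n ≠ 0) {x : M}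
    (h : n • x ∈ pureClosure H) : x ∈ pureClosure H := by
  obtain ⟨m, hm, hx⟩ := h
  exact ⟨m * n, mul_ne_zero hm hn, by rwa [mul_smul]⟩

theorem iSupIndep_pureClosure_zmultiples [IsAddTorsionFree M] {ι : Type*} [Fintype ι] {b : ι → M}
    (hb : LinearIndependent ℤ b) :
    iSupIndep fun i => pureClosure (AddSubgroup.zmultiples (b i)) := by
  classical
  rw [iSupIndep_iff_sum]
  intro v hv h0
  choose n hn hmem using hv
  -- The product of all denominators turns the relation into an integral one among the `b i`.
  have hw : ∀ i, ∃ w : ℤ, (∏ j, n j) • v i = w • b i := fun i => by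
    obtain ⟨z, hz⟩ := AddSubgroup.mem_zmultiples_iff.1 (hmem i)
    obtain ⟨c, hc⟩ := Finset.dvd_prod_of_mem n (Finset.mem_univ i)
    exact ⟨c * z, by rw [hc, mul_comm, mul_smul, ← hz, mul_smul]⟩
  choose w hw using hw
  have hw0 := Fintype.linearIndependent_iff.1 hb w (by
    simp_rw [← hw]
    rw [← Finset.smul_sum, h0, smul_zero])
  intro i
  refine zsmul_cancel (n := ∏ j, n j) (Finset.prod_ne_zero_iff.2 fun j _ => hn j) ?_
  rw [hw, hw0, zero_smul, smul_zero]

theorem rank_pureClosure_zmultiples [IsAddTorsionFree M] {e : M} (he : e ≠ 0) :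
    Module.rank ℤ (pureClosure (AddSubgroup.zmultiples e)) = 1 := by
  refine rank_eq_one_of_forall
    (e := ⟨e, le_pureClosure _ (AddSubgroup.mem_zmultiples e)⟩) (by simpa using he) ?_
  rintro ⟨x, n, hn, hx⟩
  obtain ⟨z, hz⟩ := AddSubgroup.mem_zmultiples_iff.1 hx
  exact ⟨n, z, hn, Subtype.ext hz.symm⟩

end Independence

/-! ### Bases over the rings `R_τ` -/

section Parts

variable (M : Type*) [AddCommGroup M]

/-- The subgroup of all elements of type at least `τ`, for idempotent `τ`. -/
abbrev typePart (τ : GType) : AddSubgroup M := divPart M (PInf τ)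

/-- A basis of `typePart M τ` over `R_τ`. -/
structure IsPartBasis (τ : GType) (I : Finset ℕ) (e : ℕ → M) : Prop where
  mem : ∀ i ∈ I, e i ∈ typePart M τ
  indep : ∀ z : ℕ → ℤ, ∑ i ∈ I, z i • e i = 0 → ∀ i ∈ I, z i = 0
  span : ∀ x ∈ typePart M τ, ∃ n, IsSUnit (PInf τ) n ∧ ∃ z : ℕ → ℤ, n • x = ∑ i ∈ I, z i • e i

/-- `typePart M τ` is finitely generated over `R_τ`. -/
def HasLattice (τ : GType) : Prop := ∃ N : Submodule ℤ M, N.FG ∧ (∀ x ∈ N, x ∈ typePart M τ) ∧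
  ∀ x ∈ typePart M τ, ∃ n, IsSUnit (PInf τ) n ∧ n • x ∈ N

/-- The sum of all `typePart M τ` with `τ ∈ T`. -/
def divSum (T : Finset GType) : AddSubgroup M where
  carrier := {x | ∃ f : GType → M, (∀ τ ∈ T, f τ ∈ typePart M τ) ∧ ∑ τ ∈ T, f τ = x}
  zero_mem' := ⟨0, fun _ _ => zero_mem _, by simp⟩
  add_mem' := by
    rintro x y ⟨f, hf, rfl⟩ ⟨g, hg, rfl⟩
    exact ⟨f + g, fun τ hτ => add_mem (hf τ hτ) (hg τ hτ), by simp [Finset.sum_add_distrib]⟩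
  neg_mem' := by
    rintro x ⟨f, hf, rfl⟩
    exact ⟨-f, fun τ hτ => neg_mem (hf τ hτ), by simp⟩

/-- The parts of `M` belonging to the idempotent types in `T` are finitely generated, independent,
and their sum is of finite index. -/
structure BlockData (T : Finset GType) : Prop where
  idem : ∀ τ ∈ T, τ.IsIdempotent
  lattice : ∀ τ ∈ T, HasLattice M τ
  indep : ∀ f : GType → M, (∀ τ ∈ T, f τ ∈ typePart M τ) → ∑ τ ∈ T, f τ = 0 → ∀ τ ∈ T, f τ = 0
  finiteIndex : (divSum M T).FiniteIndex

variable {M}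

open Classical in
theorem typePart_le_divSum {T : Finset GType} {τ : GType} (hτ : τ ∈ T) :
    typePart M τ ≤ divSum M T := fun x hx =>
  ⟨fun σ => if σ = τ then x else 0, fun σ _ => by
    dsimp only
    split_ifs with h
    · exact h ▸ hx
    · exact zero_mem _, by simp [hτ]⟩

theorem IsPartBasis.ne_zero {τ : GType} {I : Finset ℕ} {e : ℕ → M} (h : IsPartBasis M τ I e)
    {i : ℕ} (hi : i ∈ I) : e i ≠ 0 := by
  intro h0
  have := h.indep (fun j => if j = i then 1 else 0) (by simp [h0]) i hi
  simp at this

theorem IsPartBasis.linearIndependent {τ : GType} {I : Finset ℕ} {e : ℕ → M}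
    (h : IsPartBasis M τ I e) : LinearIndependent ℤ fun i : I => e i := by
  classical
  rw [Fintype.linearIndependent_iff]
  intro g hg i
  have := h.indep (fun j => if hj : j ∈ I then g ⟨j, hj⟩ else 0) ?_ i i.2
  · simpa using this
  · rw [← hg, ← Finset.sum_coe_sort I]
    simp

/-- Passing from the lattice to the whole part only introduces denominators that are products of
primes in `PInf τ`, so a ℤ-basis of the lattice serves as an R_τ-basis. -/
theorem isPartBasis_of_basis {τ : GType} {I : Finset ℕ} (N : Submodule ℤ M)
    (b : Module.Basis I ℤ N) (hN : ∀ x ∈ N, x ∈ typePart M τ)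
    (hspan : ∀ x ∈ typePart M τ, ∃ n, IsSUnit (PInf τ) n ∧ n • x ∈ N) :
    IsPartBasis M τ I fun i => if h : i ∈ I then (b ⟨i, h⟩ : M) else 0 where
  mem := fun i hi => by simpa [hi] using hN _ (b ⟨i, hi⟩).2
  indep := fun z hz i hi => by
    have := Fintype.linearIndependent_iff.1 b.linearIndependent (fun i => z i) ?_ ⟨i, hi⟩
    · exact this
    · rw [← Finset.sum_coe_sort I] at hz
      simp only [Finset.coe_mem, dite_true, Subtype.coe_eta] at hz
      refine Subtype.ext ?_
      simpa using hz
  span := fun x hx => by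
    obtain ⟨n, hn, hnx⟩ := hspan x hx
    refine ⟨n, hn, fun i => if h : i ∈ I then b.repr ⟨_, hnx⟩ ⟨i, h⟩ else 0, ?_⟩
    have := congrArg Subtype.val (b.sum_repr ⟨_, hnx⟩)
    rw [← Finset.sum_coe_sort I]
    simpa using this.symm

variable [IsAddTorsionFree M]

theorem HasLattice.exists_isPartBasis {τ : GType} (h : HasLattice M τ) :
    ∃ (r : ℕ) (e : ℕ → M), IsPartBasis M τ (Finset.Icc 1 r) e := by
  obtain ⟨N, hfg, hN, hspan⟩ := h
  have : Module.Finite ℤ N := Module.Finite.iff_fg.2 hfg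
  let b := Module.finBasis ℤ N
  have e : Fin (Module.finrank ℤ N) ≃ Finset.Icc 1 (Module.finrank ℤ N) :=
    Fintype.equivOfCardEq (by simp)
  exact ⟨_, _, isPartBasis_of_basis N (b.reindex e) hN hspan⟩

/-- Fix a nonzero coordinate z of a suitable multiple of x. For a prime p outside `PInf τ`, if p^k
divides x then p^k divides z. So outside `PInf τ` all heights are finite and almost all are zero,
while on `PInf τ` they are infinite. -/
theorem IsPartBasis.type_eq {τ : GType} (hτ : τ.IsIdempotent) {I : Finset ℕ} {e : ℕ → M}
    (h : IsPartBasis M τ I e) {x : M} (hx : x ∈ typePart M τ) (hx0 : x ≠ 0) :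
    GType.mk (charOf x) = τ := by
  obtain ⟨χ, rfl, hχ⟩ := hτ
  obtain ⟨n, hn, z, hz⟩ := h.span x hx
  obtain ⟨i, hi, hzi⟩ : ∃ i ∈ I, z i ≠ 0 := by
    by_contra hne
    push Not at hne
    rw [Finset.sum_eq_zero fun i hi => by rw [hne i hi, zero_smul]] at hz
    exact hx0 (nsmul_cancel hn.1 (by rw [hz, smul_zero]))
  have key : ∀ (p : Nat.Primes) (k : ℕ), (p : ℕ) ∉ PInf (GType.mk χ) →
      (k : ℕ∞) ≤ charOf x p → ((p : ℕ) : ℤ) ^ k ∣ z i := by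
    intro p k hp hk
    obtain ⟨y, rfl⟩ := le_height_iff.1 hk
    have hpk : (p : ℕ) ^ k ≠ 0 := pow_ne_zero _ p.2.ne_zero
    obtain ⟨n', hn', w, hw⟩ := h.span y (mem_divPart_of_nsmul_mem hpk hx)
    have e0 := h.indep (fun j => (n' : ℤ) * z j - ((p : ℕ) : ℤ) ^ k * n * w j) (by
      simp only [sub_smul, mul_smul, Finset.sum_sub_distrib, ← Finset.smul_sum]
      rw [← hz, ← hw]
      simp only [← Nat.cast_pow, natCast_zsmul]
      rw [smul_comm n', smul_comm n' ((p : ℕ) ^ k), smul_comm n, sub_self]) i hi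
    have hdvd : ((p : ℕ) : ℤ) ^ k ∣ n' * z i := ⟨n * w i, by rw [← mul_assoc]; exact sub_eq_zero.1 e0⟩
    refine IsCoprime.dvd_of_dvd_mul_left (IsCoprime.pow_left ?_) hdvd
    exact Nat.isCoprime_iff_coprime.2 ((p.2.coprime_iff_not_dvd).2 fun hd => hp (hn'.2 p p.2 hd))
  have htop : ∀ p : Nat.Primes, (p : ℕ) ∈ PInf (GType.mk χ) → charOf x p = ⊤ := fun p hp =>
    (height_eq_top_iff p.2).2 (divPart_anti (by simpa using hp) hx)
  have hfin : ∀ p : Nat.Primes, (p : ℕ) ∉ PInf (GType.mk χ) → charOf x p ≠ ⊤ := by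
    intro p hp h'
    -- The exponent |z| suffices, since p^|z| > |z|.
    refine hzi (Int.eq_zero_of_abs_lt_dvd (m := ((p : ℕ) : ℤ) ^ (z i).natAbs)
      (key p _ hp (h' ▸ le_top)) ?_)
    rw [Int.abs_eq_natAbs]
    exact_mod_cast Nat.lt_pow_self p.2.one_lt
  refine Quotient.sound (s := charSetoid) ⟨?_, fun p hp => ?_⟩
  · refine Set.Finite.subset (s := {p : Nat.Primes | (p : ℕ) ∣ (z i).natAbs}) ?_ fun p hp => ?_
    · exact Set.Finite.preimage (f := fun p : Nat.Primes => (p : ℕ))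
        (fun _ _ _ _ h => Subtype.ext h)
        ((Set.finite_Iic (z i).natAbs).subset fun k (hk : k ∣ (z i).natAbs) =>
          Nat.le_of_dvd (Nat.pos_of_ne_zero (by simpa using hzi)) hk)
    · by_cases hpS : (p : ℕ) ∈ PInf (GType.mk χ)
      · exact absurd ((htop p hpS).trans ((mem_PInf_mk p.2).1 hpS).symm) hp
      · have h0 := (hχ p).resolve_right fun h => hpS ((mem_PInf_mk p.2).2 h)
        have h1 : charOf x p ≠ 0 := fun h => hp (h.trans h0.symm)
        have := key p 1 hpS (by simpa using Order.one_le_iff_ne_zero.2 h1)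
        exact Int.natCast_dvd.1 (by simpa using this)
  · by_cases hpS : (p : ℕ) ∈ PInf (GType.mk χ)
    · exact absurd ((htop p hpS).trans ((mem_PInf_mk p.2).1 hpS).symm) hp
    · exact ⟨hfin p hpS, fun h => hpS ((mem_PInf_mk p.2).2 h)⟩

omit [IsAddTorsionFree M] in
theorem IsPartBasis.rank_eq {τ : GType} {I : Finset ℕ} {e : ℕ → M} (h : IsPartBasis M τ I e) :
    Module.rank ℤ (typePart M τ) = I.card := by
  let v : I → typePart M τ := fun i => ⟨e i, h.mem i i.2⟩
  have hli : LinearIndependent ℤ v := by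
    refine LinearIndependent.of_comp (typePart M τ).subtype.toIntLinearMap ?_
    exact h.linearIndependent
  rw [rank_eq_of_torsion_quotient (Submodule.span ℤ (Set.range v)), rank_span hli]
  · have := Cardinal.mk_range_eq_of_injective hli.injective
    simpa using this
  · intro x
    obtain ⟨n, hn, z, hz⟩ := h.span x x.2
    refine ⟨n, by exact_mod_cast hn.1, ?_⟩
    have : (n : ℤ) • x = ∑ i : I, z i • v i := by
      refine Subtype.ext ?_
      rw [natCast_zsmul]
      simp only [AddSubgroup.coe_nsmul, hz, AddSubgroup.val_finsetSum, AddSubgroup.coe_zsmul, v]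
      exact (Finset.sum_coe_sort I fun i => z i • e i).symm
    rw [this]
    exact Submodule.sum_mem _ fun i _ =>
      Submodule.smul_mem _ _ (Submodule.subset_span (Set.mem_range_self i))

end Parts

/-! ### Regulators of groups with block data -/

section Recognition

variable {M : Type*} [AddCommGroup M]

theorem charOf_map_of_pure {H : Type*} [AddCommGroup H] (f : H →+ M)
    (hf : Function.Injective f) (x : H)
    (hp : ∀ (n : ℕ) (y : M), n ≠ 0 → n • y = f x → y ∈ f.range) : charOf x = charOf (f x) := by
  ext1 p
  refine ENat.eq_of_forall_natCast_le_iff fun k => ?_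
  simp only [charOf]
  rw [le_height_iff, le_height_iff]
  constructor
  · rintro ⟨y, rfl⟩
    exact ⟨f y, by simp⟩
  · rintro ⟨y, hy⟩
    obtain ⟨z, rfl⟩ := hp _ y (pow_ne_zero _ p.2.ne_zero) hy
    exact ⟨z, hf (by simpa using hy)⟩

theorem IsRankOneDecomposition.exists_ne_zero {n : ℕ} {L : Fin n → AddSubgroup M}
    (h : IsRankOneDecomposition M L) (i : Fin n) : ∃ x ∈ L i, x ≠ 0 := by
  by_contra hne
  push Not at hne
  have h1 := h.rank_one i
  rw [(AddSubgroup.eq_bot_iff_forall _).2 hne] at h1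
  have : Subsingleton (⊥ : AddSubgroup M) := inferInstance
  simp at h1

theorem IsRankOneDecomposition.isPureIn [IsAddTorsionFree M] {n : ℕ} {L : Fin n → AddSubgroup M}
    (h : IsRankOneDecomposition M L) (i : Fin n) : IsPureIn (L i) := by
  obtain ⟨π, hπ, hsum, hπ'⟩ := exists_projections h.indep h.sup
  intro k x hk hx
  rw [← hsum x, Finset.sum_eq_single i]
  · exact hπ i x
  · intro j _ hj
    refine nsmul_cancel hk ?_
    rw [← map_nsmul, (hπ' i _ hx).2 j hj, smul_zero]
  · simp

variable [IsAddTorsionFree M] {T : Finset GType}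

/-- A multiple of a nonzero x in `L i` is a sum of elements of the parts, so the projection onto `L
i` of one of these is nonzero. Homomorphisms preserve divisibility, hence `L i` meets that part
nontrivially. Since `L i` has rank one and the part is pure, the part contains all of it. -/
theorem BlockData.summand_le (hB : BlockData M T) {H : AddSubgroup M} (hH : H.FiniteIndex)
    {n : ℕ} {L : Fin n → AddSubgroup H} (hL : IsRankOneDecomposition H L) (i : Fin n) :
    ∃ τ ∈ T, ∀ x ∈ L i, (x : M) ∈ typePart M τ := by
  have hfi := hB.finiteIndex
  obtain ⟨π, hπ, hsum, hπ'⟩ := exists_projections hL.indep hL.sup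
  obtain ⟨x, hx, hx0⟩ := hL.exists_ne_zero i
  obtain ⟨f, hf, hfx⟩ := (divSum M T).nsmul_index_mem (x : M)
  -- The factor `H.index` moves the components into `H`, where the projections are defined.
  let g : GType → H := fun τ => ⟨H.index • f τ, H.nsmul_index_mem _⟩
  have hg : ∑ τ ∈ T, g τ = (H.index * (divSum M T).index) • x := by
    refine Subtype.ext ?_
    simp only [AddSubgroup.val_finsetSum, g, AddSubgroup.coe_nsmul, ← Finset.smul_sum, hfx,
      mul_smul]
  obtain ⟨τ, hτ, hne⟩ : ∃ τ ∈ T, π i (g τ) ≠ 0 := by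
    by_contra hne
    push Not at hne
    have := congrArg (π i) hg
    rw [map_sum, Finset.sum_eq_zero hne, map_nsmul, (hπ' i x hx).1] at this
    refine hx0 (nsmul_cancel (n := H.index * (divSum M T).index)
      (mul_ne_zero hH.index_ne_zero hfi.index_ne_zero) ?_)
    rw [← this, smul_zero]
  have hgdiv : g τ ∈ divPart H (PInf τ) := fun k hk => by
    obtain ⟨y, hy⟩ := hf τ hτ k hk
    exact ⟨⟨H.index • y, H.nsmul_index_mem _⟩, Subtype.ext (by
      simp only [AddSubgroup.coe_nsmul, g, ← hy, smul_comm k])⟩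
  have hy : ((π i (g τ) : H) : M) ∈ typePart M τ :=
    map_mem_divPart H.subtype (map_mem_divPart (π i) hgdiv)
  refine ⟨τ, hτ, fun z hz => ?_⟩
  by_cases hz0 : z = 0
  · rw [hz0]
    exact zero_mem _
  obtain ⟨u, v, hu, hv, e⟩ := exists_smul_eq_of_rank_one' (hL.rank_one i)
    (x := ⟨z, hz⟩) (y := ⟨_, hπ i (g τ)⟩) (by simpa using hz0) (by simpa using hne)
  refine mem_divPart_of_zsmul_mem hu ?_
  have e' : u • (z : M) = v • ((π i (g τ) : H) : M) :=
    congrArg (fun w : L i => ((w : H) : M)) e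
  rw [e']
  exact zsmul_mem hy v

theorem BlockData.le_divSum (hB : BlockData M T) {H : AddSubgroup M} (hH : H.FiniteIndex)
    (hcd : IsCompletelyDecomposable H) : H ≤ divSum M T := by
  obtain ⟨-, n, L, hL⟩ := hcd
  obtain ⟨π, hπ, hsum, -⟩ := exists_projections hL.indep hL.sup
  intro x hx
  have : x = ∑ i, ((π i ⟨x, hx⟩ : H) : M) := by
    rw [← AddSubgroup.val_finsetSum, hsum]
  rw [this]
  refine sum_mem fun i _ => ?_
  obtain ⟨τ, hτ, hle⟩ := hB.summand_le hH hL i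
  exact typePart_le_divSum hτ (hle _ (hπ i _))

/-- The canonical decomposition of `divSum M T` into groups of rank one. -/
theorem BlockData.exists_decomposition (hB : BlockData M T) :
    ∃ (n : ℕ) (L : Fin n → AddSubgroup (divSum M T)),
      IsRankOneDecomposition (divSum M T) L ∧ ∀ τ ∈ T, ∀ x : divSum M T, (x : M) ∈ typePart M τ →
        x ∈ ⨆ (i : Fin n) (_ : ∀ y ∈ L i, (y : M) ∈ typePart M τ), L i := by
  classical
  have hb : ∀ τ : T, ∃ (r : ℕ) (e : ℕ → M), IsPartBasis M (τ : GType) (Finset.Icc 1 r) e :=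
    fun τ => (hB.lattice τ τ.2).exists_isPartBasis
  choose r e he using hb
  let ι := (τ : T) × (Finset.Icc 1 (r τ))
  let b : ι → divSum M T := fun x =>
    ⟨e x.1 x.2, typePart_le_divSum x.1.2 ((he x.1).mem _ x.2.2)⟩
  have hli : LinearIndependent ℤ b := by
    rw [Fintype.linearIndependent_iff]
    intro g hg
    have hg' : ∑ τ : T, ∑ i : Finset.Icc 1 (r τ), g ⟨τ, i⟩ • e τ i = 0 := by
      have := congrArg Subtype.val hg
      rw [Fintype.sum_sigma] at this
      simpa [b, AddSubgroup.val_finsetSum] using this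
    have h0 := hB.indep (fun σ => if h : σ ∈ T then
      ∑ i : Finset.Icc 1 (r ⟨σ, h⟩), g ⟨⟨σ, h⟩, i⟩ • e ⟨σ, h⟩ i else 0) (fun σ hσ => by
        simp only [hσ, dite_true]
        exact sum_mem fun i _ => zsmul_mem ((he ⟨σ, hσ⟩).mem _ i.2) _) (by
        rw [← Finset.sum_coe_sort T]
        simpa using hg')
    rintro ⟨τ, i⟩
    have h1 := h0 τ τ.2
    simp only [τ.2, dite_true, Subtype.coe_eta] at h1
    exact Fintype.linearIndependent_iff.1 (he τ).linearIndependent (fun i => g ⟨τ, i⟩) h1 i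
  -- The pure closure inside `divSum M T` stands for the line R_τ b.
  let L : ι → AddSubgroup (divSum M T) := fun x => pureClosure (AddSubgroup.zmultiples (b x))
  have hLmem : ∀ x : ι, ∀ y ∈ L x, (y : M) ∈ typePart M (x.1 : GType) := by
    rintro x y ⟨n, hn, hy⟩
    obtain ⟨z, hz⟩ := AddSubgroup.mem_zmultiples_iff.1 hy
    refine mem_divPart_of_zsmul_mem hn ?_
    have := congrArg Subtype.val hz
    simp only [AddSubgroup.coe_zsmul] at this
    rw [← this]
    exact zsmul_mem ((he x.1).mem _ x.2.2) z
  let eq := (Fintype.equivFin ι)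
  have hcover : ∀ τ ∈ T, ∀ x : divSum M T, (x : M) ∈ typePart M τ →
      x ∈ ⨆ (i : Fin (Fintype.card ι)) (_ : ∀ y ∈ L (eq.symm i), (y : M) ∈ typePart M τ),
        L (eq.symm i) := by
    intro τ hτ x hx
    obtain ⟨n, hn, z, hz⟩ := (he ⟨τ, hτ⟩).span x hx
    have hdiv : ∀ i : Finset.Icc 1 (r ⟨τ, hτ⟩), ∃ y ∈ typePart M τ, n • y = e ⟨τ, hτ⟩ i :=
      fun i => exists_mem_divPart_nsmul_eq ((he ⟨τ, hτ⟩).mem i i.2) hn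
    choose y hy hny using hdiv
    have hx' : x = ∑ i : Finset.Icc 1 (r ⟨τ, hτ⟩), z i • (⟨y i, typePart_le_divSum hτ (hy i)⟩ : divSum M T) := by
      refine Subtype.ext (nsmul_cancel hn.1 ?_)
      rw [hz, AddSubgroup.val_finsetSum, Finset.smul_sum, ← Finset.sum_coe_sort]
      refine Finset.sum_congr rfl fun i _ => ?_
      rw [← hny, AddSubgroup.coe_zsmul, smul_comm]
    rw [hx']
    refine sum_mem fun i _ => zsmul_mem ?_ _
    refine AddSubgroup.mem_iSup_of_mem (eq ⟨⟨τ, hτ⟩, i⟩) (AddSubgroup.mem_iSup_of_mem ?_ ?_)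
    · simpa using hLmem ⟨⟨τ, hτ⟩, i⟩
    · rw [eq.symm_apply_apply]
      exact ⟨n, by exact_mod_cast hn.1, AddSubgroup.mem_zmultiples_iff.2 ⟨1, Subtype.ext (by
        simp [hny, b])⟩⟩
  refine ⟨Fintype.card ι, fun i => L (eq.symm i), ⟨fun i => ?_, ?_, ?_⟩, hcover⟩
  · exact rank_pureClosure_zmultiples (hli.ne_zero _)
  · exact (iSupIndep_pureClosure_zmultiples hli).comp eq.symm.injective
  · rw [eq_top_iff]
    rintro ⟨x, f, hf, rfl⟩ -
    have : (⟨∑ τ ∈ T, f τ, f, hf, rfl⟩ : divSum M T) =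
        ∑ τ : T, ⟨f τ, typePart_le_divSum τ.2 (hf τ τ.2)⟩ := by
      refine Subtype.ext ?_
      rw [AddSubgroup.val_finsetSum]
      exact (Finset.sum_coe_sort T f).symm
    rw [this]
    refine sum_mem fun τ _ => ?_
    have hle : ⨆ (i : Fin (Fintype.card ι))
        (_ : ∀ y ∈ L (eq.symm i), (y : M) ∈ typePart M (τ : GType)), L (eq.symm i) ≤
        ⨆ i : Fin (Fintype.card ι), L (eq.symm i) :=
      iSup₂_le fun i _ => le_iSup (fun i => L (eq.symm i)) i
    exact hle (hcover τ τ.2 ⟨f τ, typePart_le_divSum τ.2 (hf τ τ.2)⟩ (hf τ τ.2))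

theorem BlockData.isCompletelyDecomposable (hB : BlockData M T) :
    IsCompletelyDecomposable (divSum M T) :=
  let ⟨n, L, hL, _⟩ := hB.exists_decomposition
  ⟨inferInstance, n, L, hL⟩

/-- `divSum M T` is completely decomposable and contains every completely decomposable subgroup of
finite index. A largest one is the only one of least index. -/
theorem BlockData.isRegulating_iff (hB : BlockData M T) {H : AddSubgroup M} :
    IsRegulating M H ↔ H = divSum M T := by
  have hfi := hB.finiteIndex
  constructor
  · intro h
    have hle := hB.le_divSum h.finiteIndex h.cd
    refine le_antisymm hle (AddSubgroup.relIndex_eq_one.1 ?_)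
    have h1 := AddSubgroup.relIndex_mul_index hle
    have h2 := h.least _ hB.isCompletelyDecomposable hfi
    have h3 := h.finiteIndex.index_ne_zero
    have h4 := hfi.index_ne_zero
    -- A relative index of at least 2 would make the index of `H` exceed that of `divSum M T`.
    rcases Nat.lt_or_ge 1 (H.relIndex (divSum M T)) with h5 | h5
    · nlinarith [Nat.pos_of_ne_zero h4]
    · interval_cases h6 : H.relIndex (divSum M T)
      · simp at h1
        exact absurd h1.symm h3
      · rfl
  · rintro rfl
    refine ⟨hB.isCompletelyDecomposable, hfi, fun H' hcd hfi' => ?_⟩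
    exact Nat.le_of_dvd (Nat.pos_of_ne_zero hfi'.index_ne_zero)
      (AddSubgroup.index_dvd_of_le (hB.le_divSum hfi' hcd))

theorem BlockData.regulator_eq (hB : BlockData M T) : regulator M = divSum M T := by
  have : {H | IsRegulating M H} = {divSum M T} := Set.ext fun H => hB.isRegulating_iff
  rw [regulator, this, sInf_singleton]

theorem BlockData.type_eq (hB : BlockData M T) {τ : GType} (hτ : τ ∈ T) {x : M}
    (hx : x ∈ typePart M τ) (hx0 : x ≠ 0) : GType.mk (charOf x) = τ :=
  let ⟨_, _, h⟩ := (hB.lattice τ hτ).exists_isPartBasis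
  h.type_eq (hB.idem τ hτ) hx hx0

/-- A summand is pure in `divSum M T` and the part is pure in M, so characteristics computed in `L
i` and in M coincide. -/
theorem BlockData.hasType_summand (hB : BlockData M T) {n : ℕ}
    {L : Fin n → AddSubgroup (divSum M T)} (hL : IsRankOneDecomposition (divSum M T) L)
    {i : Fin n} {τ : GType} (hτ : τ ∈ T) (hle : ∀ x ∈ L i, (x : M) ∈ typePart M τ) :
    HasType (L i) τ := by
  intro x hx
  rw [charOf_map_of_pure ((divSum M T).subtype.comp (L i).subtype)
    (Subtype.val_injective.comp Subtype.val_injective) x]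
  · refine hB.type_eq hτ (hle x x.2) ?_
    simpa using hx
  · intro k y hk hy
    have hy' : k • y = ((x : divSum M T) : M) := hy
    have hymem : y ∈ typePart M τ := mem_divPart_of_nsmul_mem hk (by
      rw [hy']
      exact hle x x.2)
    have := hL.isPureIn i k ⟨y, typePart_le_divSum hτ hymem⟩ hk (by
      rw [show k • (⟨y, typePart_le_divSum hτ hymem⟩ : divSum M T) = x from Subtype.ext hy']
      exact x.2)
    exact ⟨⟨_, this⟩, rfl⟩

theorem HasType.unique {H : Type*} [AddCommGroup H] {σ τ : GType} (h : HasType H σ)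
    (h' : HasType H τ) {x : H} (hx : x ≠ 0) : σ = τ := (h x hx).symm.trans (h' x hx)

/-- The sum of the rank-one summands of type `τ` of a subgroup `H`. -/
def summandPart (H : AddSubgroup M) (τ : GType) : AddSubgroup M :=
  (sSup {S : AddSubgroup H | ∃ (n : ℕ) (L : Fin n → AddSubgroup H),
    IsRankOneDecomposition H L ∧ ∃ i, HasType (L i) τ ∧ S = L i}).map H.subtype

omit [IsAddTorsionFree M] in
theorem regPart_eq_summandPart (τ : GType) : regPart M τ = summandPart (regulator M) τ := rfl

/-- A rank-one summand lies in some part and then has the type of that part, so summands of type τ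
lie in the part of type τ. The canonical decomposition shows that they exhaust it. -/
theorem BlockData.regPart_eq (hB : BlockData M T) {τ : GType} (hτ : τ ∈ T) :
    regPart M τ = typePart M τ := by
  rw [regPart_eq_summandPart, hB.regulator_eq]
  refine le_antisymm ?_ ?_
  · rw [summandPart, AddSubgroup.map_le_iff_le_comap, sSup_le_iff]
    rintro _ ⟨n, L, hL, i, hi, rfl⟩
    obtain ⟨σ, hσ, hle⟩ := hB.summand_le hB.finiteIndex hL i
    obtain ⟨x, hx, hx0⟩ := hL.exists_ne_zero i
    obtain rfl := (hB.hasType_summand hL hσ hle).unique hi (x := ⟨x, hx⟩) (by simpa using hx0)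
    exact hle
  · obtain ⟨n, L, hL, hcover⟩ := hB.exists_decomposition
    intro x hx
    refine ⟨⟨x, typePart_le_divSum hτ hx⟩, ?_, rfl⟩
    refine SetLike.le_def.1 (iSup₂_le fun i hi => ?_)
      (hcover τ hτ ⟨x, typePart_le_divSum hτ hx⟩ hx)
    exact le_sSup ⟨n, L, hL, i, hB.hasType_summand hL hτ hi, rfl⟩

theorem BlockData.regPart_eq_bot (hB : BlockData M T) {τ : GType} (hτ : τ ∉ T) :
    regPart M τ = ⊥ := by
  rw [regPart_eq_summandPart, hB.regulator_eq, summandPart, eq_bot_iff,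
    AddSubgroup.map_le_iff_le_comap, sSup_le_iff]
  rintro _ ⟨n, L, hL, i, hi, rfl⟩
  obtain ⟨σ, hσ, hle⟩ := hB.summand_le hB.finiteIndex hL i
  obtain ⟨x, hx, hx0⟩ := hL.exists_ne_zero i
  obtain rfl := (hB.hasType_summand hL hσ hle).unique hi (x := ⟨x, hx⟩) (by simpa using hx0)
  exact absurd hσ hτ

/-- `T` may contain types whose part is zero, hence the second condition. -/
theorem BlockData.mem_critTypes_iff (hB : BlockData M T) {τ : GType} :
    τ ∈ critTypes M ↔ τ ∈ T ∧ typePart M τ ≠ ⊥ := by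
  by_cases hτ : τ ∈ T
  · simp [critTypes, hB.regPart_eq hτ, hτ]
  · simp [critTypes, hB.regPart_eq_bot hτ, hτ]

theorem BlockData.isACD (hB : BlockData M T) : IsACD M where
  torsionFree := inferInstance
  finiteRank := by
    classical
    have hfi := hB.finiteIndex
    have hb : ∀ τ : T, ∃ (r : ℕ) (e : ℕ → M), IsPartBasis M (τ : GType) (Finset.Icc 1 r) e :=
      fun τ => (hB.lattice τ τ.2).exists_isPartBasis
    choose r e he using hb
    let b : ((τ : T) × (Finset.Icc 1 (r τ))) → M := fun x => e x.1 x.2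
    let N := Submodule.span ℤ (Set.range b)
    have : Module.Finite ℤ N := Module.Finite.span_of_finite ℤ (Set.finite_range b)
    rw [rank_eq_of_torsion_quotient N]
    · exact Module.rank_lt_aleph0 ℤ N
    · intro x
      suffices h : x ∈ pureClosure N.toAddSubgroup from h
      refine mem_pureClosure_of_zsmul (n := (divSum M T).index)
        (by exact_mod_cast hfi.index_ne_zero) ?_
      obtain ⟨f, hf, hfx⟩ := (divSum M T).nsmul_index_mem x
      rw [natCast_zsmul, ← hfx]
      refine sum_mem fun τ hτ => ?_
      obtain ⟨n, hn, z, hz⟩ := (he ⟨τ, hτ⟩).span _ (hf τ hτ)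
      refine ⟨n, by exact_mod_cast hn.1, ?_⟩
      rw [natCast_zsmul, hz]
      refine sum_mem fun i hi => N.smul_mem _ (Submodule.subset_span ?_)
      exact ⟨⟨⟨τ, hτ⟩, ⟨i, hi⟩⟩, rfl⟩
  exists_cd := ⟨_, hB.isCompletelyDecomposable, hB.finiteIndex⟩

/-- A nonzero element of a part has exactly the type of that part. This is what makes products of
elements from different parts vanish. -/
theorem BlockData.eq_of_mem (hB : BlockData M T) {σ τ : GType} (hσ : σ ∈ T) (hτ : τ ∈ T) {x : M}
    (hx : x ∈ typePart M σ) (hx' : x ∈ typePart M τ) (hx0 : x ≠ 0) : σ = τ :=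
  (hB.type_eq hσ hx hx0).symm.trans (hB.type_eq hτ hx' hx0)

/-- If σ ≤ τ, the part of type τ lies in that of type σ, and a nonzero element of it would have both
types. -/
theorem BlockData.isBlockRigid (hB : BlockData M T) : IsBlockRigid M where
  toIsACD := hB.isACD
  antichain := by
    intro σ hσ τ hτ hne hle
    rw [hB.mem_critTypes_iff] at hσ hτ
    obtain ⟨⟨x, hx⟩, hx0⟩ := AddSubgroup.ne_bot_iff_exists_ne_zero.1 hτ.2
    replace hx0 : x ≠ 0 := by simpa using hx0
    exact hne (hB.eq_of_mem hσ.1 hτ.1 (divPart_anti (PInf_subset_of_le hle) hx) hx hx0)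

theorem BlockData.isRingType (hB : BlockData M T) : IsRingType M := fun τ hτ =>
  hB.idem τ (hB.mem_critTypes_iff.1 hτ).1

end Recognition

/-! ### Direct summands -/

section Retract

variable {M : Type*} [AddCommGroup M] {T : Finset GType}

theorem exists_retraction {H C : AddSubgroup M} (h : IsCompl H C) :
    ∃ p : M →+ H, (∀ x : H, p x = x) ∧ ∀ x ∈ C, p x = 0 := by
  have h' : IsCompl (AddSubgroup.toIntSubmodule H) (AddSubgroup.toIntSubmodule C) :=
    (OrderIso.isCompl_iff _).1 h
  refine ⟨(Submodule.projectionOnto _ _ h').toAddMonoidHom, fun x => ?_, fun x hx => ?_⟩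
  · exact Submodule.projectionOnto_apply_left h' x
  · exact (Submodule.projectionOnto_apply_eq_zero_iff h').2 hx

theorem mem_divPart_of_retract {H : AddSubgroup M} {p : M →+ H} (hp : ∀ x : H, p x = x)
    {S : Set ℕ} {x : H} : x ∈ divPart H S ↔ (x : M) ∈ divPart M S :=
  ⟨fun h => map_mem_divPart H.subtype h, fun h => hp x ▸ map_mem_divPart p h⟩

theorem mem_divSum_of_retract {H : AddSubgroup M} {p : M →+ H} (hp : ∀ x : H, p x = x)
    {x : H} : x ∈ divSum H T ↔ (x : M) ∈ divSum M T := by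
  constructor
  · rintro ⟨f, hf, rfl⟩
    exact ⟨fun τ => f τ, fun τ hτ => map_mem_divPart H.subtype (hf τ hτ), by
      rw [AddSubgroup.val_finsetSum]⟩
  · rintro ⟨f, hf, hx⟩
    refine ⟨fun τ => p (f τ), fun τ hτ => map_mem_divPart p (hf τ hτ), ?_⟩
    rw [← map_sum, hx, hp]

/-- Inclusion and retraction both preserve divisibility, so parts and their sum simply restrict to a
direct summand. This serves G₁ and C inside G as well as M' and M'' inside Mult G. -/
theorem BlockData.retract (hB : BlockData M T) {H : AddSubgroup M} {p : M →+ H}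
    (hp : ∀ x : H, p x = x) : BlockData H T where
  idem := hB.idem
  lattice := fun τ hτ => by
    obtain ⟨N, hfg, hN, hspan⟩ := hB.lattice τ hτ
    refine ⟨N.map p.toIntLinearMap, hfg.map _, ?_, fun x hx => ?_⟩
    · rintro _ ⟨x, hx, rfl⟩
      exact map_mem_divPart p (hN x hx)
    · obtain ⟨n, hn, hnx⟩ := hspan x (map_mem_divPart H.subtype hx)
      exact ⟨n, hn, n • (x : M), hnx, by simp [hp]⟩
  indep := fun f hf h0 τ hτ => by
    have := hB.indep (fun τ => f τ) (fun τ hτ => map_mem_divPart H.subtype (hf τ hτ)) (by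
      rw [← AddSubgroup.val_finsetSum, h0, AddSubgroup.coe_zero]) τ hτ
    exact Subtype.ext this
  finiteIndex := by
    have hfi := hB.finiteIndex
    have : divSum H T = (divSum M T).addSubgroupOf H :=
      AddSubgroup.ext fun x => mem_divSum_of_retract hp
    rw [this]
    infer_instance

end Retract

/-! ### Generators of the regulator quotient -/

section Generators

variable {M : Type*} [AddCommGroup M]

theorem generatesQuotient_iff {d : M} :
    GeneratesQuotient d ↔ ∀ x, ∃ k : ℤ, x - k • d ∈ regulator M := by
  rw [GeneratesQuotient, AddSubgroup.eq_top_iff']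
  constructor
  · intro h x
    obtain ⟨k, hk⟩ := AddSubgroup.mem_zmultiples_iff.1 (h x)
    refine ⟨k, ?_⟩
    rw [← QuotientAddGroup.eq_zero_iff, QuotientAddGroup.mk_sub, QuotientAddGroup.mk_zsmul, hk,
      sub_self]
  · intro h x
    obtain ⟨x, rfl⟩ := QuotientAddGroup.mk_surjective x
    obtain ⟨k, hk⟩ := h x
    refine AddSubgroup.mem_zmultiples_iff.2 ⟨k, ?_⟩
    rw [← QuotientAddGroup.eq_zero_iff, QuotientAddGroup.mk_sub, QuotientAddGroup.mk_zsmul,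
      sub_eq_zero] at hk
    exact hk.symm

theorem GeneratesQuotient.isAddCyclic {d : M} (h : GeneratesQuotient d) :
    IsAddCyclic (M ⧸ regulator M) :=
  ⟨QuotientAddGroup.mk d, (AddSubgroup.eq_top_iff' _).1 h⟩

theorem exists_generatesQuotient (h : IsAddCyclic (M ⧸ regulator M)) :
    ∃ d : M, GeneratesQuotient d := by
  obtain ⟨g, hg⟩ := h.exists_generator
  obtain ⟨d, rfl⟩ := QuotientAddGroup.mk_surjective g
  exact ⟨d, (AddSubgroup.eq_top_iff' _).2 hg⟩

theorem GeneratesQuotient.regIndex_dvd_iff {d : M} (h : GeneratesQuotient d) {k : ℕ} :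
    regIndex M ∣ k ↔ k • d ∈ regulator M := by
  rw [regIndex, AddSubgroup.index_eq_card,
    ← addOrderOf_eq_card_of_forall_mem_zmultiples (g := (QuotientAddGroup.mk d : M ⧸ regulator M))
      ((AddSubgroup.eq_top_iff' _).1 h), addOrderOf_dvd_iff_nsmul_eq_zero,
    ← QuotientAddGroup.mk_nsmul, QuotientAddGroup.eq_zero_iff]

end Generators

/-! ### The divisible hull -/

section Hull

variable {M : Type*} [AddCommGroup M]

/-- The embedding of a torsion-free group into its divisible hull. -/
abbrev toHull (M : Type*) [AddCommGroup M] : M →+ DivisibleHull M :=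
  DivisibleHull.coeAddMonoidHom M

theorem exists_nsmul_eq_toHull (v : DivisibleHull M) : ∃ n : ℕ, n ≠ 0 ∧ ∃ x : M, n • v = toHull M x := by
  induction v with
  | mk m s =>
    refine ⟨s, s.pos.ne', m, ?_⟩
    rw [DivisibleHull.nsmul_mk]
    change _ = DivisibleHull.mk m 1
    rw [DivisibleHull.mk_eq_mk]
    exact ⟨1, by simp⟩

theorem hull_nsmul_cancel {n : ℕ} (hn : n ≠ 0) {v w : DivisibleHull M} (h : n • v = n • w) :
    v = w := by
  rw [← Nat.cast_smul_eq_nsmul ℚ, ← Nat.cast_smul_eq_nsmul ℚ n w] at h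
  exact smul_right_injective _ (show (n : ℚ) ≠ 0 by exact_mod_cast hn) h

/-- The subspace of the divisible hull spanned by a subgroup. -/
def hullSpan (H : AddSubgroup M) : Submodule ℚ (DivisibleHull M) :=
  Submodule.span ℚ (toHull M '' H)

theorem toHull_mem_hullSpan {H : AddSubgroup M} {x : M} (hx : x ∈ H) : toHull M x ∈ hullSpan H :=
  Submodule.subset_span ⟨x, hx, rfl⟩

theorem mem_hullSpan_of_nsmul {W : Submodule ℚ (DivisibleHull M)} {n : ℕ} (hn : n ≠ 0)
    {v : DivisibleHull M} (h : n • v ∈ W) : v ∈ W := by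
  rw [← Nat.cast_smul_eq_nsmul ℚ] at h
  exact (W.smul_mem_iff (by exact_mod_cast hn)).1 h

theorem exists_of_mem_hullSpan {H : AddSubgroup M} {v : DivisibleHull M} (hv : v ∈ hullSpan H) :
    ∃ n : ℕ, n ≠ 0 ∧ ∃ x ∈ H, n • v = toHull M x := by
  induction hv using Submodule.span_induction with
  | mem v hv =>
    obtain ⟨x, hx, rfl⟩ := hv
    exact ⟨1, one_ne_zero, x, hx, one_smul _ _⟩
  | zero => exact ⟨1, one_ne_zero, 0, zero_mem _, by simp⟩
  | add v w _ _ hv hw =>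
    obtain ⟨m, hm, x, hx, e⟩ := hv
    obtain ⟨n, hn, y, hy, e'⟩ := hw
    refine ⟨m * n, mul_ne_zero hm hn, n • x + m • y,
      add_mem (nsmul_mem hx n) (nsmul_mem hy m), ?_⟩
    rw [nsmul_add, mul_smul, mul_smul, smul_comm m n v, e, e', map_add, map_nsmul, map_nsmul]
  | smul q v _ hv =>
    obtain ⟨m, hm, x, hx, e⟩ := hv
    refine ⟨q.den * m, mul_ne_zero q.den_nz hm, q.num • x, zsmul_mem hx _, ?_⟩
    rw [mul_smul, smul_comm m q v, e, map_zsmul, ← Nat.cast_smul_eq_nsmul ℚ, smul_smul,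
      ← Int.cast_smul_eq_zsmul ℚ]
    congr 1
    rw [mul_comm, Rat.mul_den_eq_num]

variable [IsAddTorsionFree M] {T : Finset GType}

theorem toHull_injective : Function.Injective (toHull M) := DivisibleHull.coe_injective

theorem BlockData.hullPart_eq (hB : BlockData M T) {τ : GType} (hτ : τ ∈ T) :
    hullPart M τ = hullSpan (typePart M τ) := by
  rw [hullPart, hB.regPart_eq hτ]
  rfl

open Classical in
theorem BlockData.iSup_hullPart_le (hB : BlockData M T) (τ : GType) :
    ⨆ (σ : GType) (_ : σ ≠ τ), hullPart M σ ≤ hullSpan (divSum M (T.erase τ)) := by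
  refine iSup₂_le fun σ hσ => ?_
  by_cases hσT : σ ∈ T
  · rw [hB.hullPart_eq hσT]
    exact Submodule.span_mono (Set.image_mono (typePart_le_divSum (Finset.mem_erase.2 ⟨hσ, hσT⟩)))
  · rw [hullPart, hB.regPart_eq_bot hσT, Submodule.span_le]
    rintro _ ⟨x, hx, rfl⟩
    rw [show x = 0 from hx, map_zero]
    exact zero_mem _

/-- Ensures that `typeProj` is a genuine projection and not its default value 0. -/
theorem BlockData.isCompl_hullPart (hB : BlockData M T) {τ : GType} (hτ : τ ∈ T) :
    IsCompl (hullPart M τ) (⨆ (σ : GType) (_ : σ ≠ τ), hullPart M σ) := by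
  classical
  have hfi := hB.finiteIndex
  refine ⟨?_, ?_⟩
  · refine Disjoint.mono_right (hB.iSup_hullPart_le τ) ?_
    rw [hB.hullPart_eq hτ, Submodule.disjoint_def]
    intro v hv hv'
    obtain ⟨m, hm, x, hx, e⟩ := exists_of_mem_hullSpan hv
    obtain ⟨n, hn, _, ⟨f, hf, rfl⟩, e'⟩ := exists_of_mem_hullSpan hv'
    have h1 : n • x = m • ∑ σ ∈ T.erase τ, f σ := toHull_injective (by
      rw [map_nsmul, map_nsmul, ← e, ← e', smul_comm])
    have h2 := hB.indep (fun σ => if σ = τ then -(n • x) else m • f σ) (fun σ hσ => by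
      split_ifs with h
      · exact neg_mem (nsmul_mem (h ▸ hx) n)
      · exact nsmul_mem (hf σ (Finset.mem_erase.2 ⟨h, hσ⟩)) m) (by
      rw [← Finset.add_sum_erase T _ hτ, if_pos rfl, h1, Finset.smul_sum, neg_add_eq_zero]
      exact (Finset.sum_congr rfl fun σ hσ => by rw [if_neg (Finset.ne_of_mem_erase hσ)]).symm) τ hτ
    rw [if_pos rfl, neg_eq_zero] at h2
    refine hull_nsmul_cancel (mul_ne_zero hn hm) ?_
    rw [mul_smul, e, ← map_nsmul, h2, map_zero, nsmul_zero]
  · rw [codisjoint_iff, eq_top_iff]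
    intro v _
    obtain ⟨n, hn, x, e⟩ := exists_nsmul_eq_toHull v
    obtain ⟨f, hf, hfx⟩ := (divSum M T).nsmul_index_mem x
    refine mem_hullSpan_of_nsmul (mul_ne_zero hfi.index_ne_zero hn) ?_
    rw [mul_smul, e, ← map_nsmul, ← hfx, map_sum]
    refine sum_mem fun σ hσ => ?_
    have hmem : toHull M (f σ) ∈ hullPart M σ := by
      rw [hB.hullPart_eq hσ]
      exact toHull_mem_hullSpan (hf σ hσ)
    rcases eq_or_ne σ τ with rfl | hne
    · exact Submodule.mem_sup_left hmem
    · exact Submodule.mem_sup_right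
        (Submodule.mem_iSup_of_mem σ (Submodule.mem_iSup_of_mem hne hmem))

/-- Clearing denominators by N expresses the projection in the hull through a component in M itself.
-/
theorem BlockData.typeProj_toHull (hB : BlockData M T) {τ : GType} (hτ : τ ∈ T) {N : ℕ} {d : M}
    {f : GType → M} (hf : ∀ σ ∈ T, f σ ∈ typePart M σ) (hd : N • d = ∑ σ ∈ T, f σ) :
    N • typeProj M τ (toHull M d) = toHull M (f τ) := by
  classical
  have hc := hB.isCompl_hullPart hτ
  have hmem : ∀ σ ∈ T, toHull M (f σ) ∈ hullPart M σ := fun σ hσ => by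
    rw [hB.hullPart_eq hσ]
    exact toHull_mem_hullSpan (hf σ hσ)
  rw [typeProj, dif_pos hc, ← map_nsmul, ← map_nsmul, hd, ← Finset.add_sum_erase T f hτ, map_add,
    map_add, Submodule.projection_apply_of_mem_left hc (hmem τ hτ),
    Submodule.projection_apply_of_mem_right hc, add_zero]
  rw [map_sum]
  refine sum_mem fun σ hσ => ?_
  exact Submodule.mem_iSup_of_mem σ (Submodule.mem_iSup_of_mem (Finset.ne_of_mem_erase hσ)
    (hmem σ (Finset.mem_of_mem_erase hσ)))

/-- The element kπ_τ(d) is k f(τ)/N, and by purity it can lie in the regulator only as an element of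
the part of type τ. After this the hull is no longer needed to compute orders. -/
theorem BlockData.componentOrder_dvd_iff (hB : BlockData M T) {τ : GType} (hτ : τ ∈ T) {N : ℕ}
    (hN : N ≠ 0) {d : M} {f : GType → M} (hf : ∀ σ ∈ T, f σ ∈ typePart M σ)
    (hd : N • d = ∑ σ ∈ T, f σ) {k : ℕ} :
    componentOrder τ d ∣ k ↔ ∃ b ∈ typePart M τ, k • f τ = N • b := by
  have hproj := hB.typeProj_toHull hτ hf hd
  rw [componentOrder, addOrderOf_dvd_iff_nsmul_eq_zero, ← QuotientAddGroup.mk_nsmul,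
    QuotientAddGroup.eq_zero_iff, hullRegulator, AddSubgroup.mem_map]
  constructor
  · rintro ⟨b, -, hb⟩
    have e : k • f τ = N • b := toHull_injective (by
      rw [map_nsmul, map_nsmul, ← hproj, hb, smul_comm])
    exact ⟨b, mem_divPart_of_nsmul_mem hN (e ▸ nsmul_mem (hf τ hτ) k), e⟩
  · rintro ⟨b, hb, e⟩
    refine ⟨b, ?_, hull_nsmul_cancel hN ?_⟩
    · rw [hB.regulator_eq]
      exact typePart_le_divSum hτ hb
    · rw [← map_nsmul, ← e, map_nsmul, ← hproj, smul_comm]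

omit [IsAddTorsionFree M] in
theorem BlockData.component_eq (hB : BlockData M T) {f g : GType → M}
    (hf : ∀ σ ∈ T, f σ ∈ typePart M σ) (hg : ∀ σ ∈ T, g σ ∈ typePart M σ)
    (h : ∑ σ ∈ T, f σ = ∑ σ ∈ T, g σ) {τ : GType} (hτ : τ ∈ T) : f τ = g τ :=
  sub_eq_zero.1 (hB.indep (fun σ => f σ - g σ) (fun σ hσ => sub_mem (hf σ hσ) (hg σ hσ))
    (by rw [Finset.sum_sub_distrib, h, sub_self]) τ hτ)

theorem BlockData.mInv_dvd_iff (hB : BlockData M T) {τ : GType} (hτ : τ ∈ T) {N : ℕ} (hN : N ≠ 0)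
    {d : M} (hgen : GeneratesQuotient d) {f : GType → M} (hf : ∀ σ ∈ T, f σ ∈ typePart M σ)
    (hd : N • d = ∑ σ ∈ T, f σ) {k : ℕ} :
    mInv M τ ∣ k ↔ ∃ b ∈ typePart M τ, k • f τ = N • b := by
  have hfi := hB.finiteIndex
  have hex : ∃ d : M, GeneratesQuotient d := ⟨d, hgen⟩
  rw [mInv, dif_pos hex, ← hB.componentOrder_dvd_iff hτ hN hf hd]
  -- Independence of the generator chosen in `mInv`: modulo the regulator d is a multiple of the
  -- generator d', so the order of its component divides that of d'. Both directions are then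
  -- applied.
  have key : ∀ {d d' : M}, GeneratesQuotient d' →
      componentOrder τ d ∣ componentOrder τ d' := by
    intro d d' hgen'
    obtain ⟨j, hj⟩ := generatesQuotient_iff.1 hgen' d
    rw [hB.regulator_eq] at hj
    obtain ⟨a, ha, haj⟩ := hj
    obtain ⟨g, hg, hgd⟩ := (divSum M T).nsmul_index_mem d'
    have hN' := hfi.index_ne_zero
    obtain ⟨b, hb, e⟩ := (hB.componentOrder_dvd_iff hτ hN' hg hgd.symm).1 dvd_rfl
    refine (hB.componentOrder_dvd_iff hτ hN' (d := d)
      (f := fun σ => j • g σ + (divSum M T).index • a σ)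
      (fun σ hσ => add_mem (zsmul_mem (hg σ hσ) j) (nsmul_mem (ha σ hσ) _)) ?_).2 ?_
    · rw [Finset.sum_add_distrib, ← Finset.smul_sum, ← Finset.smul_sum, haj, hgd, smul_sub,
        smul_comm j]
      abel
    · refine ⟨j • b + componentOrder τ d' • a τ,
        add_mem (zsmul_mem hb j) (nsmul_mem (ha τ hτ) _), ?_⟩
      rw [smul_add, smul_comm _ j, e, smul_comm j, smul_add,
        smul_comm (componentOrder τ d')]
  rw [Nat.dvd_antisymm (key hgen) (key hex.choose_spec)]

theorem BlockData.mInv_ne_zero (hB : BlockData M T) {τ : GType} (hτ : τ ∈ T) {d : M}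
    (hgen : GeneratesQuotient d) : mInv M τ ≠ 0 := by
  have hfi := hB.finiteIndex
  obtain ⟨f, hf, hfd⟩ := (divSum M T).nsmul_index_mem d
  have hN := hfi.index_ne_zero
  exact fun h => hN (Nat.eq_zero_of_zero_dvd (h ▸
    (hB.mInv_dvd_iff hτ hN hgen hf hfd.symm).2 ⟨f τ, hf τ hτ, rfl⟩))

/-- kd lies in the regulator iff each of its components does; thus the regulator index is the least
common multiple of the m_τ. -/
theorem BlockData.regIndex_dvd_iff (hB : BlockData M T) {d : M} (hgen : GeneratesQuotient d)
    {k : ℕ} : regIndex M ∣ k ↔ ∀ τ ∈ T, mInv M τ ∣ k := by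
  have hfi := hB.finiteIndex
  obtain ⟨f, hf, hfd⟩ := (divSum M T).nsmul_index_mem d
  have hN := hfi.index_ne_zero
  rw [hgen.regIndex_dvd_iff, hB.regulator_eq]
  constructor
  · rintro ⟨a, ha, hak⟩ τ hτ
    refine (hB.mInv_dvd_iff hτ hN hgen hf hfd.symm).2 ⟨a τ, ha τ hτ, ?_⟩
    refine hB.component_eq (f := fun σ => k • f σ) (g := fun σ => (divSum M T).index • a σ)
      (fun σ hσ => nsmul_mem (hf σ hσ) k) (fun σ hσ => nsmul_mem (ha σ hσ) _) ?_ hτ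
    rw [← Finset.smul_sum, ← Finset.smul_sum, hfd, hak, smul_comm]
  · intro h
    have hb : ∀ τ : GType, ∃ b, τ ∈ T → b ∈ typePart M τ ∧ k • f τ = (divSum M T).index • b := by
      intro τ
      by_cases hτ : τ ∈ T
      · obtain ⟨b, hb, e⟩ := (hB.mInv_dvd_iff hτ hN hgen hf hfd.symm).1 (h τ hτ)
        exact ⟨b, fun _ => ⟨hb, e⟩⟩
      · exact ⟨0, fun h => absurd h hτ⟩
    choose b hb using hb
    refine ⟨b, fun τ hτ => (hb τ hτ).1, nsmul_cancel hN ?_⟩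
    rw [Finset.smul_sum, ← Finset.sum_congr rfl fun τ hτ => (hb τ hτ).2, ← Finset.smul_sum, hfd,
      smul_comm]

/-- A summand containing a generator of the regulator quotient has the same invariants. -/
theorem BlockData.generatesQuotient_retract (hB : BlockData M T) {H : AddSubgroup M} {p : M →+ H}
    (hp : ∀ x : H, p x = x) {d : H} (hgen : GeneratesQuotient (d : M)) : GeneratesQuotient d := by
  rw [generatesQuotient_iff] at hgen ⊢
  intro x
  obtain ⟨k, hk⟩ := hgen x
  refine ⟨k, ?_⟩
  rw [(hB.retract hp).regulator_eq, mem_divSum_of_retract hp]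
  rwa [hB.regulator_eq] at hk

theorem BlockData.mInv_retract (hB : BlockData M T) {H : AddSubgroup M} {p : M →+ H}
    (hp : ∀ x : H, p x = x) {d : H} (hgen : GeneratesQuotient (d : M)) {τ : GType} (hτ : τ ∈ T) :
    mInv H τ = mInv M τ := by
  have hB' := hB.retract hp
  have hfi := hB'.finiteIndex
  obtain ⟨f, hf, hfd⟩ := (divSum H T).nsmul_index_mem d
  have hN := hfi.index_ne_zero
  have hgen' := hB.generatesQuotient_retract hp hgen
  refine Nat.dvd_right_iff_eq.1 fun k => ?_
  rw [hB'.mInv_dvd_iff hτ hN hgen' hf hfd.symm,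
    hB.mInv_dvd_iff hτ hN hgen (f := fun σ => (f σ : M))
      (fun σ hσ => map_mem_divPart H.subtype (hf σ hσ)) (by
        rw [← AddSubgroup.coe_nsmul, ← hfd, AddSubgroup.val_finsetSum])]
  constructor
  · rintro ⟨b, hb, e⟩
    exact ⟨b, map_mem_divPart H.subtype hb, congrArg Subtype.val e⟩
  · rintro ⟨b, hb, e⟩
    refine ⟨p b, map_mem_divPart p hb, ?_⟩
    rw [← map_nsmul, ← e, map_nsmul, hp]

end Hull

/-! ### Block data of groups in the class `𝒜₀` -/

section FromClass

variable {M : Type*} [AddCommGroup M]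

theorem exists_regulating (h : IsACD M) : ∃ H, IsRegulating M H := by
  classical
  have hex : ∃ k, ∃ H : AddSubgroup M, IsCompletelyDecomposable H ∧ H.FiniteIndex ∧ H.index = k :=
    let ⟨H, h1, h2⟩ := h.exists_cd
    ⟨_, H, h1, h2, rfl⟩
  obtain ⟨H, h1, h2, h3⟩ := Nat.find_spec hex
  exact ⟨H, h1, h2, fun H' h1' h2' => h3 ▸ Nat.find_min' hex ⟨H', h1', h2', rfl⟩⟩

theorem regulator_le_of_isRegulating {H : AddSubgroup M} (h : IsRegulating M H) :
    regulator M ≤ H := sInf_le h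

/-- Subgroups of a finite cyclic group are determined by their index, so membership in H depends on
H only through `H.index`. -/
theorem mem_isRegulating_iff {H : AddSubgroup M} (h : IsRegulating M H) {d : M}
    (hd : GeneratesQuotient d) {x : M} {k : ℤ} (hk : x - k • d ∈ regulator M) :
    x ∈ H ↔ (H.index : ℤ) ∣ k := by
  have hle := regulator_le_of_isRegulating h
  have hgen : ∀ y : M ⧸ H, y ∈ AddSubgroup.zmultiples (QuotientAddGroup.mk d : M ⧸ H) := by
    intro y
    obtain ⟨y, rfl⟩ := QuotientAddGroup.mk_surjective y
    obtain ⟨j, hj⟩ := generatesQuotient_iff.1 hd y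
    refine AddSubgroup.mem_zmultiples_iff.2 ⟨j, ?_⟩
    have := (QuotientAddGroup.eq_zero_iff _).2 (hle hj)
    rw [QuotientAddGroup.mk_sub, QuotientAddGroup.mk_zsmul, sub_eq_zero] at this
    exact this.symm
  rw [AddSubgroup.index_eq_card, ← addOrderOf_eq_card_of_forall_mem_zmultiples hgen,
    addOrderOf_dvd_iff_zsmul_eq_zero, ← QuotientAddGroup.mk_zsmul, QuotientAddGroup.eq_zero_iff]
  constructor
  · intro hx
    have := sub_mem hx (hle hk)
    simpa using this
  · intro hx
    have := add_mem (hle hk) hx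
    simpa using this

/-- The regulator of a `CRQ`-group is the only completely decomposable subgroup of least index. -/
theorem IsCRQ.isRegulating_regulator (h : IsCRQ M) : IsRegulating M (regulator M) := by
  obtain ⟨H, hH⟩ := exists_regulating h.toIsACD
  obtain ⟨d, hd⟩ := exists_generatesQuotient h.cyclic
  have huniq : ∀ H', IsRegulating M H' → H' = H := by
    intro H' hH'
    ext x
    obtain ⟨k, hk⟩ := generatesQuotient_iff.1 hd x
    rw [mem_isRegulating_iff hH' hd hk, mem_isRegulating_iff hH hd hk,
      le_antisymm (hH.least _ hH'.cd hH'.finiteIndex) (hH'.least _ hH.cd hH.finiteIndex)]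
  have : regulator M = H := le_antisymm (regulator_le_of_isRegulating hH)
    (le_sInf fun H' hH' => (huniq H' hH').ge)
  rwa [this]

variable [IsAddTorsionFree M]

omit [IsAddTorsionFree M] in
theorem nsmul_eq_of_coprime_dvd {a b : ℕ} (hab : a.Coprime b) {x y z : M}
    (hy : a • y = x) (hz : b • z = x) : ∃ w, (a * b) • w = x := by
  obtain ⟨w, rfl⟩ := exists_nsmul_eq_of_coprime hab (hy.trans hz.symm)
  exact ⟨w, by rw [mul_smul, hy]⟩

omit [IsAddTorsionFree M] in
theorem exists_prod_nsmul_eq {F : Finset Nat.Primes} {k : Nat.Primes → ℕ} {x : M}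
    (h : ∀ p ∈ F, ∃ y, (p : ℕ) ^ k p • y = x) : ∃ y, (∏ p ∈ F, (p : ℕ) ^ k p) • y = x := by
  classical
  induction F using Finset.induction_on with
  | empty => exact ⟨x, by simp⟩
  | insert q F hq ih =>
    obtain ⟨y, hy⟩ := h q (by simp)
    obtain ⟨z, hz⟩ := ih fun p hp => h p (by simp [hp])
    rw [Finset.prod_insert hq]
    refine nsmul_eq_of_coprime_dvd ?_ hy hz
    refine Nat.Coprime.prod_right fun p hp => Nat.Coprime.pow _ _ ?_
    exact (Nat.coprime_primes q.2 p.2).2 fun e => hq ((Subtype.ext e : q = p) ▸ hp)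

omit [IsAddTorsionFree M] in
/-- An element of idempotent type is a multiple of an element whose characteristic has values
`0` and `∞` only. -/
theorem exists_not_dvd {τ : GType} (hτ : τ.IsIdempotent) {x : M} (hx0 : x ≠ 0)
    (hx : GType.mk (charOf x) = τ) : ∃ e : M, e ≠ 0 ∧ (∃ m : ℕ, m • e = x) ∧
      ∀ p : ℕ, p.Prime → p ∉ PInf τ → ¬ ∃ y, p • y = e := by
  obtain ⟨χ, rfl, hχ⟩ := hτ
  obtain ⟨hfin, hne⟩ : charEquiv (charOf x) χ := Quotient.exact hx
  obtain ⟨F, hF⟩ : ∃ F : Finset Nat.Primes, ∀ p, p ∈ F ↔ charOf x p ≠ χ p :=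
    ⟨hfin.toFinset, fun p => by rw [Set.Finite.mem_toFinset]; rfl⟩
  obtain ⟨k, hk⟩ : ∃ k : Nat.Primes → ℕ, ∀ p ∈ F, charOf x p = k p :=
    ⟨fun p => (charOf x p).toNat, fun p hp => (ENat.natCast_toNat (hne p ((hF p).1 hp)).1).symm⟩
  -- Among the finitely many primes where the characteristic of x differs from χ, all heights are
  -- finite, and χ is 0 there. Dividing by the full prime powers removes these heights.
  obtain ⟨e, he⟩ := exists_prod_nsmul_eq (F := F) (k := k) (x := x) fun p hp =>
    le_height_iff.1 (hk p hp).ge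
  refine ⟨e, ?_, ⟨_, he⟩, fun p hp hpS => ?_⟩
  · rintro rfl
    exact hx0 (by rw [← he, smul_zero])
  · rintro ⟨y, rfl⟩
    have hχ0 : χ ⟨p, hp⟩ = 0 := (hχ _).resolve_right fun h => hpS ((mem_PInf_mk hp).2 h)
    by_cases hpF : (⟨p, hp⟩ : Nat.Primes) ∈ F
    · have hle : ((k ⟨p, hp⟩ + 1 : ℕ) : ℕ∞) ≤ charOf x ⟨p, hp⟩ := by
        refine le_height_iff.2 ?_
        obtain ⟨c, hc⟩ := Finset.dvd_prod_of_mem (fun q : Nat.Primes => (q : ℕ) ^ k q) hpF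
        refine ⟨c • y, ?_⟩
        rw [← mul_smul, ← he, ← mul_smul, hc]
        congr 1
        simp only [pow_succ]
        ring
      rw [hk _ hpF, Nat.cast_le] at hle
      omega
    · have hle : ((1 : ℕ) : ℕ∞) ≤ charOf x ⟨p, hp⟩ := by
        refine le_height_iff.2 ⟨(∏ q ∈ F, (q : ℕ) ^ k q) • y, ?_⟩
        rw [smul_comm, pow_one]
        exact he
      rw [not_not.1 fun h => hpF ((hF _).2 h), hχ0] at hle
      simp at hle

/-- Take e not divisible by any prime outside `PInf τ`, and write uy = ve in lowest terms. A prime p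
outside `PInf τ` dividing u would be coprime to v and so divide e. Hence u is a product of primes in
`PInf τ`. -/
theorem exists_generator_of_hasType {τ : GType} (hτ : τ.IsIdempotent)
    (hr : Module.rank ℤ M = 1) (ht : HasType M τ) :
    ∃ e : M, ∀ x : M, ∃ n, IsSUnit (PInf τ) n ∧ ∃ z : ℤ, n • x = z • e := by
  have : Nontrivial M := by
    rw [← not_subsingleton_iff_nontrivial]
    intro hs
    simp at hr
  obtain ⟨x, hx⟩ := exists_ne (0 : M)
  obtain ⟨e, he0, -, he⟩ := exists_not_dvd hτ hx (ht x hx)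
  refine ⟨e, fun y => ?_⟩
  rcases eq_or_ne y 0 with rfl | hy
  · exact ⟨1, isSUnit_one _, 0, by simp⟩
  obtain ⟨u, v, hu, hv, huv⟩ := exists_smul_eq_of_rank_one' hr hy he0
  have hg : (Int.gcd u v : ℤ) ≠ 0 := by
    simpa [Int.gcd_eq_zero_iff] using fun h => absurd h hu
  obtain ⟨u', hu'⟩ := Int.gcd_dvd_left u v
  obtain ⟨v', hv'⟩ := Int.gcd_dvd_right u v
  have hcop : Int.gcd u' v' = 1 := by
    have h1 := Int.gcd_mul_left (Int.gcd u v) u' v'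
    rw [← hu', ← hv', Int.natAbs_natCast] at h1
    exact Nat.eq_of_mul_eq_mul_left (Nat.pos_of_ne_zero (by exact_mod_cast hg))
      (by rw [mul_one]; exact h1.symm)
  have hu'0 : u' ≠ 0 := by
    rintro rfl
    exact hu (by rw [hu', mul_zero])
  have e1 : u' • y = v' • e := zsmul_cancel hg (by
    rw [← mul_smul, ← mul_smul, ← hu', ← hv', huv])
  have e2 : ∃ z : ℤ, u'.natAbs • y = z • e ∧ z.natAbs = v'.natAbs := by
    rcases Int.natAbs_eq u' with h | h
    · exact ⟨v', by rw [← e1, ← natCast_zsmul, ← h], rfl⟩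
    · refine ⟨-v', ?_, by simp⟩
      rw [neg_smul, ← e1, ← natCast_zsmul, ← neg_smul]
      congr 1
      omega
  obtain ⟨z, hz, hzv⟩ := e2
  refine ⟨u'.natAbs, ⟨by simpa using hu'0, fun p hp hpu => ?_⟩, z, hz⟩
  by_contra hpS
  refine he p hp hpS ?_
  obtain ⟨c, hc⟩ := hpu
  have e3 : z.natAbs • e = p • ((z.sign * c) • y) := by
    rw [← natCast_zsmul, ← Int.sign_mul_self_eq_natAbs, mul_smul, ← hz, hc, mul_smul p c,
      mul_smul, natCast_zsmul, smul_comm z.sign p]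
  refine exists_nsmul_eq_of_coprime ?_ e3
  refine Nat.Coprime.symm ((hp.coprime_iff_not_dvd).2 fun hd => ?_)
  rw [hzv] at hd
  have := Nat.dvd_gcd (Dvd.intro _ hc.symm) hd
  rw [show Nat.gcd u'.natAbs v'.natAbs = 1 from hcop] at this
  exact hp.one_lt.ne' (Nat.dvd_one.1 this)

/-- T consists of the types of the rank-one summands in one decomposition of the regulator. The
point is that the part of type τ has no component in summands of other types; lattice and
independence then come from the summands of type τ alone. -/
theorem InA0.exists_blockData (hG : InA0 M) :
    ∃ T : Finset GType, BlockData M T ∧ ∀ τ, τ ∈ critTypes M ↔ τ ∈ T := by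
  classical
  have hreg := IsCRQ.isRegulating_regulator hG.toIsCRQ
  have hfi := hreg.finiteIndex
  obtain ⟨-, n, L, hL⟩ := hreg.cd
  have htype : ∀ i, ∃ τ, HasType (L i) τ := fun i => exists_hasType (hL.rank_one i)
  choose t ht using htype
  have hcrit : ∀ i, t i ∈ critTypes M := by
    intro i h0
    obtain ⟨x, hx, hx0⟩ := hL.exists_ne_zero i
    have hle : L i ≤ sSup {S : AddSubgroup (regulator M) |
        ∃ (n : ℕ) (L : Fin n → AddSubgroup (regulator M)),
          IsRankOneDecomposition (regulator M) L ∧ ∃ j, HasType (L j) (t i) ∧ S = L j} :=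
      le_sSup ⟨n, L, hL, i, ht i, rfl⟩
    have hmem : (x : M) ∈ regPart M (t i) := AddSubgroup.mem_map_of_mem _ (hle hx)
    rw [h0] at hmem
    exact hx0 (Subtype.ext hmem)
  have hidem : ∀ i, (t i).IsIdempotent := fun i => hG.ringType _ (hcrit i)
  have hgen : ∀ i, ∃ e : L i, ∀ x : L i, ∃ n, IsSUnit (PInf (t i)) n ∧ ∃ z : ℤ, n • x = z • e :=
    fun i => exists_generator_of_hasType (hidem i) (hL.rank_one i) (ht i)
  choose e he using hgen
  obtain ⟨π, hπ, hsum, hπ'⟩ := exists_projections hL.indep hL.sup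
  have hLdiv : ∀ i, ∀ x ∈ L i, ((x : regulator M) : M) ∈ typePart M (t i) := by
    intro i x hx
    rcases eq_or_ne x 0 with rfl | hx0
    · exact zero_mem _
    have h1 := mem_divPart_of_type_eq (ht i ⟨x, hx⟩ (by simpa using hx0))
    exact map_mem_divPart ((regulator M).subtype.comp (L i).subtype) h1
  let N := (regulator M).index
  have hN : N ≠ 0 := hfi.index_ne_zero
  let ν : M →+ regulator M :=
    AddMonoidHom.codRestrict (nsmulAddMonoidHom N) (regulator M)
      fun x => (regulator M).nsmul_index_mem x
  have hν : ∀ x, ((ν x : regulator M) : M) = N • x := fun x => rfl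
  have hνsum : ∀ x, ∑ i, ((π i (ν x) : regulator M) : M) = N • x := fun x => by
    rw [← AddSubgroup.val_finsetSum, hsum, hν]
  -- A nonzero image in `L i` of an element of the part of type τ would force `PInf τ ⊆ PInf (t i)`,
  -- hence τ ≤ t i, against incomparability.
  have hzero : ∀ i, ∀ τ ∈ Finset.univ.image t, ∀ x ∈ typePart M τ, t i ≠ τ → π i (ν x) = 0 := by
    intro i τ hτ x hx hne
    by_contra h0
    obtain ⟨j, -, rfl⟩ := Finset.mem_image.1 hτ
    have h1 := map_mem_divPart ((AddMonoidHom.codRestrict (π i) (L i) (hπ i)).comp ν) hx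
    have h2 := PInf_subset_type (fun p hp => prime_of_mem_PInf hp) h1
    rw [ht i _ (by simpa using h0)] at h2
    exact hne (hG.antichain.eq (hcrit j) (hcrit i) (le_of_PInf_subset (hidem j) h2)).symm
  have hB : BlockData M (Finset.univ.image t) := by
    refine ⟨?_, ?_, ?_, ?_⟩
    · intro τ hτ
      obtain ⟨j, -, rfl⟩ := Finset.mem_image.1 hτ
      exact hidem j
    · intro τ hτ
      let s : Finset (Fin n) := Finset.univ.filter fun i => t i = τ
      let b : s → M := fun i => ((e i : regulator M) : M)
      let N₀ : Submodule ℤ M := Submodule.span ℤ (Set.range b)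
      have : Module.Finite ℤ N₀ := Module.Finite.span_of_finite ℤ (Set.finite_range b)
      -- The part is not yet known to lie in the regulator, so the lattice `N₀` spanned by the
      -- generators is pulled back along multiplication by the index. This multiplication embeds
      -- `N₁` into `N₀`, so `N₁` is finitely generated.
      let N₁ : Submodule ℤ M := N₀.comap (LinearMap.lsmul ℤ M N)
      have hN₁ : ∀ x, x ∈ N₁ ↔ N • x ∈ N₀ := fun x => by simp [N₁]
      have hfg : Module.Finite ℤ N₁ := by
        let g : N₁ →ₗ[ℤ] N₀ := (LinearMap.lsmul ℤ M N).restrict fun x hx => hx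
        refine Module.Finite.of_injective g fun x y hxy => Subtype.ext (nsmul_cancel hN ?_)
        have := congrArg Subtype.val hxy
        simpa [g] using this
      refine ⟨N₁, Module.Finite.iff_fg.1 hfg, fun x hx => ?_, fun x hx => ?_⟩
      · refine mem_divPart_of_nsmul_mem hN ?_
        have hle : N₀ ≤ AddSubgroup.toIntSubmodule (typePart M τ) := by
          refine Submodule.span_le.2 ?_
          rintro _ ⟨i, rfl⟩
          exact (Finset.mem_filter.1 i.2).2 ▸ hLdiv i _ (e i).2
        exact hle ((hN₁ x).1 hx)
      · have hk : ∀ i, ∃ k, IsSUnit (PInf τ) k ∧ k • ((π i (ν x) : regulator M) : M) ∈ N₀ := by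
          intro i
          by_cases hi : t i = τ
          · obtain ⟨k, hk, z, hz⟩ := he i ⟨π i (ν x), hπ i _⟩
            refine ⟨k, hi ▸ hk, ?_⟩
            have := congrArg (fun y : L i => ((y : regulator M) : M)) hz
            rw [show k • ((π i (ν x) : regulator M) : M) = z • ((e i : regulator M) : M) from this]
            exact N₀.smul_mem z (Submodule.subset_span ⟨⟨i, by simp [s, hi]⟩, rfl⟩)
          · refine ⟨1, isSUnit_one _, ?_⟩
            rw [hzero i τ hτ x hx hi]
            simp
        choose k hk hkmem using hk
        refine ⟨∏ i, k i, IsSUnit.prod fun i _ => hk i, (hN₁ _).2 ?_⟩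
        rw [smul_comm, ← hνsum, Finset.smul_sum]
        refine sum_mem fun i _ => ?_
        obtain ⟨c, hc⟩ := Finset.dvd_prod_of_mem k (Finset.mem_univ i)
        rw [hc, mul_comm, mul_smul]
        exact nsmul_mem (hkmem i) c
    · intro f hf h0 τ hτ
      refine nsmul_cancel hN ?_
      rw [← hνsum, smul_zero]
      refine Finset.sum_eq_zero fun i _ => ?_
      by_cases hi : t i = τ
      · have h1 := congrArg (fun x => π i (ν x)) h0
        simp only [map_sum, map_zero] at h1
        rw [Finset.sum_eq_single_of_mem τ hτ fun σ hσ hne =>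
          hzero i σ hσ _ (hf σ hσ) fun h => hne (h.symm.trans hi)] at h1
        rw [h1, AddSubgroup.coe_zero]
      · rw [hzero i τ hτ _ (hf τ hτ) hi, AddSubgroup.coe_zero]
    · refine AddSubgroup.finiteIndex_of_le (H := regulator M) fun x hx => ?_
      have h1 : x = ∑ i, ((π i ⟨x, hx⟩ : regulator M) : M) := by
        rw [← AddSubgroup.val_finsetSum, hsum]
      rw [h1]
      exact sum_mem fun i _ => typePart_le_divSum (Finset.mem_image_of_mem t (Finset.mem_univ i))
        (hLdiv i _ (hπ i _))
  refine ⟨_, hB, fun τ => ⟨fun h => (hB.mem_critTypes_iff.1 h).1, fun h => ?_⟩⟩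
  obtain ⟨j, -, rfl⟩ := Finset.mem_image.1 h
  exact hcrit j

end FromClass

/-! ### Bases adapted to a generator of the regulator quotient -/

section Adapted

variable (M : Type*) [AddCommGroup M]

/-- Bases `e τ i` (`i ∈ I τ`) of all `typePart M τ` such that `d = ∑ (s τ / m_τ) e τ 0`. -/
structure AdaptedBasis (T : Finset GType) (I : GType → Finset ℕ) (e : GType → ℕ → M)
    (s : GType → ℤ) (d : M) : Prop where
  basis : ∀ τ ∈ T, IsPartBasis M τ (I τ) (e τ)
  gen : GeneratesQuotient d
  coprime : ∀ τ ∈ T, 0 ∈ I τ → IsCoprime (s τ) (mInv M τ : ℤ)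
  zero_mem_iff : ∀ τ ∈ T, 0 ∈ I τ ↔ 1 < mInv M τ
  repr : regIndex M • d =
    ∑ τ ∈ T, if 0 ∈ I τ then ((regIndex M / mInv M τ : ℕ) * s τ : ℤ) • e τ 0 else 0

variable {M} [IsAddTorsionFree M] {T : Finset GType}

omit [IsAddTorsionFree M] in
theorem IsPartBasis.of_nsmul {τ : GType} {I : Finset ℕ} {e y : ℕ → M} (h : IsPartBasis M τ I e)
    {n : ℕ} (hy : ∀ i ∈ I, y i ∈ typePart M τ) (hn : ∀ i ∈ I, n • y i = e i) :
    IsPartBasis M τ I y where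
  mem := hy
  indep := fun z hz => h.indep z (by
    rw [← smul_zero n, ← hz, Finset.smul_sum]
    exact Finset.sum_congr rfl fun i hi => by rw [← hn i hi, smul_comm])
  span := fun x hx => by
    obtain ⟨k, hk, z, hz⟩ := h.span x hx
    refine ⟨k, hk, fun i => z i * n, hz.trans (Finset.sum_congr rfl fun i hi => ?_)⟩
    rw [mul_smul, natCast_zsmul, hn i hi]

/-- Every element is a multiple of a basis element. -/
theorem HasLattice.exists_isPartBasis_of_mem {τ : GType} (h : HasLattice M τ) {v : M}
    (hv : v ∈ typePart M τ) (hv0 : v ≠ 0) : ∃ (r : ℕ) (e : ℕ → M) (c : ℤ), 0 < r ∧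
      IsPartBasis M τ (Finset.range r) e ∧ v = c • e 0 := by
  classical
  obtain ⟨N, hfg, hN, hspan⟩ := h
  have : Module.Finite ℤ N := Module.Finite.iff_fg.2 hfg
  obtain ⟨n, hn, hnv⟩ := hspan v hv
  let w : N := ⟨n • v, hnv⟩
  have hw0 : w ≠ 0 := fun h0 => hv0 (nsmul_cancel hn.1 (by
    rw [smul_zero]
    exact congrArg Subtype.val h0))
  -- Smith normal form of the cyclic subgroup generated by w = nv yields a basis of the lattice one
  -- member of which divides w.
  obtain ⟨k, bM, bN, f, a, snf⟩ := (Submodule.span ℤ {w}).smithNormalForm (Module.finBasis ℤ N)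
  have hk1 : k ≤ 1 := by
    have h1 := Module.finrank_eq_card_basis bN
    have h2 := finrank_span_le_card (R := ℤ) ({w} : Set N)
    simp only [Fintype.card_fin] at h1
    simpa [h1] using h2
  let w' : Submodule.span ℤ {w} := ⟨w, Submodule.mem_span_singleton_self w⟩
  have hsum := congrArg Subtype.val (bN.sum_repr w')
  obtain ⟨j, c, hc⟩ : ∃ (j : Fin (Module.finrank ℤ N)) (c : ℤ), w = c • bM j := by
    rcases Nat.le_one_iff_eq_zero_or_eq_one.1 hk1 with rfl | rfl
    · exfalso
      apply hw0
      simpa [w'] using hsum.symm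
    · refine ⟨f 0, bN.repr w' 0 * a 0, ?_⟩
      rw [mul_smul, ← snf]
      simpa [w'] using hsum.symm
  let r := Module.finrank ℤ N
  have hr : 0 < r := j.pos
  have σ₀ : Fin r ≃ Finset.range r := Fintype.equivOfCardEq (by simp)
  -- The transposition gives that basis vector the index 0.
  let σ : Fin r ≃ Finset.range r := σ₀.trans (Equiv.swap (σ₀ j) ⟨0, Finset.mem_range.2 hr⟩)
  have hσ : σ.symm ⟨0, Finset.mem_range.2 hr⟩ = j := by
    rw [Equiv.symm_apply_eq]
    simp [σ]
  have hb := isPartBasis_of_basis N (bM.reindex σ) hN hspan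
  -- Dividing the whole basis by n compensates for having replaced v by nv.
  have hdiv : ∀ i : ℕ, ∃ y, i ∈ Finset.range r → y ∈ typePart M τ ∧
      n • y = (fun i => if h : i ∈ Finset.range r then ((bM.reindex σ) ⟨i, h⟩ : M) else 0) i := by
    intro i
    by_cases hi : i ∈ Finset.range r
    · obtain ⟨y, hy, e⟩ := exists_mem_divPart_nsmul_eq (hb.mem i hi) hn
      exact ⟨y, fun _ => ⟨hy, e⟩⟩
    · exact ⟨0, fun h => absurd h hi⟩
  choose y hy using hdiv
  refine ⟨r, y, c, hr, hb.of_nsmul (n := n) (fun i hi => (hy i hi).1) (fun i hi => (hy i hi).2),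
    nsmul_cancel hn.1 ?_⟩
  rw [smul_comm, (hy 0 (Finset.mem_range.2 hr)).2]
  dsimp only
  rw [dif_pos (Finset.mem_range.2 hr), Module.Basis.reindex_apply, hσ]
  exact congrArg Subtype.val hc

omit [AddCommGroup M] [IsAddTorsionFree M] in
theorem eq_one_of_mul_dvd {m g c : ℕ} (hm : m ≠ 0) (h : m = g * c) (hd : m ∣ c) : g = 1 := by
  subst h
  have hg := Nat.pos_of_ne_zero (left_ne_zero_of_mul hm)
  have hc := Nat.pos_of_ne_zero (right_ne_zero_of_mul hm)
  have := Nat.le_of_dvd hc hd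
  nlinarith

/-- The part is divisible by g = gcd(n, m_τ), so a factor g could be cancelled and m_τ/g would
already annihilate the component of d. Minimality gives g = 1. -/
theorem BlockData.mInv_coprime (hB : BlockData M T) {d : M} (hgen : GeneratesQuotient d)
    {τ : GType} (hτ : τ ∈ T) {n : ℕ} (hn : IsSUnit (PInf τ) n) : n.Coprime (mInv M τ) := by
  have hfi := hB.finiteIndex
  obtain ⟨f, hf, hfd⟩ := (divSum M T).nsmul_index_mem d
  have hN := hfi.index_ne_zero
  have hm := hB.mInv_ne_zero hτ hgen
  obtain ⟨b, hb, e⟩ := (hB.mInv_dvd_iff hτ hN hgen hf hfd.symm).1 dvd_rfl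
  obtain ⟨c, hc⟩ := Nat.gcd_dvd_right n (mInv M τ)
  have hg := hn.of_dvd (Nat.gcd_dvd_left n (mInv M τ))
  rw [Nat.Coprime]
  generalize n.gcd (mInv M τ) = g at hc hg ⊢
  obtain ⟨b', hb', rfl⟩ := exists_mem_divPart_nsmul_eq hb hg
  have h1 : mInv M τ ∣ c := (hB.mInv_dvd_iff hτ hN hgen hf hfd.symm).2
    ⟨b', hb', nsmul_cancel hg.1 (by rw [← mul_smul, ← hc, e, smul_comm])⟩
  exact eq_one_of_mul_dvd hm hc h1

theorem BlockData.mInv_dvd_regIndex (hB : BlockData M T) {d : M} (hgen : GeneratesQuotient d)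
    {τ : GType} (hτ : τ ∈ T) : mInv M τ ∣ regIndex M :=
  (hB.regIndex_dvd_iff hgen).1 dvd_rfl τ hτ

omit [IsAddTorsionFree M] in
theorem GeneratesQuotient.sub_mem {d a : M} (hgen : GeneratesQuotient d)
    (ha : a ∈ regulator M) : GeneratesQuotient (d - a) := by
  rw [generatesQuotient_iff] at hgen ⊢
  intro x
  obtain ⟨k, hk⟩ := hgen x
  refine ⟨k, ?_⟩
  have := add_mem hk (zsmul_mem ha k)
  rwa [smul_sub, sub_sub_eq_add_sub, add_sub_right_comm]

theorem BlockData.regIndex_ne_zero (hB : BlockData M T) : regIndex M ≠ 0 := by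
  have hfi := hB.finiteIndex
  rw [regIndex, hB.regulator_eq]
  exact hfi.index_ne_zero

/-- Adapted bases exist. -/
theorem BlockData.exists_adaptedBasis (hB : BlockData M T) {d₀ : M}
    (hgen : GeneratesQuotient d₀) :
    ∃ (I : GType → Finset ℕ) (e : GType → ℕ → M) (s : GType → ℤ) (d : M),
      AdaptedBasis M T I e s d := by
  classical
  have hN := hB.regIndex_ne_zero
  obtain ⟨f, hf, hfd⟩ : regIndex M • d₀ ∈ divSum M T := by
    rw [← hB.regulator_eq]
    exact hgen.regIndex_dvd_iff.1 dvd_rfl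
  -- Each component of n(G)d₀ is split into n(G)b with b in the regulator and a multiple of the
  -- future e₀. Subtracting all b from d₀ leaves a generator with the desired representation.
  have key : ∀ τ : GType, ∃ (I : Finset ℕ) (e : ℕ → M) (s : ℤ) (b : M), τ ∈ T →
      b ∈ typePart M τ ∧ IsPartBasis M τ I e ∧ (0 ∈ I ↔ 1 < mInv M τ) ∧
      (0 ∈ I → IsCoprime s (mInv M τ : ℤ)) ∧
      f τ = regIndex M • b +
        if 0 ∈ I then ((regIndex M / mInv M τ : ℕ) * s : ℤ) • e 0 else 0 := by
    intro τ
    by_cases hτ : τ ∈ T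
    swap
    · exact ⟨∅, 0, 0, 0, fun h => absurd h hτ⟩
    have hdvd := fun k => hB.mInv_dvd_iff (k := k) hτ hN hgen hf hfd.symm
    have hm := hB.mInv_ne_zero hτ hgen
    obtain ⟨v, hv, hmv⟩ := (hdvd _).1 dvd_rfl
    by_cases h1 : 1 < mInv M τ
    · have hv0 : v ≠ 0 := by
        rintro rfl
        rw [smul_zero, ← smul_zero (mInv M τ)] at hmv
        have := (hdvd 1).2 ⟨0, zero_mem _, by rw [nsmul_cancel hm hmv, smul_zero, smul_zero]⟩
        exact h1.ne' (Nat.dvd_one.1 this)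
      -- Here v = m_τ π_τ(d₀) is made a multiple c e₀ of a basis element. A common factor of c and
      -- m_τ would contradict the minimality of m_τ, so c can serve as s_τ.
      obtain ⟨r, e, c, hr, he, rfl⟩ := (hB.lattice τ hτ).exists_isPartBasis_of_mem hv hv0
      have h0 : 0 ∈ Finset.range r := Finset.mem_range.2 hr
      refine ⟨Finset.range r, e, c, 0, fun _ => ⟨zero_mem _, he, iff_of_true h0 h1, fun _ => ?_, ?_⟩⟩
      · rw [Int.isCoprime_iff_gcd_eq_one]
        obtain ⟨c', hc'⟩ := Int.gcd_dvd_left c (mInv M τ)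
        obtain ⟨m', hm'⟩ := Int.gcd_dvd_natAbs_right c (mInv M τ)
        generalize Int.gcd c (mInv M τ) = g at hc' hm' ⊢
        rw [Int.natAbs_natCast] at hm'
        have hg : g ≠ 0 := by
          rintro rfl
          exact hm (by rw [hm', zero_mul])
        refine eq_one_of_mul_dvd hm hm' ((hdvd m').2
          ⟨c' • e 0, zsmul_mem (he.mem 0 h0) _, nsmul_cancel hg ?_⟩)
        rw [← mul_smul, ← hm', hmv, hc', mul_smul, natCast_zsmul, smul_comm]
      · rw [if_pos h0, smul_zero, zero_add]
        refine nsmul_cancel hm ?_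
        rw [hmv, mul_smul, natCast_zsmul, ← mul_smul (mInv M τ),
          Nat.mul_div_cancel' (hB.mInv_dvd_regIndex hgen hτ)]
    · obtain ⟨r, e, he⟩ := (hB.lattice τ hτ).exists_isPartBasis
      have h1' : mInv M τ = 1 := by omega
      have h0 : 0 ∉ Finset.Icc 1 r := by simp
      -- When m_τ = 1 the whole component lies in the regulator and is removed from d₀, so no index
      -- 0 is needed.
      refine ⟨Finset.Icc 1 r, e, 1, v, fun _ => ⟨hv, he, iff_of_false h0 h1,
        fun h => absurd h h0, ?_⟩⟩
      rw [if_neg h0, add_zero, ← hmv, h1', one_smul]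
  choose I e s b h using key
  have hb : ∑ τ ∈ T, b τ ∈ regulator M := by
    rw [hB.regulator_eq]
    exact sum_mem fun τ hτ => typePart_le_divSum hτ (h τ hτ).1
  refine ⟨I, e, s, d₀ - ∑ τ ∈ T, b τ, fun τ hτ => (h τ hτ).2.1, hgen.sub_mem hb,
    fun τ hτ => (h τ hτ).2.2.2.1, fun τ hτ => (h τ hτ).2.2.1, ?_⟩
  rw [smul_sub, ← hfd, Finset.smul_sum, ← Finset.sum_sub_distrib]
  refine Finset.sum_congr rfl fun τ hτ => ?_
  rw [sub_eq_iff_eq_add', (h τ hτ).2.2.2.2]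

end Adapted

/-! ### Adapted bases from main decompositions -/

section FromMain

variable {G : Type*} [AddCommGroup G] [IsAddTorsionFree G] {T : Finset GType}

theorem cyclicPart_le {τ : GType} {e : G} (he : e ∈ typePart G τ) :
    cyclicPart τ e ≤ (typePart G τ).map (toHull G) := by
  rintro _ ⟨q, hq, rfl⟩
  obtain ⟨y, hy, rfl⟩ := exists_mem_divPart_nsmul_eq he (mem_typeRing.1 hq)
  refine ⟨q.num • y, zsmul_mem hy _, ?_⟩
  change toHull G (q.num • y) = q • toHull G (q.den • y)
  rw [map_zsmul, map_nsmul, ← Nat.cast_smul_eq_nsmul ℚ, smul_smul, Rat.mul_den_eq_num,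
    Int.cast_smul_eq_zsmul]

omit [IsAddTorsionFree G] in
theorem zsmul_mem_cyclicPart {τ : GType} (e : G) (z : ℤ) :
    toHull G (z • e) ∈ cyclicPart τ e :=
  ⟨z, intCast_mem (typeRing τ) z, by
    change (z : ℚ) • toHull G e = _
    rw [map_zsmul, Int.cast_smul_eq_zsmul]⟩

omit [IsAddTorsionFree G] in
theorem mem_cyclicPart_of_nsmul {τ : GType} {e x : G} {n : ℕ} (hn : IsSUnit (PInf τ) n) {z : ℤ}
    (h : n • x = z • e) : toHull G x ∈ cyclicPart τ e := by
  refine ⟨(z : ℚ) / n, div_mem_typeRing z hn, hull_nsmul_cancel hn.1 ?_⟩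
  change n • (((z : ℚ) / n) • toHull G e) = _
  rw [← map_nsmul, h, map_zsmul, ← Nat.cast_smul_eq_nsmul ℚ, smul_smul,
    mul_div_cancel₀ _ (by exact_mod_cast hn.1), Int.cast_smul_eq_zsmul]

/-- The `R_τ`-span of a family, as a subgroup of `typePart G τ`. -/
def ringSpan (τ : GType) (I : Finset ℕ) (e : ℕ → G) : AddSubgroup G where
  carrier := {x | ∃ n, IsSUnit (PInf τ) n ∧ ∃ z : ℕ → ℤ, n • x = ∑ i ∈ I, z i • e i}
  zero_mem' := ⟨1, isSUnit_one _, 0, by simp⟩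
  add_mem' := by
    rintro x y ⟨m, hm, z, hz⟩ ⟨n, hn, w, hw⟩
    refine ⟨m * n, hm.mul hn, fun i => n * z i + m * w i, ?_⟩
    simp only [add_smul, mul_smul, Finset.sum_add_distrib, ← Finset.smul_sum, natCast_zsmul]
    rw [← hz, ← hw, smul_add, smul_add, smul_comm n m x]
  neg_mem' := by
    rintro x ⟨m, hm, z, hz⟩
    exact ⟨m, hm, fun i => -z i, by simp [hz]⟩

omit [IsAddTorsionFree G] in
theorem mem_ringSpan_of_mem {τ : GType} {I : Finset ℕ} {e : ℕ → G} {i : ℕ} (hi : i ∈ I) :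
    e i ∈ ringSpan τ I e :=
  ⟨1, isSUnit_one _, fun j => if j = i then 1 else 0, by simp [hi]⟩

omit [IsAddTorsionFree G] in
theorem ringSpan_of_nsmul {τ : GType} {I : Finset ℕ} {e : ℕ → G} {n : ℕ}
    (hn : IsSUnit (PInf τ) n) {x : G} (h : n • x ∈ ringSpan τ I e) : x ∈ ringSpan τ I e := by
  obtain ⟨m, hm, z, hz⟩ := h
  exact ⟨m * n, hm.mul hn, z, by rw [mul_smul, hz]⟩

omit [IsAddTorsionFree G] in
theorem zero_mem_idx {G₁ C : AddSubgroup G} {τ : GType} : 0 ∈ idx G₁ C τ ↔ τ ∈ critTypes G₁ := by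
  classical
  by_cases h : τ ∈ critTypes G₁ <;> simp [idx, h]

/-- Zero has infinite height at every prime. If it occurred in the basis, τ would be the type with
all values ∞ and the part of type τ a nonzero divisible subgroup of a reduced group. -/
theorem IsABasis.ne_zero (hG : InA0 G) (hB : BlockData G T)
    {G₁ C : AddSubgroup G} {d : G} {s : GType → ℤ} {E : GType → ℕ → G}
    (hE : IsABasis G₁ C d s E) {τ : GType} (hτ : τ ∈ critTypes G) {i : ℕ} (hi : i ∈ idx G₁ C τ) :
    E τ i ≠ 0 := by
  intro h0
  have htype := hE.char_type τ hτ i hi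
  rw [h0] at htype
  have hall : ∀ n : ℕ, n ≠ 0 → IsSUnit (PInf τ) n := fun n hn => ⟨hn, fun p hp _ => by
    rw [← htype, mem_PInf_type_iff hp]
    exact zero_mem _⟩
  refine (hB.mem_critTypes_iff.1 hτ).2 (hG.reduced _ fun n hn x hx => ?_)
  exact exists_mem_divPart_nsmul_eq hx (hall n hn)

theorem IsABasis.isPartBasis (hG : InA0 G) (hB : BlockData G T)
    (hT : ∀ τ, τ ∈ critTypes G ↔ τ ∈ T) {G₁ C : AddSubgroup G} {d : G} {s : GType → ℤ}
    {E : GType → ℕ → G} (hE : IsABasis G₁ C d s E) {τ : GType} (hτ : τ ∈ T) :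
    IsPartBasis G τ (idx G₁ C τ) (E τ) where
  mem := fun i hi => by
    rw [← hB.regPart_eq hτ]
    exact hE.mem τ ((hT τ).2 hτ) i hi
  indep := fun z hz => by
    have hτ' := (hT τ).2 hτ
    have hinj : Function.Injective fun i : idx G₁ C τ =>
        (⟨⟨τ, hτ'⟩, i⟩ : (τ : critTypes G) × idx G₁ C τ) := fun i j h => by simpa using h
    have h := iSupIndep_iff_sum.1 (hE.indep.comp hinj) (fun i => toHull G (z i • E τ i))
      (fun i => zsmul_mem_cyclicPart _ _) (by
        rw [← map_sum, Finset.sum_coe_sort (idx G₁ C τ) fun i => z i • E τ i, hz, map_zero])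
    intro i hi
    have h1 := h ⟨i, hi⟩
    rw [map_eq_zero_iff _ toHull_injective] at h1
    exact (smul_eq_zero_iff_left (hE.ne_zero hG hB hτ' hi)).1 h1
  span := fun x hx => by
    -- The lines R_σ E(σ, i) already lie in the sum of the R_σ-spans inside G. Independence of the
    -- parts then isolates the component of type τ.
    have hcover : ⨆ x : (τ : critTypes G) × idx G₁ C τ, cyclicPart (x.1 : GType) (E x.1 x.2) ≤
        (⨆ σ : T, (typePart G (σ : GType) ⊓ ringSpan σ (idx G₁ C σ) (E σ))).map (toHull G) := by
      refine iSup_le ?_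
      rintro ⟨⟨σ, hσ⟩, i, hi⟩
      have hσT := (hT σ).1 hσ
      have hmem : E σ i ∈ typePart G σ := by
        rw [← hB.regPart_eq hσT]
        exact hE.mem σ hσ i hi
      rintro _ ⟨q, hq, rfl⟩
      obtain ⟨y, hy, hye⟩ := exists_mem_divPart_nsmul_eq hmem (mem_typeRing.1 hq)
      refine ⟨q.num • y, AddSubgroup.mem_iSup_of_mem ⟨σ, hσT⟩ (zsmul_mem (K := typePart G σ ⊓
        ringSpan σ (idx G₁ C σ) (E σ)) (AddSubgroup.mem_inf.2 ⟨hy, ?_⟩) _), ?_⟩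
      · refine ringSpan_of_nsmul (mem_typeRing.1 hq) ?_
        rw [hye]
        exact mem_ringSpan_of_mem hi
      · change toHull G (q.num • y) = q • toHull G (E σ i)
        rw [← hye, map_zsmul, map_nsmul, ← Nat.cast_smul_eq_nsmul ℚ, smul_smul,
          Rat.mul_den_eq_num, Int.cast_smul_eq_zsmul]
    rw [hE.sup] at hcover
    have hxA : toHull G x ∈ hullRegulator G := by
      refine AddSubgroup.mem_map_of_mem _ ?_
      rw [hB.regulator_eq]
      exact typePart_le_divSum hτ hx
    obtain ⟨x', hx', e⟩ := hcover hxA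
    obtain rfl := toHull_injective e
    obtain ⟨v, hv, hsum⟩ := mem_iSup_iff_sum.1 hx'
    classical
    have h1 := hB.component_eq (f := fun σ => if h : σ ∈ T then v ⟨σ, h⟩ else 0)
      (g := fun σ => if σ = τ then x' else 0) (fun σ hσ => by
        simp only [hσ, dite_true]
        exact (hv ⟨σ, hσ⟩).1) (fun σ hσ => by
        split_ifs with h
        · exact h ▸ hx
        · exact zero_mem _) (by
        rw [Finset.sum_ite_eq' T τ, if_pos hτ, ← hsum, ← Finset.sum_coe_sort T]
        simp) hτ
    simp only [hτ, dite_true, if_true] at h1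
    rw [← h1]
    exact (hv ⟨τ, hτ⟩).2

/-- The standard representation is multiplied by n(G), which turns the rational coefficients s/m
into integers and leaves the hull. -/
theorem IsABasis.adaptedBasis (hG : InA0 G) (hB : BlockData G T)
    (hT : ∀ τ, τ ∈ critTypes G ↔ τ ∈ T) {G₁ C : AddSubgroup G} (hM : IsMainDecomposition G G₁ C)
    {d : G} {s : GType → ℤ} {E : GType → ℕ → G} (hE : IsABasis G₁ C d s E) :
    AdaptedBasis G T (idx G₁ C) E s d where
  basis := fun τ hτ => hE.isPartBasis hG hB hT hτ
  gen := hE.bbasis.d_gen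
  coprime := fun τ _ h0 => hE.bbasis.gcd τ (zero_mem_idx.1 h0)
  zero_mem_iff := fun τ hτ => by
    rw [zero_mem_idx, hM.types, and_iff_right ((hT τ).2 hτ)]
  repr := by
    classical
    have hset : critTypes G₁ = ((T.filter fun τ => 0 ∈ idx G₁ C τ : Finset GType) : Set GType) := by
      ext τ
      simp only [Finset.coe_filter, Set.mem_ofPred_eq, zero_mem_idx]
      exact ⟨fun h => ⟨(hT τ).1 ((hM.types τ).1 h).1, h⟩, And.right⟩
    refine toHull_injective ?_
    rw [← Finset.sum_filter, map_nsmul, map_sum]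
    have hrepr := hE.bbasis.repr
    rw [hset, finsum_mem_coe_finset] at hrepr
    rw [show toHull G d = _ from hrepr, ← Finset.sum_nsmul]
    refine Finset.sum_congr rfl fun τ hτ => ?_
    have hτT := (Finset.mem_filter.1 hτ).1
    obtain ⟨c, hc⟩ := hB.mInv_dvd_regIndex hE.bbasis.d_gen hτT
    have hm := hB.mInv_ne_zero hτT hE.bbasis.d_gen
    have hm' : (mInv G τ : ℚ) ≠ 0 := by exact_mod_cast hm
    rw [hc, Nat.mul_div_cancel_left _ (Nat.pos_of_ne_zero hm), map_zsmul,
      ← Nat.cast_smul_eq_nsmul ℚ, smul_smul, ← Int.cast_smul_eq_zsmul ℚ]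
    congr 1
    push_cast
    field_simp

/-- In a main decomposition, `typePart` of the first summand is generated by `E τ 0`. -/
theorem IsABasis.exists_zsmul_eq (hG : InA0 G) (hB : BlockData G T)
    (hT : ∀ τ, τ ∈ critTypes G ↔ τ ∈ T) {G₁ C : AddSubgroup G} (hM : IsMainDecomposition G G₁ C)
    {d : G} {s : GType → ℤ} {E : GType → ℕ → G} (hE : IsABasis G₁ C d s E) {τ : GType}
    (hτ : τ ∈ T) (h0 : 0 ∈ idx G₁ C τ) : E τ 0 ∈ G₁ ∧ ∀ x ∈ typePart G τ, x ∈ G₁ →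
      ∃ n, IsSUnit (PInf τ) n ∧ ∃ z : ℤ, n • x = z • E τ 0 := by
  classical
  have hτ₁ := zero_mem_idx.1 h0
  obtain ⟨p, hp, -⟩ := exists_retraction hM.compl
  have hB₁ := hB.retract hp
  have hbasis := hE.isPartBasis hG hB hT hτ
  have hreg : regPart G₁ τ = typePart G₁ τ := hB₁.regPart_eq hτ
  have hrank := hM.rigid.rank_one τ hτ₁
  obtain ⟨e₁, he₁, he₁'⟩ := hE.bbasis.e_mem τ hτ₁
  refine ⟨he₁' ▸ e₁.2, fun x hx hxG => ?_⟩
  obtain ⟨n, hn, z, hz⟩ := hbasis.span x hx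
  have hx₁ : (⟨x, hxG⟩ : G₁) ∈ regPart G₁ τ := by
    rw [hreg]
    exact (mem_divPart_of_retract hp).2 hx
  rcases eq_or_ne x 0 with rfl | hx0
  · exact ⟨1, isSUnit_one _, 0, by simp⟩
  obtain ⟨u, v, hu, hv, e⟩ := exists_smul_eq_of_rank_one' hrank (x := ⟨⟨x, hxG⟩, hx₁⟩)
    (y := ⟨e₁, he₁⟩) (by simpa using hx0) (by
      have := hbasis.ne_zero h0
      rw [← he₁'] at this
      simpa using this)
  have e' : u • x = v • E τ 0 := by
    rw [← he₁']
    exact congrArg (fun y : regPart G₁ τ => ((y : G₁) : G)) e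
  -- The τ-part of G₁ has rank one, so x is proportional to `E τ 0` and its other coordinates
  -- vanish.
  have h1 := hbasis.indep (fun i => u * z i - if i = 0 then n * v else 0) (by
    simp only [sub_smul, mul_smul, Finset.sum_sub_distrib, ← Finset.smul_sum, ← hz, ite_smul,
      zero_smul, Finset.sum_ite_eq', h0, if_true]
    rw [← e', natCast_zsmul, smul_comm, sub_self])
  refine ⟨n, hn, z 0, ?_⟩
  rw [hz]
  refine Finset.sum_eq_single_of_mem 0 h0 fun i hi hi0 => ?_
  have := h1 i hi
  simp only [hi0, if_false, sub_zero, mul_eq_zero, hu, false_or] at this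
  rw [this, zero_smul]

end FromMain

/-! ### Multiplications -/

section Multiplications

variable {G : Type*} [AddCommGroup G] [IsAddTorsionFree G]

instance : IsAddTorsionFree (Mult G) where
  nsmul_right_injective n hn μ ν h := by
    ext x
    exact nsmul_cancel hn (DFunLike.congr_fun h x)

/-- Left and right multiplication as homomorphisms in two variables. -/
def bilin {H : Type*} [AddCommGroup H] (μ : G ⊗[ℤ] G →+ H) : G →+ G →+ H :=
  AddMonoidHom.mk' (fun x => AddMonoidHom.mk' (fun y => μ (x ⊗ₜ[ℤ] y)) fun y z => by
    rw [TensorProduct.tmul_add, map_add]) fun x y => by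
    ext z
    simp [TensorProduct.add_tmul]

omit [IsAddTorsionFree G] in
@[simp]
theorem bilin_apply {H : Type*} [AddCommGroup H] (μ : G ⊗[ℤ] G →+ H) (x y : G) :
    bilin μ x y = μ (x ⊗ₜ[ℤ] y) := rfl

/-- Divide pointwise: quotients in G are unique, so the pointwise quotient of a homomorphism is
again a homomorphism. -/
theorem mem_typePart_mult {τ : GType} {μ : Mult G} :
    μ ∈ typePart (Mult G) τ ↔ ∀ x, μ x ∈ typePart G τ := by
  constructor
  · intro h x
    exact map_mem_divPart (AddMonoidHom.eval x) h
  · intro h n hn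
    choose y hy using fun x => h x n hn
    refine ⟨AddMonoidHom.mk' y fun a b => nsmul_cancel hn.1 ?_, ?_⟩
    · rw [smul_add, hy, hy, hy, map_add]
    · ext1 x
      exact hy x

omit [IsAddTorsionFree G] in
theorem mem_of_forall_tmul {H : Type*} [AddCommGroup H] {μ : G ⊗[ℤ] G →+ H} {A : AddSubgroup H}
    (h : ∀ x y, μ (x ⊗ₜ[ℤ] y) ∈ A) (z : G ⊗[ℤ] G) : μ z ∈ A := by
  induction z using TensorProduct.induction_on with
  | zero => rw [map_zero]; exact zero_mem _
  | tmul x y => exact h x y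
  | add x y hx hy => rw [map_add]; exact add_mem hx hy

omit [IsAddTorsionFree G] in
theorem mul_mem_left (μ : Mult G) {τ : GType} {a : G} (ha : a ∈ typePart G τ) (y : G) :
    μ (a ⊗ₜ[ℤ] y) ∈ typePart G τ := map_mem_divPart ((bilin μ).flip y) ha

omit [IsAddTorsionFree G] in
theorem mul_mem_right (μ : Mult G) {τ : GType} {a : G} (ha : a ∈ typePart G τ) (y : G) :
    μ (y ⊗ₜ[ℤ] a) ∈ typePart G τ := map_mem_divPart (bilin μ y) ha

variable {T : Finset GType}

/-- A product inherits divisibility from both factors, so it lies in two different parts. -/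
theorem BlockData.mul_eq_zero (hB : BlockData G T) (μ : Mult G) {σ τ : GType} (hσ : σ ∈ T)
    (hτ : τ ∈ T) (hne : σ ≠ τ) {a b : G} (ha : a ∈ typePart G σ) (hb : b ∈ typePart G τ) :
    μ (a ⊗ₜ[ℤ] b) = 0 := by
  by_contra h0
  exact hne (hB.eq_of_mem hσ hτ (mul_mem_left μ ha b) (mul_mem_right μ hb a) h0)

theorem mult_eq_zero_of_divSum (hfi : (divSum G T).FiniteIndex) (μ : Mult G)
    (h : ∀ a ∈ divSum G T, ∀ b ∈ divSum G T, μ (a ⊗ₜ[ℤ] b) = 0) : μ = 0 := by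
  ext1 z
  refine mem_of_forall_tmul (A := ⊥) (fun x y => ?_) z
  have hN := hfi.index_ne_zero
  have h1 := h _ ((divSum G T).nsmul_index_mem x) _ ((divSum G T).nsmul_index_mem y)
  rw [← bilin_apply, map_nsmul, map_nsmul, AddMonoidHom.nsmul_apply] at h1
  exact nsmul_cancel hN (nsmul_cancel hN (by rw [← bilin_apply, h1, smul_zero, smul_zero]))

variable {I : GType → Finset ℕ} {e : GType → ℕ → G} {s : GType → ℤ} {d : G}

theorem IsPartBasis.mul_eq_zero {σ : GType} {J : Finset ℕ} {b : ℕ → G} (hb : IsPartBasis G σ J b)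
    (μ : Mult G) (h : ∀ i ∈ J, ∀ j ∈ J, μ (b i ⊗ₜ[ℤ] b j) = 0) {x y : G}
    (hx : x ∈ typePart G σ) (hy : y ∈ typePart G σ) : μ (x ⊗ₜ[ℤ] y) = 0 := by
  obtain ⟨m, hm, z, hz⟩ := hb.span x hx
  obtain ⟨n, hn, w, hw⟩ := hb.span y hy
  refine nsmul_cancel hm.1 (nsmul_cancel hn.1 ?_)
  rw [← bilin_apply, smul_zero, smul_zero, ← AddMonoidHom.nsmul_apply, ← map_nsmul, ← map_nsmul,
    hz, hw]
  simp only [map_sum, map_zsmul, AddMonoidHom.finsetSum_apply, AddMonoidHom.zsmul_apply,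
    bilin_apply]
  refine Finset.sum_eq_zero fun i hi => Finset.smul_sum.trans (Finset.sum_eq_zero fun j hj => ?_)
  rw [h j hj i hi, smul_zero, smul_zero]

/-- A multiplication is determined by the products of basis elements. -/
theorem AdaptedBasis.mult_eq_zero (hB : BlockData G T) (hE : AdaptedBasis G T I e s d)
    (μ : Mult G) (h : ∀ τ ∈ T, ∀ i ∈ I τ, ∀ j ∈ I τ, μ (e τ i ⊗ₜ[ℤ] e τ j) = 0) : μ = 0 := by
  refine mult_eq_zero_of_divSum hB.finiteIndex μ ?_
  have key : ∀ σ ∈ T, ∀ τ ∈ T, ∀ a ∈ typePart G σ, ∀ b ∈ typePart G τ,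
      μ (a ⊗ₜ[ℤ] b) = 0 := by
    intro σ hσ τ hτ a ha b hb
    by_cases hne : σ = τ
    · subst hne
      exact (hE.basis σ hσ).mul_eq_zero μ (h σ hσ) ha hb
    · exact hB.mul_eq_zero μ hσ hτ hne ha hb
  rintro _ ⟨f, hf, rfl⟩ _ ⟨g, hg, rfl⟩
  rw [TensorProduct.sum_tmul, map_sum]
  refine Finset.sum_eq_zero fun σ hσ => ?_
  rw [TensorProduct.tmul_sum, map_sum]
  exact Finset.sum_eq_zero fun τ hτ => key σ hσ τ hτ _ (hf σ hσ) _ (hg τ hτ)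

/-- The factor by which entries of the matrices of multiplications are divisible. -/
def coef (m i j : ℕ) : ℕ := if i = 0 ∧ j = 0 then m ^ 2 else if i = 0 ∨ j = 0 then m else 1

/-- The conditions on the entry of the matrix of a multiplication at `τ, i, j`. -/
def IsEntry (e : GType → ℕ → G) (t : GType → ℤ) (k : ℤ) (τ : GType) (i j : ℕ) (u : G) : Prop :=
  ∃ a ∈ typePart G τ, u =
    (if i = 0 ∧ j = 0 then k • (((mInv G τ : ℤ) * t τ) • e τ 0) else 0) + coef (mInv G τ) i j • a

theorem AdaptedBasis.regIndex_div_ne_zero (hB : BlockData G T) (hE : AdaptedBasis G T I e s d)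
    {τ : GType} (hτ : τ ∈ T) : regIndex G / mInv G τ ≠ 0 := by
  obtain ⟨c, hc⟩ := hB.mInv_dvd_regIndex hE.gen hτ
  have hm := hB.mInv_ne_zero hτ hE.gen
  rw [hc, Nat.mul_div_cancel_left _ (Nat.pos_of_ne_zero hm)]
  rintro rfl
  exact hB.regIndex_ne_zero (by rw [hc, mul_zero])

theorem AdaptedBasis.regIndex_eq (hB : BlockData G T) (hE : AdaptedBasis G T I e s d)
    {τ : GType} (hτ : τ ∈ T) : regIndex G / mInv G τ * mInv G τ = regIndex G :=
  Nat.div_mul_cancel (hB.mInv_dvd_regIndex hE.gen hτ)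

omit [IsAddTorsionFree G] in
/-- The value of a homomorphism at `d`, if it vanishes on all basis elements with index `0` except
one. -/
theorem AdaptedBasis.map_generator {H : Type*} [AddCommGroup H]
    (hE : AdaptedBasis G T I e s d) (φ : G →+ H) {τ : GType} (hτ : τ ∈ T)
    (hφ : ∀ σ ∈ T, σ ≠ τ → 0 ∈ I σ → φ (e σ 0) = 0) :
    regIndex G • φ d =
      if 0 ∈ I τ then ((regIndex G / mInv G τ : ℕ) * s τ : ℤ) • φ (e τ 0) else 0 := by
  classical
  rw [← map_nsmul, hE.repr, map_sum, Finset.sum_eq_single_of_mem τ hτ]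
  · split_ifs
    · rw [map_zsmul]
    · rw [map_zero]
  · intro σ hσ hne
    split_ifs with h
    · rw [map_zsmul, hφ σ hσ hne h, smul_zero]
    · rw [map_zero]

/-- Only the term of type τ survives when φ is applied to d, giving mφ(d) = sφ(e₀). With us + vm = 1
this yields φ(e₀) = m(uφ(d) + vφ(e₀)). -/
theorem AdaptedBasis.exists_eq_nsmul (hB : BlockData G T) (hE : AdaptedBasis G T I e s d)
    (φ : G →+ G) {τ : GType} (hτ : τ ∈ T) (h0 : 0 ∈ I τ) (hmem : ∀ x, φ x ∈ typePart G τ)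
    (hφ : ∀ σ ∈ T, σ ≠ τ → 0 ∈ I σ → φ (e σ 0) = 0) :
    ∃ w ∈ typePart G τ, φ (e τ 0) = mInv G τ • w := by
  have h1 := hE.map_generator φ hτ hφ
  rw [if_pos h0, ← hE.regIndex_eq hB hτ, Nat.mul_div_cancel _ (Nat.pos_of_ne_zero
    (hB.mInv_ne_zero hτ hE.gen)), mul_smul, mul_smul, natCast_zsmul] at h1
  have h2 := nsmul_cancel (hE.regIndex_div_ne_zero hB hτ) h1
  obtain ⟨u, v, huv⟩ := hE.coprime τ hτ h0
  refine ⟨u • φ d + v • φ (e τ 0), add_mem (zsmul_mem (hmem _) _) (zsmul_mem (hmem _) _), ?_⟩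
  rw [smul_add, smul_comm _ u, h2, smul_comm _ v, ← natCast_zsmul (φ (e τ 0)), ← mul_smul,
    ← mul_smul, ← add_smul, huv, one_smul]

/-- The shape of the matrices of a multiplication. -/
theorem AdaptedBasis.isEntry (hB : BlockData G T) (hE : AdaptedBasis G T I e s d)
    {t : GType → ℤ} (ht : ∀ τ ∈ T, 0 ∈ I τ → s τ * t τ ≡ 1 [ZMOD (mInv G τ : ℤ)])
    {μ : Mult G} {k : ℤ} (hk : μ (d ⊗ₜ[ℤ] d) - k • d ∈ divSum G T) {τ : GType} (hτ : τ ∈ T)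
    {i j : ℕ} (hi : i ∈ I τ) (hj : j ∈ I τ) : IsEntry e t k τ i j (μ (e τ i ⊗ₜ[ℤ] e τ j)) := by
  have hbm := fun σ hσ i hi => (hE.basis σ hσ).mem i hi
  -- Multiplication by a fixed y in A_τ takes values in A_τ and kills every e₀ of another type.
  have hrow : ∀ y ∈ typePart G τ, 0 ∈ I τ →
      ∃ w ∈ typePart G τ, μ (e τ 0 ⊗ₜ[ℤ] y) = mInv G τ • w := fun y hy h0 =>
    hE.exists_eq_nsmul hB ((bilin μ).flip y) hτ h0 (fun x => mul_mem_right μ hy x)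
      fun σ hσ hne h => hB.mul_eq_zero μ hσ hτ hne (hbm σ hσ 0 h) hy
  have hcol : ∀ y ∈ typePart G τ, 0 ∈ I τ →
      ∃ w ∈ typePart G τ, μ (y ⊗ₜ[ℤ] e τ 0) = mInv G τ • w := fun y hy h0 =>
    hE.exists_eq_nsmul hB (bilin μ y) hτ h0 (fun x => mul_mem_left μ hy x)
      fun σ hσ hne h => hB.mul_eq_zero μ hτ hσ hne.symm hy (hbm σ hσ 0 h)
  rw [IsEntry]
  by_cases h00 : i = 0 ∧ j = 0
  swap
  · rw [if_neg h00]
    simp only [zero_add, coef, if_neg h00]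
    by_cases h0 : i = 0 ∨ j = 0
    · rw [if_pos h0]
      rcases h0 with rfl | rfl
      · exact hrow _ (hbm τ hτ j hj) hi
      · exact hcol _ (hbm τ hτ i hi) hj
    · rw [if_neg h0]
      exact ⟨_, mul_mem_left μ (hbm τ hτ i hi) _, (one_smul _ _).symm⟩
  obtain ⟨rfl, rfl⟩ := h00
  rw [if_pos ⟨rfl, rfl⟩, coef, if_pos ⟨rfl, rfl⟩]
  have hN := hB.regIndex_ne_zero
  have hq := hE.regIndex_div_ne_zero hB hτ
  have hqm := hE.regIndex_eq hB hτ
  obtain ⟨w', hw', hw⟩ := hrow _ (hbm τ hτ 0 hi) hi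
  obtain ⟨a, ha, had⟩ := hk
  -- In the expansion of (n(G)d) × (n(G)d) all mixed products vanish.
  have hdd : (regIndex G * regIndex G) • μ (d ⊗ₜ[ℤ] d) = ∑ σ ∈ T, if 0 ∈ I σ then
      ((regIndex G / mInv G σ : ℕ) * s σ * ((regIndex G / mInv G σ : ℕ) * s σ) : ℤ) •
        μ (e σ 0 ⊗ₜ[ℤ] e σ 0) else 0 := by
    rw [mul_smul, ← bilin_apply, ← AddMonoidHom.nsmul_apply, ← map_nsmul (bilin μ), hE.repr,
      map_sum, AddMonoidHom.finsetSum_apply, Finset.smul_sum]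
    refine Finset.sum_congr rfl fun σ hσ => ?_
    split_ifs with h
    · rw [map_zsmul, AddMonoidHom.zsmul_apply, smul_comm,
        hE.map_generator (bilin μ (e σ 0)) hσ fun ρ hρ hne h' =>
          hB.mul_eq_zero μ hσ hρ hne.symm (hbm σ hσ 0 h) (hbm ρ hρ 0 h'), if_pos h, ← mul_smul,
        bilin_apply]
    · simp
  have hcomp := hB.component_eq
    (f := fun σ => if 0 ∈ I σ then
      ((regIndex G / mInv G σ : ℕ) * s σ * ((regIndex G / mInv G σ : ℕ) * s σ) : ℤ) •
        μ (e σ 0 ⊗ₜ[ℤ] e σ 0) else 0)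
    (g := fun σ => (k * regIndex G) •
      (if 0 ∈ I σ then ((regIndex G / mInv G σ : ℕ) * s σ : ℤ) • e σ 0 else 0) +
        (regIndex G * regIndex G) • a σ)
    (fun σ hσ => by
      split_ifs with h
      · exact zsmul_mem (mul_mem_left μ (hbm σ hσ 0 h) _) _
      · exact zero_mem _)
    (fun σ hσ => by
      refine add_mem (zsmul_mem ?_ _) (nsmul_mem (ha σ hσ) _)
      split_ifs with h
      · exact zsmul_mem (hbm σ hσ 0 h) _
      · exact zero_mem _)
    (by
      rw [← hdd, Finset.sum_add_distrib, ← Finset.smul_sum, ← Finset.smul_sum, ← hE.repr, had,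
        smul_sub, mul_smul k, natCast_zsmul, mul_smul, mul_smul, smul_comm k, smul_comm k]
      abel) hτ
  simp only [hi, if_true] at hcomp
  obtain ⟨r, hr⟩ := (Int.modEq_iff_dvd.1 (ht τ hτ hi).symm)
  set w := μ (e τ 0 ⊗ₜ[ℤ] e τ 0) with hwdef
  set m := mInv G τ with hmdef
  set q := regIndex G / m with hqdef
  -- The τ-component of d × d = kd + a with the common factor q² = (n(G)/m)² cancelled.
  have h3 : (s τ * s τ) • w = (k * m * s τ) • e τ 0 + (m * m : ℤ) • a τ := by
    refine zsmul_cancel (n := (q * q : ℤ)) (by positivity) ?_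
    rw [← mul_smul, smul_add, ← mul_smul, ← mul_smul]
    have hN' : (regIndex G : ℤ) = q * m := by exact_mod_cast hqm.symm
    rw [← natCast_zsmul (a τ), ← mul_smul] at hcomp
    push_cast at hcomp
    rw [hN'] at hcomp
    convert hcomp using 2
    · ring
    · congr 1; ring
    · congr 1; ring
  have hst : s τ * t τ = 1 + m * r := by linarith
  -- Multiply the preceding relation by t². Since st = 1 + mr, one has t²s² = 1 + m(2r + mr²), and w
  -- = mw' turns the error term m(2r + mr²)w into a multiple of m².
  refine ⟨(k * r * t τ) • e τ 0 + (t τ * t τ) • a τ - (2 * r + m * r * r) • w', ?_, ?_⟩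
  · exact sub_mem (add_mem (zsmul_mem (hbm τ hτ 0 hi) _) (zsmul_mem (ha τ hτ) _)) (zsmul_mem hw' _)
  · have h4 := congrArg (fun x => (t τ * t τ) • x) h3
    simp only [smul_add, ← mul_smul] at h4
    have h5 : t τ * t τ * (s τ * s τ) = 1 + m * (2 * r + m * r * r) := by
      linear_combination (s τ * t τ + 1 + m * r) * hst
    have h6 : t τ * t τ * (k * m * s τ) = k * m * t τ + m * m * (k * r * t τ) := by
      linear_combination (k * m * t τ) * hst
    rw [h5, h6, add_smul, one_smul, mul_comm (m : ℤ), mul_smul _ (m : ℤ) w] at h4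
    rw [eq_sub_of_add_eq h4, ← natCast_zsmul _ (m ^ 2)]
    nth_rewrite 1 [hw]
    push_cast
    rw [← natCast_zsmul w']
    module

end Multiplications

/-! ### Construction of multiplications -/

section Construction

variable {G : Type*} [AddCommGroup G] [IsAddTorsionFree G] {T : Finset GType}
  {I : GType → Finset ℕ} {e : GType → ℕ → G} {s : GType → ℤ} {d : G}

omit [IsAddTorsionFree G] in
theorem AdaptedBasis.exists_repr (hB : BlockData G T) (hE : AdaptedBasis G T I e s d) (x : G) :
    ∃ n : ℕ, n ≠ 0 ∧ ∃ z : GType → ℕ → ℤ, n • x = ∑ τ ∈ T, ∑ i ∈ I τ, z τ i • e τ i := by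
  have hfi := hB.finiteIndex
  obtain ⟨f, hf, hfx⟩ := (divSum G T).nsmul_index_mem x
  have h : ∀ τ, ∃ n : ℕ, n ≠ 0 ∧ ∃ z : ℕ → ℤ, τ ∈ T → n • f τ = ∑ i ∈ I τ, z i • e τ i := by
    intro τ
    by_cases hτ : τ ∈ T
    · obtain ⟨n, hn, z, hz⟩ := (hE.basis τ hτ).span _ (hf τ hτ)
      exact ⟨n, hn.1, z, fun _ => hz⟩
    · exact ⟨1, one_ne_zero, 0, fun h => absurd h hτ⟩
  choose n hn z hz using h
  have hdvd : ∀ τ, ∃ c : ℕ, τ ∈ T → ∏ σ ∈ T, n σ = n τ * c := fun τ => by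
    by_cases hτ : τ ∈ T
    · exact (Finset.dvd_prod_of_mem n hτ).imp fun c hc _ => hc
    · exact ⟨1, fun h => absurd h hτ⟩
  choose c hc using hdvd
  refine ⟨(∏ σ ∈ T, n σ) * (divSum G T).index,
    mul_ne_zero (Finset.prod_ne_zero_iff.2 fun τ _ => hn τ) hfi.index_ne_zero,
    fun τ i => c τ * z τ i, ?_⟩
  rw [mul_smul, ← hfx, Finset.smul_sum]
  refine Finset.sum_congr rfl fun τ hτ => ?_
  simp only [mul_smul, ← Finset.smul_sum, ← hz τ hτ, hc τ hτ]
  rw [natCast_zsmul, smul_comm]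

omit [IsAddTorsionFree G] in
theorem AdaptedBasis.repr_unique (hB : BlockData G T) (hE : AdaptedBasis G T I e s d)
    {z : GType → ℕ → ℤ} (h : ∑ τ ∈ T, ∑ i ∈ I τ, z τ i • e τ i = 0) :
    ∀ τ ∈ T, ∀ i ∈ I τ, z τ i = 0 := fun τ hτ =>
  (hE.basis τ hτ).indep (z τ) (hB.indep (fun τ => ∑ i ∈ I τ, z τ i • e τ i) (fun σ hσ =>
    sum_mem fun i hi => zsmul_mem ((hE.basis σ hσ).mem i hi) _) h τ hτ)

open Classical in
omit [IsAddTorsionFree G] in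
/-- Rational coordinates with respect to an adapted basis. -/
theorem AdaptedBasis.exists_coords (hB : BlockData G T) (hE : AdaptedBasis G T I e s d) :
    ∃ c : GType → ℕ → G →+ ℚ, ∀ σ ∈ T, ∀ j ∈ I σ, ∀ τ ∈ T, ∀ i ∈ I τ,
      c τ i (e σ j) = if τ = σ ∧ i = j then 1 else 0 := by
  choose n hn z hz using hE.exists_repr hB
  -- The fraction z/n does not depend on the representation chosen for x, which gives additivity of
  -- the coordinates.
  have key : ∀ (x : G) (m : ℕ) (w : GType → ℕ → ℤ), m ≠ 0 →
      m • x = ∑ τ ∈ T, ∑ i ∈ I τ, w τ i • e τ i → ∀ τ ∈ T, ∀ i ∈ I τ,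
        (z x τ i : ℚ) / n x = w τ i / m := by
    intro x m w hm hw τ hτ i hi
    have h0 := hE.repr_unique hB (z := fun τ i => (m : ℤ) * z x τ i - n x * w τ i) (by
      simp only [sub_smul, mul_smul, Finset.sum_sub_distrib, ← Finset.smul_sum, ← hz, ← hw]
      rw [natCast_zsmul, natCast_zsmul, smul_comm, sub_self]) τ hτ i hi
    rw [div_eq_div_iff (by exact_mod_cast hn x) (by exact_mod_cast hm)]
    have h1 : (m : ℚ) * z x τ i - n x * w τ i = 0 := by exact_mod_cast h0
    linarith
  refine ⟨fun τ i => AddMonoidHom.mk' (fun x => if τ ∈ T ∧ i ∈ I τ then (z x τ i : ℚ) / n x else 0)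
    fun x y => ?_, fun σ hσ j hj τ hτ i hi => ?_⟩
  · split_ifs with h
    · have hx : (n x : ℚ) ≠ 0 := by exact_mod_cast hn x
      have hy : (n y : ℚ) ≠ 0 := by exact_mod_cast hn y
      rw [key (x + y) (n x * n y) (fun τ i => n y * z x τ i + n x * z y τ i)
        (mul_ne_zero (hn x) (hn y)) (by
          simp only [add_smul, mul_smul, Finset.sum_add_distrib, ← Finset.smul_sum, ← hz, smul_add,
            natCast_zsmul]
          rw [smul_comm (n x)]) τ h.1 i h.2]
      push_cast
      field_simp
    · rw [add_zero]
  · simp only [AddMonoidHom.mk'_apply, hτ, hi, and_self, if_true]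
    rw [key (e σ j) 1 (fun τ i => if τ = σ ∧ i = j then 1 else 0) one_ne_zero (by
      rw [one_smul, Finset.sum_eq_single_of_mem σ hσ, Finset.sum_eq_single_of_mem j hj]
      · simp
      · intro i _ hij
        simp [hij]
      · intro τ _ hne
        simp [hne]) τ hτ i hi]
    simp

/-- The denominators occurring in the part are ones by which the part is divisible, so a condition
on the basis spreads to all of A_τ. The parameter is r = 1 for integrality, r = m_τ for row and
column 0, r = 0 for vanishing. -/
theorem IsPartBasis.exists_map_eq {τ : GType} {J : Finset ℕ} {b : ℕ → G} (h : IsPartBasis G τ J b)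
    (φ : G →+ DivisibleHull G) {r : ℕ}
    (hφ : ∀ i ∈ J, ∃ u ∈ typePart G τ, φ (b i) = toHull G (r • u)) {x : G}
    (hx : x ∈ typePart G τ) : ∃ u ∈ typePart G τ, φ x = toHull G (r • u) := by
  obtain ⟨n, hn, z, hz⟩ := h.span x hx
  have hφ' : ∀ i, ∃ u, i ∈ J → u ∈ typePart G τ ∧ φ (b i) = toHull G (r • u) := fun i => by
    by_cases hi : i ∈ J
    · exact (hφ i hi).imp fun u hu _ => hu
    · exact ⟨0, fun h => absurd h hi⟩
  choose u hu using hφ'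
  obtain ⟨w, hw, hwu⟩ := exists_mem_divPart_nsmul_eq
    (sum_mem fun i hi => zsmul_mem (hu i hi).1 (z i) : ∑ i ∈ J, z i • u i ∈ typePart G τ) hn
  refine ⟨w, hw, hull_nsmul_cancel hn.1 ?_⟩
  rw [← map_nsmul, ← map_nsmul, hz, smul_comm, hwu, Finset.smul_sum, map_sum, map_sum]
  refine Finset.sum_congr rfl fun i hi => ?_
  rw [map_zsmul, (hu i hi).2, smul_comm, map_zsmul]

theorem IsPartBasis.map_eq_zero {τ : GType} {J : Finset ℕ} {b : ℕ → G} (h : IsPartBasis G τ J b)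
    (φ : G →+ DivisibleHull G) (hφ : ∀ i ∈ J, φ (b i) = 0) {x : G} (hx : x ∈ typePart G τ) :
    φ x = 0 := by
  obtain ⟨u, -, hu⟩ := h.exists_map_eq φ (r := 0)
    (fun i hi => ⟨0, zero_mem _, by simp [hφ i hi]⟩) hx
  simpa using hu

/-- φ(d) = (s/m)φ(e₀), so the factor m in φ(e₀) = mu absorbs the denominator and φ(d) = su. -/
theorem AdaptedBasis.exists_map_generator_eq (hB : BlockData G T)
    (hE : AdaptedBasis G T I e s d) (φ : G →+ DivisibleHull G) {τ : GType} (hτ : τ ∈ T)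
    (hφ : ∀ σ ∈ T, σ ≠ τ → 0 ∈ I σ → φ (e σ 0) = 0)
    (hφ' : 0 ∈ I τ → ∃ u ∈ typePart G τ, φ (e τ 0) = toHull G (mInv G τ • u)) :
    ∃ u ∈ typePart G τ, φ d = toHull G u := by
  have h := hE.map_generator φ hτ hφ
  split_ifs at h with h0
  · obtain ⟨u, hu, e'⟩ := hφ' h0
    refine ⟨s τ • u, zsmul_mem hu _, hull_nsmul_cancel hB.regIndex_ne_zero ?_⟩
    rw [h, e', ← map_nsmul, ← map_zsmul]
    congr 1
    conv_rhs => rw [← hE.regIndex_eq hB hτ]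
    rw [mul_smul, mul_smul, natCast_zsmul, smul_comm (s τ)]
  · exact ⟨0, zero_mem _, hull_nsmul_cancel hB.regIndex_ne_zero (by rw [h, map_zero, nsmul_zero])⟩

theorem exists_mult_of_bilin (β : G ⊗[ℤ] G →+ DivisibleHull G)
    (h : ∀ x y, ∃ u, β (x ⊗ₜ[ℤ] y) = toHull G u) :
    ∃ μ : Mult G, ∀ z, toHull G (μ z) = β z := by
  have hmem : ∀ z, β z ∈ (toHull G).range := fun z =>
    mem_of_forall_tmul (fun x y => (h x y).imp fun u hu => hu.symm) z
  refine ⟨(AddMonoidHom.ofInjective (toHull_injective (M := G))).symm.toAddMonoidHom.comp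
    (β.codRestrict _ hmem), fun z => ?_⟩
  have := AddMonoidHom.apply_ofInjective_symm (toHull_injective (M := G)) ⟨β z, hmem z⟩
  exact this

omit [IsAddTorsionFree G] in
theorem exists_bilin_of_coords (T : Finset GType) (I : GType → Finset ℕ)
    (c : GType → ℕ → G →+ ℚ) (v : GType → ℕ → ℕ → DivisibleHull G) :
    ∃ β : G ⊗[ℤ] G →+ DivisibleHull G, ∀ x y, β (x ⊗ₜ[ℤ] y) =
      ∑ τ ∈ T, ∑ i ∈ I τ, ∑ j ∈ I τ, (c τ i x * c τ j y) • v τ i j := by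
  refine ⟨(TensorProduct.lift (LinearMap.mk₂ ℤ
    (fun x y => ∑ τ ∈ T, ∑ i ∈ I τ, ∑ j ∈ I τ, (c τ i x * c τ j y) • v τ i j) ?_ ?_ ?_
    ?_)).toAddMonoidHom, fun x y => rfl⟩
  · intro x x' y
    simp only [map_add, add_mul, add_smul, Finset.sum_add_distrib]
  · intro z x y
    simp only [map_zsmul, ← Int.cast_smul_eq_zsmul ℚ, smul_eq_mul, mul_assoc, mul_smul,
      Finset.smul_sum]
  · intro x y y'
    simp only [map_add, mul_add, add_smul, Finset.sum_add_distrib]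
  · intro z x y
    simp only [map_zsmul, ← Int.cast_smul_eq_zsmul ℚ, smul_eq_mul, mul_left_comm _ (z : ℚ),
      mul_smul (z : ℚ), Finset.smul_sum]

/-- All matrices of the right shape belong to multiplications. -/
theorem AdaptedBasis.exists_mult (hB : BlockData G T) (hE : AdaptedBasis G T I e s d)
    {t : GType → ℤ} (ht : ∀ τ ∈ T, 0 ∈ I τ → s τ * t τ ≡ 1 [ZMOD (mInv G τ : ℤ)])
    {k : ℤ} {U : GType → ℕ → ℕ → G}
    (hU : ∀ τ ∈ T, ∀ i ∈ I τ, ∀ j ∈ I τ, IsEntry e t k τ i j (U τ i j)) :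
    ∃ μ : Mult G, (∀ τ ∈ T, ∀ i ∈ I τ, ∀ j ∈ I τ, μ (e τ i ⊗ₜ[ℤ] e τ j) = U τ i j) ∧
      μ (d ⊗ₜ[ℤ] d) - k • d ∈ divSum G T ∧ (k = 0 → ∀ z, μ z ∈ divSum G T) := by
  classical
  obtain ⟨c, hc⟩ := hE.exists_coords hB
  -- The product is first defined with values in the divisible hull, through rational coordinates.
  -- What remains is to show that its values lie in G.
  obtain ⟨β, hβ⟩ := exists_bilin_of_coords T I c fun τ i j => toHull G (U τ i j)
  have hbm := fun σ hσ i hi => (hE.basis σ hσ).mem i hi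
  have hβe : ∀ σ ∈ T, ∀ i ∈ I σ, ∀ τ ∈ T, ∀ j ∈ I τ,
      β (e σ i ⊗ₜ[ℤ] e τ j) = if σ = τ then toHull G (U τ i j) else 0 := by
    intro σ hσ i hi τ hτ j hj
    rw [hβ, Finset.sum_eq_single_of_mem σ hσ, Finset.sum_eq_single_of_mem i hi]
    · rw [hc σ hσ i hi σ hσ i hi, if_pos ⟨rfl, rfl⟩]
      split_ifs with h
      · subst h
        rw [Finset.sum_eq_single_of_mem j hj]
        · rw [hc σ hσ j hj σ hσ j hj]
          simp
        · intro j' hj' hne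
          rw [hc σ hσ j hj σ hσ j' hj', if_neg fun h => hne h.2]
          simp
      · refine Finset.sum_eq_zero fun j' hj' => ?_
        rw [hc τ hτ j hj σ hσ j' hj', if_neg fun h' => h h'.1]
        simp
    · intro i' hi' hne
      refine Finset.sum_eq_zero fun j' _ => ?_
      rw [hc σ hσ i hi σ hσ i' hi', if_neg fun h => hne h.2]
      simp
    · intro ρ hρ hne
      refine Finset.sum_eq_zero fun i' hi' => Finset.sum_eq_zero fun j' _ => ?_
      rw [hc σ hσ i hi ρ hρ i' hi', if_neg fun h => hne h.1]
      simp
  have hU1 : ∀ τ ∈ T, ∀ i ∈ I τ, ∀ j ∈ I τ, U τ i j ∈ typePart G τ := by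
    intro τ hτ i hi j hj
    obtain ⟨a, ha, e'⟩ := hU τ hτ i hi j hj
    rw [e']
    refine add_mem ?_ (nsmul_mem ha _)
    split_ifs with h
    · exact zsmul_mem (zsmul_mem (hbm τ hτ 0 (h.1 ▸ hi)) _) _
    · exact zero_mem _
  -- The corner entry is included: both kmt e₀ and m²a are multiples of m. This is what makes
  -- products of d with elements of A integral.
  have hUm : ∀ τ ∈ T, ∀ i ∈ I τ, ∀ j ∈ I τ, i = 0 ∨ j = 0 →
      ∃ u ∈ typePart G τ, U τ i j = mInv G τ • u := by
    intro τ hτ i hi j hj h0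
    obtain ⟨a, ha, e'⟩ := hU τ hτ i hi j hj
    by_cases h : i = 0 ∧ j = 0
    · rw [if_pos h, coef, if_pos h] at e'
      refine ⟨(k * t τ) • e τ 0 + mInv G τ • a,
        add_mem (zsmul_mem (hbm τ hτ 0 (h.1 ▸ hi)) _) (nsmul_mem ha _), ?_⟩
      rw [e', ← natCast_zsmul _ (mInv G τ ^ 2)]
      push_cast
      module
    · rw [if_neg h, coef, if_neg h, if_pos h0, zero_add] at e'
      exact ⟨a, ha, e'⟩
  -- products of basis elements with elements of the parts
  have hcross : ∀ σ ∈ T, ∀ τ ∈ T, σ ≠ τ → ∀ a ∈ typePart G σ, ∀ b ∈ typePart G τ,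
      β (a ⊗ₜ[ℤ] b) = 0 := by
    intro σ hσ τ hτ hne a ha b hb
    refine (hE.basis σ hσ).map_eq_zero ((bilin β).flip b) (fun i hi => ?_) ha
    refine (hE.basis τ hτ).map_eq_zero (bilin β (e σ i)) (fun j hj => ?_) hb
    rw [bilin_apply, hβe σ hσ i hi τ hτ j hj, if_neg hne]
  have hsame : ∀ τ ∈ T, ∀ a ∈ typePart G τ, ∀ b ∈ typePart G τ,
      ∃ u ∈ typePart G τ, β (a ⊗ₜ[ℤ] b) = toHull G u := by
    intro τ hτ a ha b hb
    obtain ⟨u, hu, e'⟩ := (hE.basis τ hτ).exists_map_eq ((bilin β).flip b) (r := 1)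
      (fun i hi => (hE.basis τ hτ).exists_map_eq (bilin β (e τ i)) (r := 1) (fun j hj =>
        ⟨U τ i j, hU1 τ hτ i hi j hj, by
          rw [bilin_apply, hβe τ hτ i hi τ hτ j hj, if_pos rfl, one_smul]⟩) hb) ha
    exact ⟨u, hu, by rwa [one_smul] at e'⟩
  let A : AddSubgroup (DivisibleHull G) := (divSum G T).map (toHull G)
  have hA : ∀ τ ∈ T, ∀ u ∈ typePart G τ, toHull G u ∈ A := fun τ hτ u hu =>
    AddSubgroup.mem_map_of_mem _ (typePart_le_divSum hτ hu)
  have hAA : ∀ a ∈ divSum G T, ∀ b ∈ divSum G T, β (a ⊗ₜ[ℤ] b) ∈ A := by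
    rintro _ ⟨f, hf, rfl⟩ _ ⟨g, hg, rfl⟩
    rw [TensorProduct.sum_tmul, map_sum]
    refine sum_mem fun σ hσ => ?_
    rw [TensorProduct.tmul_sum, map_sum]
    refine sum_mem fun τ hτ => ?_
    by_cases h : σ = τ
    · subst h
      obtain ⟨u, hu, e'⟩ := hsame σ hσ _ (hf σ hσ) _ (hg σ hσ)
      rw [e']
      exact hA σ hσ u hu
    · rw [hcross σ hσ τ hτ h _ (hf σ hσ) _ (hg τ hτ)]
      exact zero_mem _
  have hdA : ∀ b ∈ divSum G T, β (d ⊗ₜ[ℤ] b) ∈ A := by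
    rintro _ ⟨g, hg, rfl⟩
    rw [TensorProduct.tmul_sum, map_sum]
    refine sum_mem fun τ hτ => ?_
    obtain ⟨u, hu, e'⟩ := hE.exists_map_generator_eq hB ((bilin β).flip (g τ)) hτ
      (fun σ hσ hne h => hcross σ hσ τ hτ hne _ (hbm σ hσ 0 h) _ (hg τ hτ))
      (fun h0 => (hE.basis τ hτ).exists_map_eq (bilin β (e τ 0)) (fun j hj => by
        obtain ⟨u, hu, e'⟩ := hUm τ hτ 0 h0 j hj (Or.inl rfl)
        exact ⟨u, hu, by rw [bilin_apply, hβe τ hτ 0 h0 τ hτ j hj, if_pos rfl, e']⟩) (hg τ hτ))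
    rw [show β (d ⊗ₜ[ℤ] g τ) = toHull G u from e']
    exact hA τ hτ u hu
  have hAd : ∀ b ∈ divSum G T, β (b ⊗ₜ[ℤ] d) ∈ A := by
    rintro _ ⟨g, hg, rfl⟩
    rw [TensorProduct.sum_tmul, map_sum]
    refine sum_mem fun τ hτ => ?_
    obtain ⟨u, hu, e'⟩ := hE.exists_map_generator_eq hB (bilin β (g τ)) hτ
      (fun σ hσ hne h => hcross τ hτ σ hσ hne.symm _ (hg τ hτ) _ (hbm σ hσ 0 h))
      (fun h0 => (hE.basis τ hτ).exists_map_eq ((bilin β).flip (e τ 0)) (fun j hj => by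
        obtain ⟨u, hu, e'⟩ := hUm τ hτ j hj 0 h0 (Or.inr rfl)
        exact ⟨u, hu, by
          rw [AddMonoidHom.flip_apply, bilin_apply, hβe τ hτ j hj τ hτ 0 h0, if_pos rfl, e']⟩)
        (hg τ hτ))
    rw [show β (g τ ⊗ₜ[ℤ] d) = toHull G u from e']
    exact hA τ hτ u hu
  have hdd : β (d ⊗ₜ[ℤ] d) - k • toHull G d ∈ A := by
    have hw : ∀ τ, ∃ w, τ ∈ T → w ∈ typePart G τ ∧
        (regIndex G * regIndex G) • w = (if 0 ∈ I τ then
          ((regIndex G / mInv G τ : ℕ) * s τ * ((regIndex G / mInv G τ : ℕ) * s τ) : ℤ) • U τ 0 0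
            else 0) - (regIndex G * k) • (if 0 ∈ I τ then
              ((regIndex G / mInv G τ : ℕ) * s τ : ℤ) • e τ 0 else 0) := by
      intro τ
      by_cases hτ : τ ∈ T
      swap
      · exact ⟨0, fun h => absurd h hτ⟩
      by_cases h0 : 0 ∈ I τ
      swap
      · exact ⟨0, fun _ => ⟨zero_mem _, by simp [h0]⟩⟩
      obtain ⟨a, ha, e'⟩ := hU τ hτ 0 h0 0 h0
      obtain ⟨r, hr⟩ := Int.modEq_iff_dvd.1 (ht τ hτ h0).symm
      rw [if_pos ⟨rfl, rfl⟩, coef, if_pos ⟨rfl, rfl⟩] at e'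
      -- This is (s²/m²)U₀₀ - k(s/m)e₀ with U₀₀ = kmt e₀ + m²a: the coefficient of e₀ becomes ks(st
      -- - 1)/m = ksr.
      refine ⟨(s τ * r * k) • e τ 0 + (s τ * s τ) • a, fun _ =>
        ⟨add_mem (zsmul_mem (hbm τ hτ 0 h0) _) (zsmul_mem ha _), ?_⟩⟩
      rw [if_pos h0, if_pos h0, e', ← natCast_zsmul _ (mInv G τ ^ 2), ← natCast_zsmul]
      have hN : (regIndex G : ℤ) = (regIndex G / mInv G τ : ℕ) * mInv G τ := by
        exact_mod_cast (hE.regIndex_eq hB hτ).symm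
      generalize (regIndex G / mInv G τ : ℕ) = q at hN ⊢
      have hst : s τ * t τ = 1 + mInv G τ * r := by linarith
      push_cast
      rw [hN]
      generalize (mInv G τ : ℤ) = m at hst ⊢
      have h1 : (q : ℤ) * m * (q * m) * (s τ * r * k) =
          q * s τ * (q * s τ) * (k * (m * t τ)) - q * m * k * (q * s τ) := by
        linear_combination (-(q : ℤ) * q * m * s τ * k) * hst
      simp only [smul_add, ← mul_smul, h1, sub_smul]
      rw [show (q : ℤ) * m * (q * m) * (s τ * s τ) = q * s τ * (q * s τ) * m ^ 2 by ring]
      abel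
    choose w hw using hw
    refine ⟨∑ τ ∈ T, w τ, ⟨w, fun τ hτ => (hw τ hτ).1, rfl⟩, ?_⟩
    refine hull_nsmul_cancel (mul_ne_zero hB.regIndex_ne_zero hB.regIndex_ne_zero) ?_
    rw [← map_nsmul, Finset.smul_sum, Finset.sum_congr rfl fun τ hτ => (hw τ hτ).2,
      Finset.sum_sub_distrib, ← Finset.smul_sum, ← hE.repr, map_sub, nsmul_sub]
    congr 1
    · rw [mul_smul, ← bilin_apply, ← AddMonoidHom.nsmul_apply, ← map_nsmul (bilin β), hE.repr,
        map_sum, map_sum, AddMonoidHom.finsetSum_apply, ← Finset.sum_nsmul]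
      refine Finset.sum_congr rfl fun σ hσ => ?_
      split_ifs with h
      · rw [map_zsmul, map_zsmul, AddMonoidHom.zsmul_apply, smul_comm,
          hE.map_generator (bilin β (e σ 0)) hσ fun ρ hρ hne h' =>
            hcross σ hσ ρ hρ hne.symm _ (hbm σ hσ 0 h) _ (hbm ρ hρ 0 h'), if_pos h, ← mul_smul,
          bilin_apply, hβe σ hσ 0 h σ hσ 0 h, if_pos rfl]
      · simp
    · rw [map_zsmul, map_nsmul, ← natCast_zsmul, ← natCast_zsmul, ← mul_smul, ← mul_smul]
      push_cast
      congr 1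
      ring
  -- Modulo A write x = k₁d and y = k₂d. Products with an element of A stay in A, so the product of
  -- x and y is k₁k₂kd modulo A.
  have hall : ∀ x y, ∃ j : ℤ, β (x ⊗ₜ[ℤ] y) - (j * k) • toHull G d ∈ A := by
    intro x y
    obtain ⟨k₁, h₁⟩ := generatesQuotient_iff.1 hE.gen x
    obtain ⟨k₂, h₂⟩ := generatesQuotient_iff.1 hE.gen y
    rw [hB.regulator_eq] at h₁ h₂
    refine ⟨k₁ * k₂, ?_⟩
    have e1 : β (x ⊗ₜ[ℤ] y) - (k₁ * k₂ * k) • toHull G d =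
        β ((x - k₁ • d) ⊗ₜ[ℤ] (y - k₂ • d)) + k₂ • β ((x - k₁ • d) ⊗ₜ[ℤ] d) +
        k₁ • β (d ⊗ₜ[ℤ] (y - k₂ • d)) + (k₁ * k₂) • (β (d ⊗ₜ[ℤ] d) - k • toHull G d) := by
      simp only [← bilin_apply, map_sub, map_zsmul, AddMonoidHom.sub_apply,
        AddMonoidHom.zsmul_apply]
      module
    rw [e1]
    exact add_mem (add_mem (add_mem (hAA _ h₁ _ h₂) (zsmul_mem (hAd _ h₁) _))
      (zsmul_mem (hdA _ h₂) _)) (zsmul_mem hdd _)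
  obtain ⟨μ, hμ⟩ := exists_mult_of_bilin β fun x y => by
    obtain ⟨j, a, -, ha⟩ := hall x y
    exact ⟨a + (j * k) • d, by rw [map_add, ha, map_zsmul, sub_add_cancel]⟩
  refine ⟨μ, fun τ hτ i hi j hj => toHull_injective ?_, ?_, ?_⟩
  · rw [hμ, hβe τ hτ i hi τ hτ j hj, if_pos rfl]
  · obtain ⟨a, ha, e'⟩ := hdd
    rw [← hμ, ← map_zsmul, ← map_sub] at e'
    exact toHull_injective e' ▸ ha
  · rintro rfl z
    refine mem_of_forall_tmul (fun x y => ?_) z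
    obtain ⟨j, a, ha, e'⟩ := hall x y
    rw [mul_zero, zero_smul, sub_zero, ← hμ] at e'
    exact toHull_injective e' ▸ ha

end Construction

/-! ### The group of multiplications -/

section MultGroup

variable {G : Type*} [AddCommGroup G] [IsAddTorsionFree G] {T : Finset GType}
  {I : GType → Finset ℕ} {e : GType → ℕ → G} {s t : GType → ℤ} {d : G}

omit [IsAddTorsionFree G] in
theorem coef_ne_zero {m : ℕ} (hm : m ≠ 0) (i j : ℕ) : coef m i j ≠ 0 := by
  rw [coef]
  split_ifs
  exacts [pow_ne_zero 2 hm, hm, one_ne_zero]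

omit [IsAddTorsionFree G] in
theorem AdaptedBasis.exists_inverse (hE : AdaptedBasis G T I e s d) :
    ∃ t : GType → ℤ, ∀ τ ∈ T, 0 ∈ I τ → s τ * t τ ≡ 1 [ZMOD (mInv G τ : ℤ)] := by
  have h : ∀ τ, ∃ t : ℤ, τ ∈ T → 0 ∈ I τ → s τ * t ≡ 1 [ZMOD (mInv G τ : ℤ)] := fun τ => by
    by_cases hτ : τ ∈ T ∧ 0 ∈ I τ
    · obtain ⟨a, b, hab⟩ := hE.coprime τ hτ.1 hτ.2
      refine ⟨a, fun _ _ => Int.modEq_iff_dvd.2 ⟨b, ?_⟩⟩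
      linear_combination -hab
    · exact ⟨0, fun h h' => absurd ⟨h, h'⟩ hτ⟩
  choose t ht using h
  exact ⟨t, ht⟩

/-- A multiplication whose matrices vanish outside `τ` belongs to the part of type `τ`. -/
theorem AdaptedBasis.mem_typePart_of_entries (hB : BlockData G T)
    (hE : AdaptedBasis G T I e s d) (μ : Mult G) {τ : GType}
    (h : ∀ σ ∈ T, σ ≠ τ → ∀ i ∈ I σ, ∀ j ∈ I σ, μ (e σ i ⊗ₜ[ℤ] e σ j) = 0) :
    μ ∈ typePart (Mult G) τ := by
  refine mem_typePart_mult.2 (mem_of_forall_tmul fun x y => ?_)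
  have hN := hB.finiteIndex.index_ne_zero
  have key : ∀ a ∈ divSum G T, ∀ b ∈ divSum G T, μ (a ⊗ₜ[ℤ] b) ∈ typePart G τ := by
    rintro _ ⟨f, hf, rfl⟩ _ ⟨g, hg, rfl⟩
    rw [TensorProduct.sum_tmul, map_sum]
    refine sum_mem fun σ hσ => ?_
    rw [TensorProduct.tmul_sum, map_sum]
    refine sum_mem fun ρ hρ => ?_
    by_cases h1 : σ = ρ
    swap
    · rw [hB.mul_eq_zero μ hσ hρ h1 (hf σ hσ) (hg ρ hρ)]
      exact zero_mem _
    subst h1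
    by_cases h2 : σ = τ
    · subst h2
      exact mul_mem_left μ (hf σ hσ) _
    · rw [(hE.basis σ hσ).mul_eq_zero μ (h σ hσ h2) (hf σ hσ) (hg σ hσ)]
      exact zero_mem _
  have h1 := key _ ((divSum G T).nsmul_index_mem x) _ ((divSum G T).nsmul_index_mem y)
  rw [← bilin_apply, map_nsmul, map_nsmul, AddMonoidHom.nsmul_apply] at h1
  exact mem_divPart_of_nsmul_mem hN (mem_divPart_of_nsmul_mem hN h1)

theorem BlockData.mul_eq_zero_of_mem_typePart (hB : BlockData G T) {μ : Mult G} {σ τ : GType}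
    (hσ : σ ∈ T) (hτ : τ ∈ T) (hμ : μ ∈ typePart (Mult G) τ) (hne : σ ≠ τ) {a : G}
    (ha : a ∈ typePart G σ) (b : G) : μ (a ⊗ₜ[ℤ] b) = 0 := by
  by_contra h0
  exact hne (hB.eq_of_mem hσ hτ (mul_mem_left μ ha b) (mem_typePart_mult.1 hμ _) h0)

/-- With k = 0 the matrices at different types are unrelated, so one may be prescribed and the
others set to zero. -/
theorem AdaptedBasis.exists_single (hB : BlockData G T) (hE : AdaptedBasis G T I e s d)
    {τ : GType} (hτ : τ ∈ T) {a : ℕ → ℕ → G} (ha : ∀ i ∈ I τ, ∀ j ∈ I τ, a i j ∈ typePart G τ) :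
    ∃ μ ∈ typePart (Mult G) τ, ∀ i ∈ I τ, ∀ j ∈ I τ,
      μ (e τ i ⊗ₜ[ℤ] e τ j) = coef (mInv G τ) i j • a i j := by
  classical
  obtain ⟨t, ht⟩ := hE.exists_inverse
  obtain ⟨μ, hμ, -⟩ := hE.exists_mult hB ht (k := 0)
    (U := fun σ i j => if σ = τ then coef (mInv G τ) i j • a i j else 0) (fun σ hσ i hi j hj => by
      by_cases h : σ = τ
      · subst h
        exact ⟨a i j, ha i hi j hj, by simp⟩
      · exact ⟨0, zero_mem _, by simp [h]⟩)
  refine ⟨μ, hE.mem_typePart_of_entries hB μ fun σ hσ hne i hi j hj => ?_, fun i hi j hj => ?_⟩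
  · rw [hμ σ hσ i hi j hj, if_neg hne]
  · rw [hμ τ hτ i hi j hj, if_pos rfl]

/-- If d × d lies in A, the matrices have the shape for k = 0. Each block is then realized by a
multiplication in the part of its own type, and the sum of these has the same matrices as μ. -/
theorem AdaptedBasis.mem_divSum_mult_iff (hB : BlockData G T) (hE : AdaptedBasis G T I e s d)
    {μ : Mult G} : μ ∈ divSum (Mult G) T ↔ μ (d ⊗ₜ[ℤ] d) ∈ divSum G T := by
  constructor
  · rintro ⟨f, hf, rfl⟩
    exact ⟨fun τ => f τ (d ⊗ₜ[ℤ] d), fun τ hτ => mem_typePart_mult.1 (hf τ hτ) _,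
      (AddMonoidHom.finsetSum_apply _ _ _).symm⟩
  · intro h
    obtain ⟨t, ht⟩ := hE.exists_inverse
    have hent := fun {τ} (hτ : τ ∈ T) {i} (hi : i ∈ I τ) {j} (hj : j ∈ I τ) =>
      hE.isEntry hB ht (k := 0) (by rwa [zero_smul, sub_zero]) hτ hi hj
    have h1 : ∀ τ, ∃ ν : Mult G, τ ∈ T → ν ∈ typePart (Mult G) τ ∧ ∀ i ∈ I τ, ∀ j ∈ I τ,
        ν (e τ i ⊗ₜ[ℤ] e τ j) = μ (e τ i ⊗ₜ[ℤ] e τ j) := by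
      intro τ
      by_cases hτ : τ ∈ T
      swap
      · exact ⟨0, fun h => absurd h hτ⟩
      have h2 : ∀ i j, ∃ a, i ∈ I τ → j ∈ I τ → a ∈ typePart G τ ∧
          μ (e τ i ⊗ₜ[ℤ] e τ j) = coef (mInv G τ) i j • a := fun i j => by
        by_cases hij : i ∈ I τ ∧ j ∈ I τ
        · obtain ⟨a, ha, e'⟩ := hent hτ hij.1 hij.2
          exact ⟨a, fun _ _ => ⟨ha, by simpa using e'⟩⟩
        · exact ⟨0, fun h h' => absurd ⟨h, h'⟩ hij⟩
      choose a ha using h2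
      obtain ⟨ν, hν, e'⟩ := hE.exists_single hB hτ fun i hi j hj => (ha i j hi hj).1
      exact ⟨ν, fun _ => ⟨hν, fun i hi j hj => by rw [e' i hi j hj, (ha i j hi hj).2]⟩⟩
    choose ν hν using h1
    refine ⟨ν, fun τ hτ => (hν τ hτ).1, ?_⟩
    rw [← sub_eq_zero]
    refine hE.mult_eq_zero hB _ fun τ hτ i hi j hj => ?_
    rw [AddMonoidHom.sub_apply, AddMonoidHom.finsetSum_apply, Finset.sum_eq_single_of_mem τ hτ,
      (hν τ hτ).2 i hi j hj, sub_self]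
    intro σ hσ hne
    exact hB.mul_eq_zero_of_mem_typePart hτ hσ (hν σ hσ).1 hne.symm
      ((hE.basis τ hτ).mem i hi) _

/-- A basis of the part of type `τ` of the group of multiplications. -/
theorem AdaptedBasis.exists_mult_basis (hB : BlockData G T) (hE : AdaptedBasis G T I e s d)
    {τ : GType} (hτ : τ ∈ T) : ∃ F : I τ × I τ × I τ → Mult G, (∀ x, F x ∈ typePart (Mult G) τ) ∧
      LinearIndependent ℤ F ∧ ∀ μ ∈ typePart (Mult G) τ, ∃ n, IsSUnit (PInf τ) n ∧
        n • μ ∈ Submodule.span ℤ (Set.range F) := by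
  classical
  have hm := hB.mInv_ne_zero hτ hE.gen
  -- The multiplication labelled (i, j, l) has the single nonzero entry `coef · e τ l` at position
  -- (i, j).
  have h1 : ∀ x : I τ × I τ × I τ, ∃ μ ∈ typePart (Mult G) τ, ∀ i j : I τ,
      μ (e τ i ⊗ₜ[ℤ] e τ j) =
        if i = x.1 ∧ j = x.2.1 then coef (mInv G τ) i j • e τ x.2.2 else 0 := by
    intro x
    obtain ⟨μ, hμ, h⟩ := hE.exists_single hB hτ
      (a := fun i j => if i = x.1 ∧ j = x.2.1 then e τ x.2.2 else 0) (fun i _ j _ => by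
        split_ifs
        · exact (hE.basis τ hτ).mem _ x.2.2.2
        · exact zero_mem _)
    refine ⟨μ, hμ, fun i j => ?_⟩
    rw [h i i.2 j j.2]
    simp only [← Subtype.ext_iff]
    split_ifs
    · rfl
    · rw [smul_zero]
  choose F hF hFe using h1
  have hsum : ∀ (g : I τ × I τ × I τ → ℤ) (i j : I τ),
      (∑ x, g x • F x) (e τ i ⊗ₜ[ℤ] e τ j) =
        coef (mInv G τ) i j • ∑ l : I τ, g (i, j, l) • e τ l := by
    intro g i j
    rw [AddMonoidHom.finsetSum_apply]
    simp only [AddMonoidHom.zsmul_apply, hFe]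
    rw [Fintype.sum_prod_type, Finset.sum_eq_single_of_mem i (Finset.mem_univ i),
      Fintype.sum_prod_type, Finset.sum_eq_single_of_mem j (Finset.mem_univ j), Finset.smul_sum]
    · exact Finset.sum_congr rfl fun l _ => by rw [if_pos ⟨rfl, rfl⟩, smul_comm]
    · exact fun j' _ hne => Finset.sum_eq_zero fun l _ => by
        rw [if_neg fun h => hne h.2.symm, smul_zero]
    · exact fun i' _ hne => Finset.sum_eq_zero fun l _ => by
        rw [if_neg fun h => hne h.1.symm, smul_zero]
  refine ⟨F, hF, Fintype.linearIndependent_iff.2 fun g hg => ?_, fun μ hμ => ?_⟩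
  · rintro ⟨i, j, l⟩
    have h2 := hsum g i j
    rw [hg, AddMonoidHom.zero_apply] at h2
    exact Fintype.linearIndependent_iff.1 (hE.basis τ hτ).linearIndependent
      (fun l => g (i, j, l)) (nsmul_cancel (coef_ne_zero hm i j) (by rw [← h2, smul_zero])) l
  · obtain ⟨t, ht⟩ := hE.exists_inverse
    have hμ' := (hE.mem_divSum_mult_iff hB).1 (typePart_le_divSum hτ hμ)
    have h2 : ∀ x : I τ × I τ, ∃ n, IsSUnit (PInf τ) n ∧ ∃ z : ℕ → ℤ,
        n • μ (e τ x.1 ⊗ₜ[ℤ] e τ x.2) =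
          coef (mInv G τ) x.1 x.2 • ∑ l : I τ, z l • e τ l := by
      intro x
      obtain ⟨a, ha, e'⟩ := hE.isEntry hB ht (k := 0) (by rwa [zero_smul, sub_zero]) hτ
        x.1.2 x.2.2
      obtain ⟨n, hn, z, hz⟩ := (hE.basis τ hτ).span a ha
      refine ⟨n, hn, z, ?_⟩
      rw [zero_smul, ite_self, zero_add] at e'
      rw [e', smul_comm, hz, ← Finset.sum_coe_sort]
    choose n hn z hz using h2
    refine ⟨∏ x, n x, IsSUnit.prod fun x _ => hn x, ?_⟩
    have h3 : ∀ x, ∃ c, ∏ x, n x = c * n x := fun x =>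
      (Finset.dvd_prod_of_mem n (Finset.mem_univ x)).imp fun c hc => by rw [hc, mul_comm]
    choose c hc using h3
    have h4 : (∏ x, n x) • μ = ∑ x : I τ × I τ × I τ,
        ((c (x.1, x.2.1) : ℤ) * z (x.1, x.2.1) x.2.2) • F x := by
      rw [← sub_eq_zero]
      refine hE.mult_eq_zero hB _ fun σ hσ i hi j hj => ?_
      by_cases hne : σ = τ
      · subst hne
        rw [AddMonoidHom.sub_apply, sub_eq_zero, AddMonoidHom.nsmul_apply, hc (⟨i, hi⟩, ⟨j, hj⟩),
          mul_smul, hz (⟨i, hi⟩, ⟨j, hj⟩)]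
        have := hsum (fun x => (c (x.1, x.2.1) : ℤ) * z (x.1, x.2.1) x.2.2) ⟨i, hi⟩ ⟨j, hj⟩
        refine Eq.trans ?_ this.symm
        simp only [mul_smul, ← Finset.smul_sum, natCast_zsmul]
        rw [smul_comm]
      · exact hB.mul_eq_zero_of_mem_typePart hσ hτ (sub_mem (nsmul_mem hμ _)
          (sum_mem fun x _ => zsmul_mem (hF x) _)) hne ((hE.basis σ hσ).mem i hi) _
    rw [h4]
    exact Submodule.sum_mem _ fun x _ =>
      Submodule.smul_mem _ _ (Submodule.subset_span (Set.mem_range_self x))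

theorem AdaptedBasis.rank_mult (hB : BlockData G T) (hE : AdaptedBasis G T I e s d)
    {τ : GType} (hτ : τ ∈ T) :
    Module.finrank ℤ (typePart (Mult G) τ) = Module.finrank ℤ (typePart G τ) ^ 3 := by
  obtain ⟨F, hF, hli, hspan⟩ := hE.exists_mult_basis hB hτ
  have h1 : Module.finrank ℤ (typePart G τ) = (I τ).card :=
    Module.finrank_eq_of_rank_eq (hE.basis τ hτ).rank_eq
  let v : I τ × I τ × I τ → typePart (Mult G) τ := fun x => ⟨F x, hF x⟩
  have hv : LinearIndependent ℤ v :=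
    LinearIndependent.of_comp (typePart (Mult G) τ).subtype.toIntLinearMap hli
  have h2 := rank_eq_of_torsion_quotient (Submodule.span ℤ (Set.range v)) fun x => by
    obtain ⟨n, hn, h⟩ := hspan x x.2
    refine ⟨n, by exact_mod_cast hn.1, ?_⟩
    have h3 : Set.range F = (typePart (Mult G) τ).subtype.toIntLinearMap '' Set.range v := by
      rw [← Set.range_comp]
      rfl
    rw [h3, Submodule.span_image] at h
    obtain ⟨y, hy, e'⟩ := h
    have : y = (n : ℤ) • x := Subtype.ext (by rw [natCast_zsmul]; exact e')
    exact this ▸ hy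
  have h4 : Module.finrank ℤ (typePart (Mult G) τ) =
      Module.finrank ℤ (Submodule.span ℤ (Set.range v)) := congrArg Cardinal.toNat h2
  rw [h1, h4, finrank_span_eq_card hv]
  simp only [Fintype.card_prod, Fintype.card_coe]
  ring

/-- Independence is checked value by value. For the index, the sum of the parts is the preimage of A
under evaluation at d ⊗ d. -/
theorem AdaptedBasis.blockData_mult (hB : BlockData G T) (hE : AdaptedBasis G T I e s d) :
    BlockData (Mult G) T where
  idem := hB.idem
  lattice := fun τ hτ => by
    obtain ⟨F, hF, -, hspan⟩ := hE.exists_mult_basis hB hτ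
    refine ⟨Submodule.span ℤ (Set.range F), Submodule.fg_span (Set.finite_range F), ?_, hspan⟩
    have : Submodule.span ℤ (Set.range F) ≤ AddSubgroup.toIntSubmodule (typePart (Mult G) τ) :=
      Submodule.span_le.2 (Set.range_subset_iff.2 hF)
    exact fun x hx => this hx
  indep := fun f hf h τ hτ => by
    ext1 x
    refine hB.indep (fun τ => f τ x) (fun τ hτ => mem_typePart_mult.1 (hf τ hτ) x) ?_ τ hτ
    rw [← AddMonoidHom.finsetSum_apply, h, AddMonoidHom.zero_apply]
  finiteIndex := by
    have := hB.finiteIndex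
    have h : divSum (Mult G) T = (divSum G T).comap (AddMonoidHom.eval (d ⊗ₜ[ℤ] d)) := by
      ext μ
      exact hE.mem_divSum_mult_iff hB
    rw [h]
    refine ⟨?_⟩
    rw [AddSubgroup.index_comap]
    exact AddSubgroup.FiniteIndex.index_ne_zero (H := (divSum G T).addSubgroupOf _)

end MultGroup

/-! ### Invariants of the group of multiplications -/

section MultInvariants

variable {G : Type*} [AddCommGroup G] [IsAddTorsionFree G] {T : Finset GType}
  {I : GType → Finset ℕ} {e : GType → ℕ → G} {s t : GType → ℤ} {d : G}

/-- The matrices of `μ` vanish outside the positions `(0, 0)`, where their entries are `u τ`. -/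
def HasCorner (T : Finset GType) (I : GType → Finset ℕ) (e : GType → ℕ → G) (u : GType → G)
    (μ : Mult G) : Prop :=
  ∀ τ ∈ T, ∀ i ∈ I τ, ∀ j ∈ I τ, μ (e τ i ⊗ₜ[ℤ] e τ j) = if i = 0 ∧ j = 0 then u τ else 0

/-- The case k = 1 with zero free part: a multiplication with d × d ≡ d modulo A. -/
theorem AdaptedBasis.exists_mult_generator (hB : BlockData G T) (hE : AdaptedBasis G T I e s d)
    (ht : ∀ τ ∈ T, 0 ∈ I τ → s τ * t τ ≡ 1 [ZMOD (mInv G τ : ℤ)]) :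
    ∃ X' : Mult G, HasCorner T I e (fun τ => ((mInv G τ : ℤ) * t τ) • e τ 0) X' ∧
      X' (d ⊗ₜ[ℤ] d) - d ∈ divSum G T := by
  obtain ⟨μ, hμ, hd, -⟩ := hE.exists_mult hB ht (k := 1)
    (U := fun τ i j => if i = 0 ∧ j = 0 then ((mInv G τ : ℤ) * t τ) • e τ 0 else 0)
    fun τ _ i _ j _ => ⟨0, zero_mem _, by simp⟩
  exact ⟨μ, hμ, by simpa using hd⟩

/-- The multiplication with the only nonzero entry `m_τ² e_0` at `τ`. -/
def IsCornerUnit (I : GType → Finset ℕ) (e : GType → ℕ → G) (τ : GType)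
    (μ : Mult G) : Prop :=
  μ ∈ typePart (Mult G) τ ∧ ∀ i ∈ I τ, ∀ j ∈ I τ,
    μ (e τ i ⊗ₜ[ℤ] e τ j) = if i = 0 ∧ j = 0 then mInv G τ ^ 2 • e τ 0 else 0

theorem AdaptedBasis.exists_cornerUnits (hB : BlockData G T) (hE : AdaptedBasis G T I e s d) :
    ∃ F : GType → Mult G, ∀ τ ∈ T, 0 ∈ I τ → IsCornerUnit I e τ (F τ) := by
  have h : ∀ τ, ∃ μ : Mult G, τ ∈ T → 0 ∈ I τ → IsCornerUnit I e τ μ := fun τ => by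
    by_cases hτ : τ ∈ T ∧ 0 ∈ I τ
    · obtain ⟨μ, hμ, h⟩ := hE.exists_single hB hτ.1
        (a := fun i j => if i = 0 ∧ j = 0 then e τ 0 else 0) (fun i _ j _ => by
          split_ifs
          · exact (hE.basis τ hτ.1).mem 0 hτ.2
          · exact zero_mem _)
      refine ⟨μ, fun _ _ => ⟨hμ, fun i hi j hj => ?_⟩⟩
      rw [h i hi j hj]
      split_ifs with h0
      · rw [coef, if_pos h0]
      · rw [smul_zero]
    · exact ⟨0, fun h h' => absurd ⟨h, h'⟩ hτ⟩
  choose F hF using h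
  exact ⟨F, hF⟩

/-- If μ sends d ⊗ d to kd modulo A, then μ - kX' sends it into A and so lies in the regulator. -/
theorem AdaptedBasis.generatesQuotient_mult (hB : BlockData G T)
    (hE : AdaptedBasis G T I e s d) {X' : Mult G} (hd : X' (d ⊗ₜ[ℤ] d) - d ∈ divSum G T) :
    GeneratesQuotient X' := by
  rw [generatesQuotient_iff, (hE.blockData_mult hB).regulator_eq]
  intro μ
  obtain ⟨k, hk⟩ := generatesQuotient_iff.1 hE.gen (μ (d ⊗ₜ[ℤ] d))
  rw [hB.regulator_eq] at hk
  refine ⟨k, (hE.mem_divSum_mult_iff hB).2 ?_⟩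
  have : (μ - k • X') (d ⊗ₜ[ℤ] d) =
      (μ (d ⊗ₜ[ℤ] d) - k • d) - k • (X' (d ⊗ₜ[ℤ] d) - d) := by
    rw [AddMonoidHom.sub_apply, AddMonoidHom.zsmul_apply]
    module
  rw [this]
  exact sub_mem hk (zsmul_mem hd k)

/-- Comparison of corner entries: n(G) · mt = (n(G)/m)t · m². -/
theorem AdaptedBasis.repr_mult (hB : BlockData G T) (hE : AdaptedBasis G T I e s d)
    {X' : Mult G} (hX : HasCorner T I e (fun τ => ((mInv G τ : ℤ) * t τ) • e τ 0) X')
    {F : GType → Mult G} (hF : ∀ τ ∈ T, 0 ∈ I τ → IsCornerUnit I e τ (F τ)) :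
    regIndex G • X' =
      ∑ τ ∈ T, if 0 ∈ I τ then ((regIndex G / mInv G τ : ℕ) * t τ : ℤ) • F τ else 0 := by
  rw [← sub_eq_zero]
  refine hE.mult_eq_zero hB _ fun τ hτ i hi j hj => ?_
  rw [AddMonoidHom.sub_apply, AddMonoidHom.nsmul_apply, AddMonoidHom.finsetSum_apply,
    hX τ hτ i hi j hj, Finset.sum_eq_single_of_mem τ hτ, sub_eq_zero]
  · by_cases h0 : i = 0 ∧ j = 0
    · obtain ⟨rfl, rfl⟩ := h0
      rw [if_pos ⟨rfl, rfl⟩, if_pos hi, AddMonoidHom.zsmul_apply, (hF τ hτ hi).2 0 hi 0 hi,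
        if_pos ⟨rfl, rfl⟩, ← natCast_zsmul, ← natCast_zsmul, ← mul_smul, ← mul_smul]
      congr 1
      have : (regIndex G : ℤ) = (regIndex G / mInv G τ : ℕ) * mInv G τ := by
        exact_mod_cast (hE.regIndex_eq hB hτ).symm
      push_cast at this ⊢
      linear_combination ((mInv G τ : ℤ) * t τ) * this
    · rw [if_neg h0, smul_zero]
      split_ifs with h
      · rw [AddMonoidHom.zsmul_apply, (hF τ hτ h).2 i hi j hj, if_neg h0, smul_zero]
      · rfl
  · intro σ hσ hne
    split_ifs with h
    · rw [AddMonoidHom.zsmul_apply, hB.mul_eq_zero_of_mem_typePart hτ hσ (hF σ hσ h).1 hne.symm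
        ((hE.basis τ hτ).mem i hi), smul_zero]
    · rfl

omit [IsAddTorsionFree G] in
/-- `m e` with `e` a basis element is divisible by `k` only if `k ∣ m`, for `k` prime to `τ`. -/
theorem IsPartBasis.dvd_of_zsmul_eq {τ : GType} {J : Finset ℕ} {b : ℕ → G}
    (h : IsPartBasis G τ J b) {i : ℕ} (hi : i ∈ J) {m : ℕ} {z : ℤ}
    (hm : ∀ n, IsSUnit (PInf τ) n → n.Coprime m) {a : G} (ha : a ∈ typePart G τ)
    (e' : z • b i = m • a) : (m : ℤ) ∣ z := by
  classical
  obtain ⟨n, hn, w, hw⟩ := h.span a ha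
  have h1 := h.indep (fun j => (if j = i then n * z else 0) - m * w j) (by
    simp only [sub_smul, Finset.sum_sub_distrib, mul_smul, ← Finset.smul_sum, ← hw, ite_smul,
      zero_smul, Finset.sum_ite_eq', hi, if_true, e', natCast_zsmul]
    rw [smul_comm, sub_self]) i hi
  rw [if_pos rfl, sub_eq_zero] at h1
  have hc : IsCoprime (m : ℤ) n := (Nat.isCoprime_iff_coprime.2 (hm n hn)).symm
  exact hc.dvd_of_dvd_mul_left ⟨w i, h1⟩

/-- The τ-component of X' is (t/m)F. If k(t/m)F is a multiplication ν, its corner entry is m²a with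
a in A_τ, so kt e₀ = ma. Hence m divides kt, and t is prime to m. If there is no index 0, the
component is zero and both invariants are 1. -/
theorem AdaptedBasis.mInv_mult (hB : BlockData G T) (hE : AdaptedBasis G T I e s d)
    {τ : GType} (hτ : τ ∈ T) : mInv (Mult G) τ = mInv G τ := by
  obtain ⟨t, ht⟩ := hE.exists_inverse
  obtain ⟨X', hX, hd⟩ := hE.exists_mult_generator hB ht
  obtain ⟨F, hF⟩ := hE.exists_cornerUnits hB
  have hgen := hE.generatesQuotient_mult hB hd
  have hmem : ∀ σ ∈ T,
      (if 0 ∈ I σ then ((regIndex G / mInv G σ : ℕ) * t σ : ℤ) • F σ else 0) ∈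
        typePart (Mult G) σ := fun σ hσ => by
    split_ifs with h
    · exact zsmul_mem (hF σ hσ h).1 _
    · exact zero_mem _
  have hdvd := fun k => (hE.blockData_mult hB).mInv_dvd_iff hτ hB.regIndex_ne_zero hgen hmem
    (hE.repr_mult hB hX hF) (k := k)
  have hm := hB.mInv_ne_zero hτ hE.gen
  have hq := hE.regIndex_div_ne_zero hB hτ
  by_cases h0 : 0 ∈ I τ
  swap
  · have h1 : ¬ 1 < mInv G τ := fun h => h0 ((hE.zero_mem_iff τ hτ).2 h)
    rw [show mInv G τ = 1 by omega]
    refine Nat.dvd_one.1 ((hdvd 1).2 ⟨0, zero_mem _, ?_⟩)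
    rw [if_neg h0, smul_zero, smul_zero]
  simp only [if_pos h0] at hdvd
  refine Nat.dvd_antisymm ((hdvd _).2 ⟨t τ • F τ, zsmul_mem (hF τ hτ h0).1 _, ?_⟩) ?_
  · rw [← hE.regIndex_eq hB hτ, ← natCast_zsmul, ← natCast_zsmul, ← mul_smul, ← mul_smul]
    rw [hE.regIndex_eq hB hτ]
    congr 1
    have : (regIndex G : ℤ) = (regIndex G / mInv G τ : ℕ) * mInv G τ := by
      exact_mod_cast (hE.regIndex_eq hB hτ).symm
    linear_combination (- t τ) * this
  · obtain ⟨ν, hν, e'⟩ := (hdvd _).1 dvd_rfl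
    have hνd := (hE.mem_divSum_mult_iff hB).1 (typePart_le_divSum hτ hν)
    obtain ⟨a, ha, ea⟩ := hE.isEntry hB ht (k := 0) (by rwa [zero_smul, sub_zero]) hτ h0 h0
    rw [zero_smul, ite_self, zero_add, coef, if_pos ⟨rfl, rfl⟩] at ea
    have h2 := DFunLike.congr_fun e' (e τ 0 ⊗ₜ[ℤ] e τ 0)
    rw [AddMonoidHom.nsmul_apply, AddMonoidHom.nsmul_apply, AddMonoidHom.zsmul_apply,
      (hF τ hτ h0).2 0 h0 0 h0, if_pos ⟨rfl, rfl⟩, ea] at h2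
    have h3 : ((mInv (Mult G) τ : ℤ) * t τ) • e τ 0 = mInv G τ • a := by
      refine nsmul_cancel (mul_ne_zero hq (pow_ne_zero 2 hm)) ?_
      rw [← natCast_zsmul, ← natCast_zsmul (mInv G τ • a), ← natCast_zsmul a, ← mul_smul,
        ← mul_smul]
      rw [← natCast_zsmul, ← natCast_zsmul (e τ 0), ← natCast_zsmul _ (regIndex G),
        ← natCast_zsmul a, ← mul_smul, ← mul_smul, ← mul_smul] at h2
      convert h2 using 2
      · push_cast
        ring
      · have : (regIndex G : ℤ) = (regIndex G / mInv G τ : ℕ) * mInv G τ := by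
          exact_mod_cast (hE.regIndex_eq hB hτ).symm
        generalize regIndex G / mInv G τ = q at this ⊢
        rw [this]
        push_cast
        ring
    have h4 := (hE.basis τ hτ).dvd_of_zsmul_eq h0 (fun n hn => hB.mInv_coprime hE.gen hτ hn) ha h3
    have h5 : IsCoprime (mInv G τ : ℤ) (t τ) := by
      obtain ⟨c, hc⟩ := Int.modEq_iff_dvd.1 (ht τ hτ h0)
      exact ⟨c, s τ, by linear_combination -hc⟩
    exact_mod_cast h5.dvd_of_dvd_mul_right h4

theorem AdaptedBasis.regIndex_mult (hB : BlockData G T) (hE : AdaptedBasis G T I e s d) :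
    regIndex (Mult G) = regIndex G := by
  obtain ⟨t, ht⟩ := hE.exists_inverse
  obtain ⟨X', hX, hd⟩ := hE.exists_mult_generator hB ht
  have h1 := fun k => (hE.blockData_mult hB).regIndex_dvd_iff (hE.generatesQuotient_mult hB hd)
    (k := k)
  have h2 := fun k => hB.regIndex_dvd_iff hE.gen (k := k)
  refine Nat.dvd_antisymm ((h1 _).2 fun τ hτ => ?_) ((h2 _).2 fun τ hτ => ?_)
  · rw [hE.mInv_mult hB hτ]
    exact (h2 _).1 dvd_rfl τ hτ
  · rw [← hE.mInv_mult hB hτ]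
    exact (h1 _).1 dvd_rfl τ hτ

omit [IsAddTorsionFree G] in
theorem isReduced_mult (h : IsReduced G) : IsReduced (Mult G) := by
  intro D hD
  refine (AddSubgroup.eq_bot_iff_forall D).2 fun μ hμ => ?_
  ext1 x
  have h1 := h (D.map (AddMonoidHom.eval x)) (by
    rintro n hn _ ⟨ν, hν, rfl⟩
    obtain ⟨ν', hν', rfl⟩ := hD n hn ν hν
    exact ⟨_, ⟨ν', hν', rfl⟩, rfl⟩)
  exact (AddSubgroup.eq_bot_iff_forall _).1 h1 _ ⟨μ, hμ, rfl⟩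

theorem AdaptedBasis.inA0_mult (hB : BlockData G T) (hE : AdaptedBasis G T I e s d)
    (h : IsReduced G) : InA0 (Mult G) := by
  obtain ⟨t, ht⟩ := hE.exists_inverse
  obtain ⟨X', -, hd⟩ := hE.exists_mult_generator hB ht
  exact { (hE.blockData_mult hB).isBlockRigid with
    cyclic := (hE.generatesQuotient_mult hB hd).isAddCyclic
    reduced := isReduced_mult h
    ringType := (hE.blockData_mult hB).isRingType }

theorem AdaptedBasis.regulator_mult (hB : BlockData G T) (hE : AdaptedBasis G T I e s d) :
    regulator (Mult G) = regulatorMult G := by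
  rw [(hE.blockData_mult hB).regulator_eq]
  ext μ
  constructor
  · rintro ⟨f, hf, rfl⟩ x
    rw [hB.regulator_eq]
    exact ⟨fun τ => f τ x, fun τ hτ => mem_typePart_mult.1 (hf τ hτ) _,
      (AddMonoidHom.finsetSum_apply _ _ _).symm⟩
  · intro h
    exact (hE.mem_divSum_mult_iff hB).2 (hB.regulator_eq ▸ h _)

/-- A basis element e_i of the part of G gives a nonzero multiplication with entry a multiple of e_i
at (i, i). So the two parts vanish together. -/
theorem AdaptedBasis.critTypes_mult (hB : BlockData G T) (hE : AdaptedBasis G T I e s d) :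
    critTypes (Mult G) = critTypes G := by
  ext τ
  rw [(hE.blockData_mult hB).mem_critTypes_iff, hB.mem_critTypes_iff, and_congr_right_iff]
  intro hτ
  rw [not_iff_not, AddSubgroup.eq_bot_iff_forall, AddSubgroup.eq_bot_iff_forall]
  constructor
  · intro h x hx
    obtain ⟨n, hn, z, hz⟩ := (hE.basis τ hτ).span x hx
    have hI : I τ = ∅ := by
      refine Finset.eq_empty_of_forall_notMem fun i hi => ?_
      obtain ⟨μ, hμ, h1⟩ := hE.exists_single hB hτ (a := fun _ _ => e τ i)
        fun _ _ _ _ => (hE.basis τ hτ).mem i hi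
      have h2 := h1 i hi i hi
      rw [h μ hμ, AddMonoidHom.zero_apply] at h2
      exact (hE.basis τ hτ).ne_zero hi (nsmul_cancel
        (coef_ne_zero (hB.mInv_ne_zero hτ hE.gen) i i) (by rw [← h2, smul_zero]))
    rw [hI, Finset.sum_empty] at hz
    exact nsmul_cancel hn.1 (by rw [hz, smul_zero])
  · intro h μ hμ
    ext1 x
    exact h _ (mem_typePart_mult.1 hμ x)

theorem AdaptedBasis.critTypes0_mult (hB : BlockData G T) (hE : AdaptedBasis G T I e s d) :
    critTypes0 (Mult G) = critTypes0 G := by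
  ext τ
  simp only [critTypes0, Set.mem_ofPred_eq, hE.critTypes_mult hB]
  refine and_congr_right fun h => ?_
  rw [hE.mInv_mult hB (hB.mem_critTypes_iff.1 h).1]

end MultInvariants

/-! ### The matrix groups of a main decomposition -/

theorem IsCompletelyDecomposable.of_addEquiv {M N : Type*} [AddCommGroup M] [AddCommGroup N]
    (f : M ≃+ N) (h : IsCompletelyDecomposable M) : IsCompletelyDecomposable N := by
  obtain ⟨htf, n, L, hL⟩ := h
  refine ⟨f.symm.injective.isAddTorsionFree f.symm.toAddMonoidHom, n,
    fun i => (L i).map f.toAddMonoidHom, ⟨fun i => ?_, ?_, ?_⟩⟩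
  · have h1 := hL.rank_one i
    have h2 := (f.addSubgroupMap (L i)).toIntLinearEquiv.lift_rank_eq
    rw [h1, Cardinal.lift_one] at h2
    exact Cardinal.lift_eq_one.1 h2.symm
  · exact hL.indep.map_orderIso f.mapAddSubgroup
  · rw [← AddSubgroup.map_iSup, hL.sup, AddSubgroup.map_top_of_surjective _ f.surjective]

theorem mem_closure_singleton_sup_iff {M : Type*} [AddCommGroup M] {N : AddSubgroup M} {x y : M} :
    y ∈ AddSubgroup.closure {x} ⊔ N ↔ ∃ k : ℤ, y - k • x ∈ N := by
  rw [AddSubgroup.mem_sup]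
  constructor
  · rintro ⟨_, hz, w, hw, rfl⟩
    obtain ⟨k, rfl⟩ := AddSubgroup.mem_closure_singleton.1 hz
    exact ⟨k, by rwa [add_sub_cancel_left]⟩
  · rintro ⟨k, hk⟩
    exact ⟨k • x, AddSubgroup.mem_closure_singleton.2 ⟨k, rfl⟩, _, hk, add_sub_cancel _ _⟩

section MainData

variable {G : Type*} [AddCommGroup G]

/-- What is used of a main decomposition, an adapted basis, and the inverses `t`. -/
structure MainData (T : Finset GType) (G₁ C : AddSubgroup G) (E : GType → ℕ → G)
    (s t : GType → ℤ) (d : G) : Prop where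
  block : BlockData G T
  crit : ∀ τ, τ ∈ critTypes G ↔ τ ∈ T
  basis : AdaptedBasis G T (idx G₁ C) E s d
  compl : IsCompl G₁ C
  corner_mem : ∀ τ ∈ T, 0 ∈ idx G₁ C τ → E τ 0 ∈ G₁
  corner_span : ∀ τ ∈ T, 0 ∈ idx G₁ C τ → ∀ x ∈ typePart G τ, x ∈ G₁ →
    ∃ n, IsSUnit (PInf τ) n ∧ ∃ z : ℤ, n • x = z • E τ 0
  inverse : ∀ τ ∈ T, 0 ∈ idx G₁ C τ → s τ * t τ ≡ 1 [ZMOD (mInv G τ : ℤ)]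

/-- The condition `IsEntry`, with the free summand restricted to `H` at the position `(0, 0)`, and
to `H'` at the other positions. -/
def IsEntryIn (H H' : AddSubgroup G) (e : GType → ℕ → G) (t : GType → ℤ) (k : ℤ) (τ : GType)
    (i j : ℕ) (u : G) : Prop :=
  ∃ a ∈ typePart G τ, (if i = 0 ∧ j = 0 then a ∈ H else a ∈ H') ∧ u =
    (if i = 0 ∧ j = 0 then k • (((mInv G τ : ℤ) * t τ) • e τ 0) else 0) + coef (mInv G τ) i j • a

theorem IsEntryIn.isEntry {H H' : AddSubgroup G} {e : GType → ℕ → G} {t : GType → ℤ} {k : ℤ}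
    {τ : GType} {i j : ℕ} {u : G} (h : IsEntryIn H H' e t k τ i j u) : IsEntry e t k τ i j u := by
  obtain ⟨a, ha, -, e'⟩ := h
  exact ⟨a, ha, e'⟩

theorem isEntryIn_top_iff {e : GType → ℕ → G} {t : GType → ℤ} {k : ℤ}
    {τ : GType} {i j : ℕ} {u : G} : IsEntryIn ⊤ ⊤ e t k τ i j u ↔ IsEntry e t k τ i j u := by
  refine ⟨IsEntryIn.isEntry, ?_⟩
  rintro ⟨a, ha, e'⟩
  exact ⟨a, ha, by simp, e'⟩

/-- The families of matrices all of whose entries satisfy `IsEntryIn H H' e t k`. -/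
def AllEntries (G₁ C H H' : AddSubgroup G) (e : GType → ℕ → G) (t : GType → ℤ) (k : ℤ)
    (U : MatrixFamily G₁ C) : Prop :=
  ∀ (τ : critTypes G) (i j : idx G₁ C τ), IsEntryIn H H' e t k τ i j (U τ i j)

/-- Subtracting kX removes exactly the fixed term of the corner entries, so membership in ⟨X, N⟩
reduces to membership in N. -/
theorem sub_zsmul_X_iff {G₁ C H H' : AddSubgroup G} {e : GType → ℕ → G} {t : GType → ℤ} {k : ℤ}
    {U : MatrixFamily G₁ C} :
    AllEntries G₁ C H H' e t 0 (U - k • X G₁ C t e) ↔ AllEntries G₁ C H H' e t k U := by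
  refine forall_congr' fun τ => forall_congr' fun i => forall_congr' fun j => ?_
  have : (U - k • X G₁ C t e) τ i j = U τ i j -
      if (i : ℕ) = 0 ∧ (j : ℕ) = 0 then k • (((mInv G τ : ℤ) * t τ) • e τ 0) else 0 := by
    change U τ i j - k • (X G₁ C t e τ i j) = _
    rw [X, Matrix.of_apply, smul_ite, smul_zero]
  rw [IsEntryIn, IsEntryIn, this]
  simp only [zero_smul, ite_self, zero_add, sub_eq_iff_eq_add']

theorem mem_mulSubgroup {k : ℕ} {H : AddSubgroup G} {x : G} :
    x ∈ mulSubgroup k H ↔ ∃ a ∈ H, x = k • a := by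
  rw [mulSubgroup, AddSubgroup.mem_map]
  exact ⟨fun ⟨a, ha, h⟩ => ⟨a, ha, h.symm⟩, fun ⟨a, ha, h⟩ => ⟨a, ha, h.symm⟩⟩

variable [IsAddTorsionFree G] {T : Finset GType}
  {G₁ C : AddSubgroup G} {E : GType → ℕ → G} {s t : GType → ℤ} {d : G}

omit [IsAddTorsionFree G] in
theorem MainData.exists_retractions (h : MainData T G₁ C E s t d) :
    (∃ p : G →+ G₁, (∀ x : G₁, p x = x) ∧ ∀ x ∈ C, p x = 0) ∧
      ∃ p : G →+ C, (∀ x : C, p x = x) ∧ ∀ x ∈ G₁, p x = 0 :=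
  ⟨exists_retraction h.compl, exists_retraction h.compl.symm⟩

theorem mem_of_nsmul_mem_of_retract {H : AddSubgroup G} {p : G →+ H}
    (hp : ∀ x : H, p x = x) {n : ℕ} (hn : n ≠ 0) {x : G} (hx : n • x ∈ H) : x ∈ H := by
  have h1 := congrArg Subtype.val (hp ⟨n • x, hx⟩)
  rw [show p ((⟨n • x, hx⟩ : H) : G) = n • p x from map_nsmul p n x, AddSubgroup.coe_nsmul] at h1
  exact nsmul_cancel hn h1 ▸ (p x).2

theorem mem_subRegPart_of_retract (hB : BlockData G T) {H : AddSubgroup G} {p : G →+ H}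
    (hp : ∀ x : H, p x = x) {τ : GType} (hτ : τ ∈ T) {x : G} :
    x ∈ subRegPart H τ ↔ x ∈ typePart G τ ∧ x ∈ H := by
  rw [subRegPart, (hB.retract hp).regPart_eq hτ, AddSubgroup.mem_map]
  constructor
  · rintro ⟨y, hy, rfl⟩
    exact ⟨(mem_divPart_of_retract hp).1 hy, y.2⟩
  · rintro ⟨hx, hxH⟩
    exact ⟨⟨x, hxH⟩, (mem_divPart_of_retract hp).2 hx, rfl⟩

/-- M⁽²⁾, K and M'' are one and the same condition for k = 0, with (H, H') equal to (⊤, ⊤), (G₁, ⊥)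
and (C, ⊤). -/
theorem MainData.mem_M2_iff (h : MainData T G₁ C E s t d) {U : MatrixFamily G₁ C} :
    U ∈ M2 G₁ C ↔ AllEntries G₁ C ⊤ ⊤ E t 0 U := by
  refine forall_congr' fun τ => forall_congr' fun i => forall_congr' fun j => ?_
  dsimp only
  generalize U τ i j = u
  rw [h.block.regPart_eq ((h.crit τ).1 τ.2), IsEntryIn, coef]
  split_ifs <;> simp [mem_mulSubgroup]

theorem MainData.mem_K_iff (h : MainData T G₁ C E s t d) {U : MatrixFamily G₁ C} :
    U ∈ K G₁ C ↔ AllEntries G₁ C G₁ ⊥ E t 0 U := by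
  obtain ⟨⟨p, hp, -⟩, -⟩ := h.exists_retractions
  refine forall_congr' fun τ => forall_congr' fun i => forall_congr' fun j => ?_
  dsimp only
  generalize U τ i j = u
  rw [IsEntryIn, coef]
  split_ifs
  · simp [mem_mulSubgroup, mem_subRegPart_of_retract h.block hp ((h.crit τ).1 τ.2), and_assoc]
  all_goals
    rw [AddSubgroup.mem_bot]
    constructor
    · intro h0
      exact ⟨0, zero_mem _, zero_mem _, by simp [h0]⟩
    · rintro ⟨a, -, ha, h0⟩
      rw [AddSubgroup.mem_bot] at ha
      simpa [ha] using h0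

theorem MainData.mem_MDoublePrime_iff (h : MainData T G₁ C E s t d) {U : MatrixFamily G₁ C} :
    U ∈ MDoublePrime G₁ C ↔ AllEntries G₁ C C ⊤ E t 0 U := by
  obtain ⟨-, p, hp, -⟩ := h.exists_retractions
  refine forall_congr' fun τ => forall_congr' fun i => forall_congr' fun j => ?_
  dsimp only
  generalize U τ i j = u
  rw [h.block.regPart_eq ((h.crit τ).1 τ.2), IsEntryIn, coef]
  split_ifs
  · simp [mem_mulSubgroup, mem_subRegPart_of_retract h.block hp ((h.crit τ).1 τ.2), and_assoc]
  all_goals simp [mem_mulSubgroup]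

theorem MainData.mem_MGroup_iff (h : MainData T G₁ C E s t d) {U : MatrixFamily G₁ C} :
    U ∈ MGroup G₁ C t E ↔ ∃ k, AllEntries G₁ C ⊤ ⊤ E t k U := by
  rw [MGroup, mem_closure_singleton_sup_iff]
  simp only [h.mem_M2_iff, sub_zsmul_X_iff]

theorem MainData.mem_MPrime_iff (h : MainData T G₁ C E s t d) {U : MatrixFamily G₁ C} :
    U ∈ MPrime G₁ C t E ↔ ∃ k, AllEntries G₁ C G₁ ⊥ E t k U := by
  rw [MPrime, mem_closure_singleton_sup_iff]
  simp only [h.mem_K_iff, sub_zsmul_X_iff]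

theorem MainData.multMatrix_injective (h : MainData T G₁ C E s t d) :
    Function.Injective (multMatrix G₁ C E) := by
  refine (injective_iff_map_eq_zero _).2 fun μ hμ => ?_
  refine h.basis.mult_eq_zero h.block μ fun τ hτ i hi j hj => ?_
  exact congrFun (congrFun (congrFun hμ ⟨τ, (h.crit τ).2 hτ⟩) ⟨i, hi⟩) ⟨j, hj⟩

theorem MainData.allEntries_of_sub_mem (h : MainData T G₁ C E s t d) {μ : Mult G} {k : ℤ}
    (hk : μ (d ⊗ₜ[ℤ] d) - k • d ∈ divSum G T) :
    AllEntries G₁ C ⊤ ⊤ E t k (multMatrix G₁ C E μ) := fun τ i j =>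
  isEntryIn_top_iff.2 (h.basis.isEntry h.block h.inverse hk ((h.crit τ).1 τ.2) i.2 j.2)

theorem MainData.exists_allEntries (h : MainData T G₁ C E s t d) (μ : Mult G) :
    ∃ k, AllEntries G₁ C ⊤ ⊤ E t k (multMatrix G₁ C E μ) := by
  obtain ⟨k, hk⟩ := generatesQuotient_iff.1 h.basis.gen (μ (d ⊗ₜ[ℤ] d))
  rw [h.block.regulator_eq] at hk
  exact ⟨k, h.allEntries_of_sub_mem hk⟩

theorem MainData.exists_of_allEntries (h : MainData T G₁ C E s t d) {H H' : AddSubgroup G} {k : ℤ}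
    {U : MatrixFamily G₁ C} (hU : AllEntries G₁ C H H' E t k U) : ∃ μ : Mult G,
      multMatrix G₁ C E μ = U ∧ μ (d ⊗ₜ[ℤ] d) - k • d ∈ divSum G T := by
  classical
  -- Extension by zero to all indices, as required by `AdaptedBasis.exists_mult`.
  have h1 : ∀ τ, ∃ V : ℕ → ℕ → G, ∀ (hτ : τ ∈ critTypes G) (i j : idx G₁ C τ),
      V i j = U ⟨τ, hτ⟩ i j := fun τ => by
    by_cases hτ : τ ∈ critTypes G
    · exact ⟨fun i j => if hij : i ∈ idx G₁ C τ ∧ j ∈ idx G₁ C τ then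
        U ⟨τ, hτ⟩ ⟨i, hij.1⟩ ⟨j, hij.2⟩ else 0, fun _ i j => by simp⟩
    · exact ⟨0, fun h => absurd h hτ⟩
  choose V hV using h1
  obtain ⟨μ, hμ, hd, -⟩ := h.basis.exists_mult h.block h.inverse (k := k) (U := V)
    fun τ hτ i hi j hj => by
      rw [hV τ ((h.crit τ).2 hτ) ⟨i, hi⟩ ⟨j, hj⟩]
      exact (hU ⟨τ, (h.crit τ).2 hτ⟩ ⟨i, hi⟩ ⟨j, hj⟩).isEntry
  refine ⟨μ, ?_, hd⟩
  ext τ i j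
  exact (hμ τ ((h.crit τ).1 τ.2) i i.2 j j.2).trans (hV τ τ.2 i j)

theorem MainData.range_multMatrix (h : MainData T G₁ C E s t d) :
    (multMatrix G₁ C E).range = MGroup G₁ C t E := by
  ext U
  rw [h.mem_MGroup_iff]
  constructor
  · rintro ⟨μ, rfl⟩
    exact h.exists_allEntries μ
  · rintro ⟨k, hk⟩
    obtain ⟨μ, hμ, -⟩ := h.exists_of_allEntries hk
    exact ⟨μ, hμ⟩

theorem MainData.mem_divSum_of_allEntries (h : MainData T G₁ C E s t d) {H H' : AddSubgroup G}
    {μ : Mult G} (hμ : AllEntries G₁ C H H' E t 0 (multMatrix G₁ C E μ)) :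
    μ ∈ divSum (Mult G) T := by
  obtain ⟨ν, hν, hd⟩ := h.exists_of_allEntries hμ
  rw [← h.multMatrix_injective hν, h.basis.mem_divSum_mult_iff h.block]
  simpa using hd

theorem MainData.allEntries_of_mem_divSum (h : MainData T G₁ C E s t d) {μ : Mult G}
    (hμ : μ ∈ divSum (Mult G) T) : AllEntries G₁ C ⊤ ⊤ E t 0 (multMatrix G₁ C E μ) := by
  rw [h.basis.mem_divSum_mult_iff h.block] at hμ
  exact h.allEntries_of_sub_mem (by simpa using hμ)

theorem MainData.regulator_mult (h : MainData T G₁ C E s t d) :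
    regulator (Mult G) = multOf G₁ C E (M2 G₁ C) := by
  rw [(h.basis.blockData_mult h.block).regulator_eq]
  ext μ
  rw [multOf, AddSubgroup.mem_comap, h.mem_M2_iff]
  exact ⟨h.allEntries_of_mem_divSum, h.mem_divSum_of_allEntries⟩

theorem MainData.mem_multOf_MPrime (h : MainData T G₁ C E s t d) {μ : Mult G} :
    μ ∈ multOf G₁ C E (MPrime G₁ C t E) ↔
      ∃ k, AllEntries G₁ C G₁ ⊥ E t k (multMatrix G₁ C E μ) :=
  h.mem_MPrime_iff

theorem MainData.mem_multOf_MDoublePrime (h : MainData T G₁ C E s t d) {μ : Mult G} :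
    μ ∈ multOf G₁ C E (MDoublePrime G₁ C) ↔
      AllEntries G₁ C C ⊤ E t 0 (multMatrix G₁ C E μ) :=
  h.mem_MDoublePrime_iff

/-- In the intersection, corner entries lie in G₁ ∩ C and all other entries vanish. For the sum, the
free part of each corner entry is split along G = G₁ ⊕ C. -/
theorem MainData.isCompl_mult (h : MainData T G₁ C E s t d) :
    IsCompl (multOf G₁ C E (MPrime G₁ C t E)) (multOf G₁ C E (MDoublePrime G₁ C)) := by
  constructor
  · rw [disjoint_iff, AddSubgroup.eq_bot_iff_forall]
    rintro μ ⟨h1, h2⟩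
    obtain ⟨k, h1⟩ := h.mem_multOf_MPrime.1 h1
    replace h2 := h.mem_multOf_MDoublePrime.1 h2
    refine h.multMatrix_injective ?_
    rw [map_zero]
    ext τ i j
    obtain ⟨a, -, ha, ea⟩ := h1 τ i j
    obtain ⟨b, -, hb, eb⟩ := h2 τ i j
    change _ = (0 : G)
    by_cases h0 : (i : ℕ) = 0 ∧ (j : ℕ) = 0
    · rw [if_pos h0] at ha ea hb eb
      refine AddSubgroup.disjoint_def.1 h.compl.disjoint ?_ ?_
      · exact ea ▸ add_mem (zsmul_mem (zsmul_mem (h.corner_mem τ ((h.crit τ).1 τ.2)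
          (h0.1 ▸ i.2)) _) _) (nsmul_mem ha _)
      · rw [zero_smul, zero_add] at eb
        exact eb ▸ nsmul_mem hb _
    · rw [if_neg h0] at ha ea
      rw [ea, AddSubgroup.mem_bot.1 ha, smul_zero, add_zero]
  · rw [codisjoint_iff, eq_top_iff]
    rintro μ -
    obtain ⟨⟨p, hp, hpC⟩, -⟩ := h.exists_retractions
    obtain ⟨k, hk⟩ := h.exists_allEntries μ
    choose a ha ha' ea using hk
    -- The M'-component: the multiple of X together with the projections to G₁ of the free parts of
    -- the corners.
    obtain ⟨W, hW⟩ : ∃ W : MatrixFamily G₁ C, ∀ τ i j, W τ i j =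
        if (i : ℕ) = 0 ∧ (j : ℕ) = 0 then
          k • (((mInv G τ : ℤ) * t τ) • E τ 0) + mInv G τ ^ 2 • (p (a τ i j) : G) else 0 :=
      ⟨fun τ => Matrix.of fun i j => _, fun _ _ _ => rfl⟩
    have h1 : AllEntries G₁ C G₁ ⊥ E t k W := by
      intro τ i j
      rw [hW, IsEntryIn]
      by_cases h0 : (i : ℕ) = 0 ∧ (j : ℕ) = 0
      · simp only [if_pos h0, coef]
        exact ⟨p (a τ i j), map_mem_divPart (G₁.subtype.comp p) (ha τ i j), (p _).2, rfl⟩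
      · simp only [if_neg h0]
        exact ⟨0, zero_mem _, zero_mem _, by simp⟩
    obtain ⟨ν, hν, -⟩ := h.exists_of_allEntries h1
    rw [AddSubgroup.mem_sup]
    refine ⟨ν, h.mem_multOf_MPrime.2 ⟨k, hν ▸ h1⟩, μ - ν, h.mem_multOf_MDoublePrime.2 ?_,
      add_sub_cancel _ _⟩
    intro τ i j
    have h2 : multMatrix G₁ C E (μ - ν) τ i j =
        multMatrix G₁ C E μ τ i j - multMatrix G₁ C E ν τ i j := by
      rw [map_sub]
      rfl
    rw [h2, ea, hν, hW]
    by_cases h0 : (i : ℕ) = 0 ∧ (j : ℕ) = 0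
    · refine ⟨a τ i j - p (a τ i j), sub_mem (ha τ i j)
        (map_mem_divPart (G₁.subtype.comp p) (ha τ i j)), ?_, ?_⟩
      · rw [if_pos h0]
        have hcod : a τ i j ∈ G₁ ⊔ C := h.compl.sup_eq_top ▸ AddSubgroup.mem_top _
        obtain ⟨x, hx, y, hy, e'⟩ := AddSubgroup.mem_sup.1 hcod
        rw [← e', map_add, hpC y hy, add_zero, show p x = ⟨x, hx⟩ from hp ⟨x, hx⟩]
        simpa using hy
      · simp only [if_pos h0, coef, smul_sub, zero_smul]
        abel
    · refine ⟨a τ i j, ha τ i j, ?_, ?_⟩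
      · rw [if_neg h0]
        exact AddSubgroup.mem_top _
      · simp only [if_neg h0, sub_zero]

end MainData

/-! ### The main decomposition of the group of multiplications -/

section MultMain

variable {G : Type*} [AddCommGroup G] [IsAddTorsionFree G] {T : Finset GType}
  {G₁ C : AddSubgroup G} {E : GType → ℕ → G} {s t : GType → ℤ} {d : G}

/-- A summand contained in the regulator is the sum of its own parts. -/
theorem BlockData.isCompletelyDecomposable_of_le {M : Type*} [AddCommGroup M]
    [IsAddTorsionFree M] (hB : BlockData M T) {H : AddSubgroup M} {p : M →+ H}
    (hp : ∀ x : H, p x = x) (hH : H ≤ divSum M T) : IsCompletelyDecomposable H := by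
  have h1 : divSum H T = ⊤ :=
    eq_top_iff.2 fun x _ => (mem_divSum_of_retract hp).2 (hH x.2)
  have h2 := (hB.retract hp).isCompletelyDecomposable
  rw [h1] at h2
  exact h2.of_addEquiv AddSubgroup.topEquiv

theorem MainData.isCompletelyDecomposable_MDoublePrime (h : MainData T G₁ C E s t d) :
    IsCompletelyDecomposable (multOf G₁ C E (MDoublePrime G₁ C)) := by
  obtain ⟨p, hp, -⟩ := exists_retraction h.isCompl_mult.symm
  exact (h.basis.blockData_mult h.block).isCompletelyDecomposable_of_le hp
    fun μ hμ => h.mem_divSum_of_allEntries (h.mem_multOf_MDoublePrime.1 hμ)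

omit [IsAddTorsionFree G] in
theorem MainData.allEntries_of_hasCorner (h : MainData T G₁ C E s t d) {u : GType → G}
    {μ : Mult G} (hμ : HasCorner T (idx G₁ C) E u μ) {k : ℤ} {a : GType → G}
    (ha : ∀ τ ∈ T, 0 ∈ idx G₁ C τ → a τ ∈ typePart G τ ∧ a τ ∈ G₁ ∧
      u τ = k • (((mInv G τ : ℤ) * t τ) • E τ 0) + mInv G τ ^ 2 • a τ) :
    AllEntries G₁ C G₁ ⊥ E t k (multMatrix G₁ C E μ) := by
  intro τ i j
  have hτ := (h.crit τ).1 τ.2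
  have e1 : multMatrix G₁ C E μ τ i j = _ := hμ τ hτ i i.2 j j.2
  rw [e1, IsEntryIn]
  by_cases h0 : (i : ℕ) = 0 ∧ (j : ℕ) = 0
  · simp only [if_pos h0, coef]
    obtain ⟨h1, h2, h3⟩ := ha τ hτ (h0.1 ▸ i.2)
    exact ⟨a τ, h1, h2, h3⟩
  · simp only [if_neg h0]
    exact ⟨0, zero_mem _, zero_mem _, by simp⟩

theorem MainData.generator_mem (h : MainData T G₁ C E s t d) {X' : Mult G}
    (hX : HasCorner T (idx G₁ C) E (fun τ => ((mInv G τ : ℤ) * t τ) • E τ 0) X') :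
    X' ∈ multOf G₁ C E (MPrime G₁ C t E) :=
  h.mem_multOf_MPrime.2 ⟨1, h.allEntries_of_hasCorner hX (a := 0) fun _ _ _ =>
    ⟨zero_mem _, zero_mem _, by simp⟩⟩

/-- A corner unit has no entries outside its type. -/
theorem IsCornerUnit.hasCorner (hB : BlockData G T) {I : GType → Finset ℕ} {e : GType → ℕ → G}
    (hE : AdaptedBasis G T I e s d) {τ : GType} (hτ : τ ∈ T) {μ : Mult G}
    (hμ : IsCornerUnit I e τ μ) [DecidableEq GType] :
    HasCorner T I e (fun σ => if σ = τ then mInv G τ ^ 2 • e τ 0 else 0) μ := by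
  intro σ hσ i hi j hj
  dsimp only
  by_cases hne : σ = τ
  · subst hne
    rw [hμ.2 i hi j hj, if_pos rfl]
  · rw [if_neg hne, ite_self]
    exact hB.mul_eq_zero_of_mem_typePart hσ hτ hμ.1 hne ((hE.basis σ hσ).mem i hi) _

theorem MainData.cornerUnit_mem (h : MainData T G₁ C E s t d) {τ : GType} (hτ : τ ∈ T)
    {μ : Mult G} (hμ : IsCornerUnit (idx G₁ C) E τ μ) :
    μ ∈ multOf G₁ C E (MPrime G₁ C t E) := by
  classical
  refine h.mem_multOf_MPrime.2 ⟨0, h.allEntries_of_hasCorner (hμ.hasCorner h.block h.basis hτ)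
    (a := fun σ => if σ = τ then E τ 0 else 0) fun σ _ h0 => ?_⟩
  by_cases hne : σ = τ
  · subst hne
    simp only [if_true, zero_smul, zero_add]
    exact ⟨(h.basis.basis σ hτ).mem 0 h0, h.corner_mem σ hτ h0, trivial⟩
  · simp only [if_neg hne]
    exact ⟨zero_mem _, zero_mem _, by simp⟩

/-- The matrices of the elements of `M'` in the regulator belong to `K`. -/
theorem MainData.allEntries_of_mem (h : MainData T G₁ C E s t d) {μ : Mult G}
    (hμ : μ ∈ multOf G₁ C E (MPrime G₁ C t E)) (hd : μ ∈ divSum (Mult G) T) :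
    AllEntries G₁ C G₁ ⊥ E t 0 (multMatrix G₁ C E μ) := by
  obtain ⟨⟨p, hp, -⟩, -⟩ := h.exists_retractions
  obtain ⟨k, hk⟩ := h.mem_multOf_MPrime.1 hμ
  have h0 := h.allEntries_of_mem_divSum hd
  intro τ i j
  have hτ := (h.crit τ).1 τ.2
  obtain ⟨a, ha, ha', ea⟩ := hk τ i j
  obtain ⟨b, hb, -, eb⟩ := h0 τ i j
  rw [IsEntryIn]
  by_cases hij : (i : ℕ) = 0 ∧ (j : ℕ) = 0
  · simp only [if_pos hij, coef] at ha' ea eb ⊢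
    refine ⟨b, hb, ?_, eb⟩
    -- The entry m²b lies in G₁, and G₁ is pure as a direct summand.
    refine mem_of_nsmul_mem_of_retract hp (n := mInv G τ ^ 2)
      (pow_ne_zero 2 (h.block.mInv_ne_zero hτ h.basis.gen)) ?_
    rw [zero_smul, zero_add] at eb
    rw [← eb, ea]
    exact add_mem (zsmul_mem (zsmul_mem (h.corner_mem τ hτ (hij.1 ▸ i.2)) _) _) (nsmul_mem ha' _)
  · simp only [if_neg hij] at ha' ea ⊢
    exact ⟨a, ha, ha', ea⟩

theorem MainData.mem_multOf_K (h : MainData T G₁ C E s t d) {μ : Mult G} :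
    μ ∈ multOf G₁ C E (K G₁ C) ↔
      μ ∈ multOf G₁ C E (MPrime G₁ C t E) ∧ μ ∈ divSum (Mult G) T := by
  have h1 : μ ∈ multOf G₁ C E (K G₁ C) ↔
      AllEntries G₁ C G₁ ⊥ E t 0 (multMatrix G₁ C E μ) := h.mem_K_iff
  rw [h1]
  exact ⟨fun h2 => ⟨h.mem_multOf_MPrime.2 ⟨0, h2⟩, h.mem_divSum_of_allEntries h2⟩,
    fun h2 => h.allEntries_of_mem h2.1 h2.2⟩

theorem MainData.exists_retraction_MPrime (h : MainData T G₁ C E s t d) :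
    ∃ p : Mult G →+ multOf G₁ C E (MPrime G₁ C t E),
      ∀ x : multOf G₁ C E (MPrime G₁ C t E), p x = x :=
  (exists_retraction h.isCompl_mult).imp fun _ hp => hp.1

theorem MainData.map_regulator_MPrime (h : MainData T G₁ C E s t d) :
    (regulator (multOf G₁ C E (MPrime G₁ C t E))).map
      (multOf G₁ C E (MPrime G₁ C t E)).subtype = multOf G₁ C E (K G₁ C) := by
  obtain ⟨p, hp⟩ := h.exists_retraction_MPrime
  have hBM := h.basis.blockData_mult h.block
  rw [(hBM.retract hp).regulator_eq]
  ext μ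
  rw [h.mem_multOf_K, AddSubgroup.mem_map]
  constructor
  · rintro ⟨x, hx, rfl⟩
    exact ⟨x.2, (mem_divSum_of_retract hp).1 hx⟩
  · rintro ⟨h1, h2⟩
    exact ⟨⟨μ, h1⟩, (mem_divSum_of_retract hp).2 h2, rfl⟩

/-- The elements of `M'` of type at least `τ` are multiples of the corner unit. -/
theorem MainData.exists_zsmul_eq (h : MainData T G₁ C E s t d) {τ : GType} (hτ : τ ∈ T)
    {μ : Mult G} (hμ : μ ∈ multOf G₁ C E (MPrime G₁ C t E)) (hμτ : μ ∈ typePart (Mult G) τ) :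
    (0 ∉ idx G₁ C τ → μ = 0) ∧ ∀ F : Mult G, 0 ∈ idx G₁ C τ → IsCornerUnit (idx G₁ C) E τ F →
      ∃ n, IsSUnit (PInf τ) n ∧ ∃ z : ℤ, n • μ = z • F := by
  have hU := h.allEntries_of_mem hμ (typePart_le_divSum hτ hμτ)
  have hzero : ∀ i ∈ idx G₁ C τ, ∀ j ∈ idx G₁ C τ, ¬ (i = 0 ∧ j = 0) →
      μ (E τ i ⊗ₜ[ℤ] E τ j) = 0 := by
    intro i hi j hj h0
    obtain ⟨a, -, ha, ea⟩ := hU ⟨τ, (h.crit τ).2 hτ⟩ ⟨i, hi⟩ ⟨j, hj⟩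
    simp only [if_neg h0] at ha ea
    rw [AddSubgroup.mem_bot.1 ha, smul_zero, add_zero] at ea
    exact ea
  have hother : ∀ ν ∈ typePart (Mult G) τ, ∀ σ ∈ T, σ ≠ τ → ∀ i ∈ idx G₁ C σ,
      ∀ j ∈ idx G₁ C σ, ν (E σ i ⊗ₜ[ℤ] E σ j) = 0 := fun ν hν σ hσ hne i hi j _ =>
    h.block.mul_eq_zero_of_mem_typePart hσ hτ hν hne ((h.basis.basis σ hσ).mem i hi) _
  constructor
  · intro h0
    refine h.basis.mult_eq_zero h.block μ fun σ hσ i hi j hj => ?_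
    by_cases hne : σ = τ
    · subst hne
      exact hzero i hi j hj fun h' => h0 (h'.1 ▸ hi)
    · exact hother μ hμτ σ hσ hne i hi j hj
  · intro F h0 hF
    obtain ⟨a, ha, ha', ea⟩ := hU ⟨τ, (h.crit τ).2 hτ⟩ ⟨0, h0⟩ ⟨0, h0⟩
    have e1 : μ (E τ 0 ⊗ₜ[ℤ] E τ 0) = _ := ea
    replace ea : μ (E τ 0 ⊗ₜ[ℤ] E τ 0) = mInv G τ ^ 2 • a := by
      simpa [coef] using e1
    simp only [and_self, if_true] at ha'
    obtain ⟨n, hn, z, hz⟩ := h.corner_span τ hτ h0 a ha ha'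
    refine ⟨n, hn, z, ?_⟩
    rw [← sub_eq_zero]
    refine h.basis.mult_eq_zero h.block _ fun σ hσ i hi j hj => ?_
    by_cases hne : σ = τ
    · subst hne
      rw [AddMonoidHom.sub_apply, AddMonoidHom.nsmul_apply, AddMonoidHom.zsmul_apply,
        hF.2 i hi j hj]
      split_ifs with hij
      · rw [hij.1, hij.2, ea, smul_comm, hz, smul_comm, sub_self]
      · rw [hzero i hi j hj hij, smul_zero, smul_zero, sub_self]
    · exact hother _ (sub_mem (nsmul_mem hμτ _) (zsmul_mem hF.1 _)) σ hσ hne i hi j hj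

theorem MainData.cornerUnit_ne_zero (h : MainData T G₁ C E s t d) {τ : GType} (hτ : τ ∈ T)
    (h0 : 0 ∈ idx G₁ C τ) {F : Mult G} (hF : IsCornerUnit (idx G₁ C) E τ F) : F ≠ 0 := by
  rintro rfl
  have h1 := hF.2 0 h0 0 h0
  rw [if_pos ⟨rfl, rfl⟩, AddMonoidHom.zero_apply] at h1
  exact (h.basis.basis τ hτ).ne_zero h0 (nsmul_cancel
    (pow_ne_zero 2 (h.block.mInv_ne_zero hτ h.basis.gen)) (by rw [← h1, smul_zero]))

theorem MainData.mem_critTypes_MPrime (h : MainData T G₁ C E s t d) {τ : GType} :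
    τ ∈ critTypes (multOf G₁ C E (MPrime G₁ C t E)) ↔ τ ∈ T ∧ 0 ∈ idx G₁ C τ := by
  obtain ⟨p, hp⟩ := h.exists_retraction_MPrime
  obtain ⟨F, hF⟩ := h.basis.exists_cornerUnits h.block
  rw [((h.basis.blockData_mult h.block).retract hp).mem_critTypes_iff, and_congr_right_iff]
  intro hτ
  rw [← not_iff_not, not_not, AddSubgroup.eq_bot_iff_forall]
  constructor
  · intro h1 h0
    exact h.cornerUnit_ne_zero hτ h0 (hF τ hτ h0) (congrArg Subtype.val
      (h1 ⟨F τ, h.cornerUnit_mem hτ (hF τ hτ h0)⟩ ((mem_divPart_of_retract hp).2 (hF τ hτ h0).1)))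
  · intro h0 x hx
    exact Subtype.ext ((h.exists_zsmul_eq hτ x.2 ((mem_divPart_of_retract hp).1 hx)).1 h0)

omit [IsAddTorsionFree G] in
theorem MainData.mem_critTypes0_iff (h : MainData T G₁ C E s t d) {τ : GType} :
    τ ∈ critTypes0 G ↔ τ ∈ T ∧ 0 ∈ idx G₁ C τ := by
  rw [critTypes0, Set.mem_ofPred_eq, h.crit]
  exact and_congr_right fun hτ => (h.basis.zero_mem_iff τ hτ).symm

theorem MainData.critTypes_MPrime (h : MainData T G₁ C E s t d) :
    critTypes (multOf G₁ C E (MPrime G₁ C t E)) = critTypes0 G := by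
  ext τ
  rw [h.mem_critTypes_MPrime, h.mem_critTypes0_iff]

/-- M' contains the generator X', so it inherits cyclicity of the regulator quotient and all m_τ.
Its part of type τ consists of R_τ-multiples of one corner unit, which gives rigidity. -/
theorem MainData.isMainDecomposition_mult (h : MainData T G₁ C E s t d) :
    IsMainDecomposition (Mult G) (multOf G₁ C E (MPrime G₁ C t E))
      (multOf G₁ C E (MDoublePrime G₁ C)) := by
  obtain ⟨p, hp⟩ := h.exists_retraction_MPrime
  obtain ⟨F, hF⟩ := h.basis.exists_cornerUnits h.block
  obtain ⟨X', hX, hd⟩ := h.basis.exists_mult_generator h.block h.inverse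
  have hgen := h.basis.generatesQuotient_mult h.block hd
  have hBM := h.basis.blockData_mult h.block
  have hBP := hBM.retract hp
  have hgenP : GeneratesQuotient
      (⟨X', h.generator_mem hX⟩ : multOf G₁ C E (MPrime G₁ C t E)) :=
    hBM.generatesQuotient_retract hp hgen
  refine ⟨h.isCompl_mult, h.isCompletelyDecomposable_MDoublePrime,
    { hBP.isBlockRigid with rank_one := fun τ hτ => ?_ },
    { hBP.isACD with cyclic := hgenP.isAddCyclic }, fun τ => ?_, fun τ hτ => ?_⟩
  · obtain ⟨hτT, h0⟩ := h.mem_critTypes_MPrime.1 hτ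
    rw [hBP.regPart_eq hτT]
    have hFM := h.cornerUnit_mem hτT (hF τ hτT h0)
    refine rank_eq_one_of_forall (e := (⟨⟨F τ, hFM⟩,
      (mem_divPart_of_retract hp).2 (hF τ hτT h0).1⟩ : typePart _ τ)) (fun h1 => ?_) fun x => ?_
    · exact h.cornerUnit_ne_zero hτT h0 (hF τ hτT h0)
        (congrArg Subtype.val (congrArg Subtype.val h1))
    · obtain ⟨n, hn, z, hz⟩ := (h.exists_zsmul_eq hτT x.1.2
        ((mem_divPart_of_retract hp).1 x.2)).2 _ h0 (hF τ hτT h0)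
      refine ⟨n, z, by exact_mod_cast hn.1, Subtype.ext (Subtype.ext ?_)⟩
      rw [natCast_zsmul]
      exact hz
  · rw [h.critTypes_MPrime, ← h.basis.critTypes0_mult h.block]
    rfl
  · exact hBM.mInv_retract hp (d := ⟨X', h.generator_mem hX⟩) hgen
      (h.mem_critTypes_MPrime.1 hτ).1

end MultMain

/-! ### The standard basis of the group of multiplications -/

section MultBasis

variable {G : Type*} [AddCommGroup G] [IsAddTorsionFree G] {T : Finset GType}
  {G₁ C : AddSubgroup G} {E : GType → ℕ → G} {s t : GType → ℤ} {d : G}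

theorem BlockData.iSupIndep_cyclicPart {M : Type*} [AddCommGroup M] [IsAddTorsionFree M]
    (hB : BlockData M T) {S : Set GType} (hS : ∀ τ ∈ S, τ ∈ T) {e : GType → M}
    (he : ∀ τ ∈ S, e τ ∈ typePart M τ) :
    iSupIndep fun τ : S => cyclicPart (τ : GType) (e τ) := by
  classical
  have hfin : S.Finite := T.finite_toSet.subset hS
  have := hfin.fintype
  rw [iSupIndep_iff_sum]
  intro v hv h0
  have hv' := fun τ : S => cyclicPart_le (he τ τ.2) (hv τ)
  choose w hw hwv using hv'
  have h1 : ∑ τ : S, w τ = 0 := toHull_injective (by rw [map_sum, map_zero]; simpa only [hwv])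
  have h2 : ∑ σ ∈ T, (if h : σ ∈ S then w ⟨σ, h⟩ else 0) = 0 := by
    refine Eq.trans ?_ h1
    rw [← Finset.sum_subset (s₁ := S.toFinset) (fun σ hσ => hS σ (Set.mem_toFinset.1 hσ))
      fun σ _ hσ => dif_neg fun h => hσ (Set.mem_toFinset.2 h)]
    rw [← Finset.sum_coe_sort]
    refine Fintype.sum_equiv (Equiv.subtypeEquivRight fun σ => Set.mem_toFinset) _ _ fun σ => ?_
    rw [dif_pos (Set.mem_toFinset.1 σ.2)]
    rfl
  intro τ
  have h3 := hB.indep (fun σ => if h : σ ∈ S then w ⟨σ, h⟩ else 0) (fun σ _ => by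
    split_ifs with h
    · exact hw ⟨σ, h⟩
    · exact zero_mem _) h2 τ (hS τ τ.2)
  rw [dif_pos τ.2] at h3
  rw [← hwv τ, h3, map_zero]

/-- If F = pν with p outside `PInf τ`, then ν lies in the part of type τ and has corner entry m²a.
Comparison of corners gives e₀ = pa, impossible for a basis element. -/
theorem MainData.isZeroInfty_charOf (h : MainData T G₁ C E s t d) {τ : GType} (hτ : τ ∈ T)
    (h0 : 0 ∈ idx G₁ C τ) {F : Mult G} (hF : IsCornerUnit (idx G₁ C) E τ F) :
    IsZeroInfty (charOf F) := by
  intro p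
  have hm := pow_ne_zero 2 (h.block.mInv_ne_zero hτ h.basis.gen)
  by_cases hp : (p : ℕ) ∈ PInf τ
  · exact Or.inr ((height_eq_top_iff p.2).2
      (divPart_anti (Set.singleton_subset_iff.2 hp) hF.1))
  · refine Or.inl ?_
    by_contra hne
    have h1 : ((1 : ℕ) : ℕ∞) ≤ height (p : ℕ) F := by
      rw [Nat.cast_one]
      exact Order.one_le_iff_pos.2 (pos_iff_ne_zero.2 hne)
    obtain ⟨ν, hν⟩ := le_height_iff.1 h1
    rw [pow_one] at hν
    have hνm : ν ∈ typePart (Mult G) τ :=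
      mem_divPart_of_nsmul_mem p.2.ne_zero (by rw [hν]; exact hF.1)
    obtain ⟨a, ha, -, ea⟩ := h.allEntries_of_mem_divSum (typePart_le_divSum hτ hνm)
      ⟨τ, (h.crit τ).2 hτ⟩ ⟨0, h0⟩ ⟨0, h0⟩
    have e1 : ν (E τ 0 ⊗ₜ[ℤ] E τ 0) = _ := ea
    have e2 : ν (E τ 0 ⊗ₜ[ℤ] E τ 0) = mInv G τ ^ 2 • a := by simpa [coef] using e1
    have e3 : (1 : ℤ) • E τ 0 = (p : ℕ) • a := by
      refine nsmul_cancel hm ?_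
      have e4 := hF.2 0 h0 0 h0
      rw [if_pos ⟨rfl, rfl⟩, ← hν, AddMonoidHom.nsmul_apply, e2] at e4
      rw [one_smul, ← e4, smul_comm]
    have e5 := (h.basis.basis τ hτ).dvd_of_zsmul_eq h0 (fun n hn =>
      ((Nat.Prime.coprime_iff_not_dvd p.2).2 fun hd => hp (hn.2 p p.2 hd)).symm) ha e3
    exact p.2.one_lt.ne' (Nat.dvd_one.1 (by exact_mod_cast e5))

theorem MainData.isBBasis_mult (h : MainData T G₁ C E s t d) {X' : Mult G}
    (hX : HasCorner T (idx G₁ C) E (fun τ => ((mInv G τ : ℤ) * t τ) • E τ 0) X')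
    (hd : X' (d ⊗ₜ[ℤ] d) - d ∈ divSum G T) {F : GType → Mult G}
    (hF : ∀ τ ∈ T, 0 ∈ idx G₁ C τ → IsCornerUnit (idx G₁ C) E τ (F τ))
    (ht : ∀ τ ∈ T, 0 ∈ idx G₁ C τ → IsP0Integer τ (t τ))
    (hm : ∀ τ ∈ T, 0 ∈ idx G₁ C τ → IsP0Integer τ (mInv G τ)) :
    IsBBasis (multOf G₁ C E (MPrime G₁ C t E)) X' t F := by
  classical
  obtain ⟨p, hp⟩ := h.exists_retraction_MPrime
  have hBM := h.basis.blockData_mult h.block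
  have hBP := hBM.retract hp
  have hgen := h.basis.generatesQuotient_mult h.block hd
  have hcrit : ∀ {τ}, τ ∈ critTypes (multOf G₁ C E (MPrime G₁ C t E)) ↔
      τ ∈ T ∧ 0 ∈ idx G₁ C τ := h.mem_critTypes_MPrime
  have hFM : ∀ τ ∈ T, 0 ∈ idx G₁ C τ → F τ ∈ multOf G₁ C E (MPrime G₁ C t E) :=
    fun τ hτ h0 => h.cornerUnit_mem hτ (hF τ hτ h0)
  have hset : critTypes (multOf G₁ C E (MPrime G₁ C t E)) =
      ↑(T.filter fun τ => 0 ∈ idx G₁ C τ) := by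
    ext τ
    rw [hcrit, Finset.mem_coe, Finset.mem_filter]
  refine ⟨h.generator_mem hX, hgen, fun τ hτ => ?_, fun τ hτ => ?_, fun τ hτ => ?_, ?_,
    le_antisymm (iSup_le fun τ => ?_) ?_, ?_, ?_, fun k => ?_, fun τ hτ => ?_, fun τ hτ => ?_,
    fun τ hτ => ?_⟩
  · obtain ⟨hτ, h0⟩ := hcrit.1 hτ
    exact (mem_subRegPart_of_retract hBM hp hτ).2 ⟨(hF τ hτ h0).1, hFM τ hτ h0⟩
  · obtain ⟨hτ, h0⟩ := hcrit.1 hτ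
    exact h.isZeroInfty_charOf hτ h0 (hF τ hτ h0)
  · obtain ⟨hτ, h0⟩ := hcrit.1 hτ
    exact hBM.type_eq hτ (hF τ hτ h0).1 (h.cornerUnit_ne_zero hτ h0 (hF τ hτ h0))
  · exact hBM.iSupIndep_cyclicPart (fun τ hτ => (hcrit.1 hτ).1) fun τ hτ =>
      (hF τ (hcrit.1 hτ).1 (hcrit.1 hτ).2).1
  · obtain ⟨hτ, h0⟩ := hcrit.1 τ.2
    intro v hv
    obtain ⟨x, hx, rfl⟩ := cyclicPart_le (hF τ hτ h0).1 hv
    refine ⟨x, ?_, rfl⟩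
    obtain ⟨q, hq, e1⟩ := hv
    have e2 : q.den • x = q.num • F τ := by
      refine toHull_injective ?_
      rw [map_nsmul, map_zsmul, ← e1]
      change q.den • (q • toHull (Mult G) (F τ)) = _
      rw [← Nat.cast_smul_eq_nsmul ℚ, ← mul_smul, mul_comm, Rat.mul_den_eq_num,
        Int.cast_smul_eq_zsmul]
    have hxM : x ∈ multOf G₁ C E (MPrime G₁ C t E) :=
      mem_of_nsmul_mem_of_retract hp q.den_ne_zero
        (by rw [e2]; exact zsmul_mem (hFM τ hτ h0) _)
    refine ⟨⟨x, hxM⟩, ?_, rfl⟩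
    rw [hBP.regulator_eq]
    exact typePart_le_divSum hτ ((mem_divPart_of_retract hp).2 hx)
  · rintro _ ⟨_, ⟨x, hx, rfl⟩, rfl⟩
    rw [hBP.regulator_eq] at hx
    obtain ⟨f, hf, rfl⟩ := hx
    change toHull (Mult G) _ ∈ _
    rw [map_sum, map_sum]
    refine sum_mem fun τ hτ => ?_
    have h1 := h.exists_zsmul_eq hτ (f τ).2 ((mem_divPart_of_retract hp).1 (hf τ hτ))
    by_cases h0 : 0 ∈ idx G₁ C τ
    · obtain ⟨n, hn, z, hz⟩ := h1.2 _ h0 (hF τ hτ h0)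
      exact AddSubgroup.mem_iSup_of_mem (⟨τ, hcrit.2 ⟨hτ, h0⟩⟩ : critTypes _)
        (mem_cyclicPart_of_nsmul hn hz)
    · change toHull (Mult G) ((f τ : Mult G)) ∈ _
      rw [h1.1 h0, map_zero]
      exact zero_mem _
  · rw [hset]
    exact Finset.finite_toSet _
  · rw [hset, finsum_mem_coe_finset]
    -- The identity is verified after multiplication by n(G), where it is the integral
    -- representation of X'.
    refine hull_nsmul_cancel h.block.regIndex_ne_zero ?_
    change regIndex G • toHull (Mult G) X' = _
    rw [← map_nsmul, h.basis.repr_mult h.block hX hF, ← Finset.sum_filter, map_sum,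
      ← Finset.sum_nsmul]
    refine Finset.sum_congr rfl fun τ hτ => ?_
    obtain ⟨hτ, h0⟩ := Finset.mem_filter.1 hτ
    rw [h.basis.mInv_mult h.block hτ, map_zsmul, ← Nat.cast_smul_eq_nsmul ℚ, ← mul_smul,
      ← Int.cast_smul_eq_zsmul ℚ]
    congr 1
    have h1 : (regIndex G : ℚ) = (regIndex G / mInv G τ : ℕ) * mInv G τ := by
      exact_mod_cast (h.basis.regIndex_eq h.block hτ).symm
    have h2 : (mInv G τ : ℚ) ≠ 0 := by exact_mod_cast h.block.mInv_ne_zero hτ h.basis.gen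
    generalize regIndex G / mInv G τ = q at h1 ⊢
    rw [h1]
    push_cast
    field_simp
  · rw [hBM.regIndex_dvd_iff hgen]
    refine ⟨fun h1 τ hτ => h1 τ (hcrit.1 hτ).1, fun h1 τ hτ => ?_⟩
    -- Types without index 0 have m_τ = 1 and do not affect the least common multiple.
    by_cases h0 : 0 ∈ idx G₁ C τ
    · exact h1 τ (hcrit.2 ⟨hτ, h0⟩)
    · have h2 := h.block.mInv_ne_zero hτ h.basis.gen
      have h3 : ¬ 1 < mInv G τ := fun h' => h0 ((h.basis.zero_mem_iff τ hτ).2 h')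
      rw [h.basis.mInv_mult h.block hτ, show mInv G τ = 1 by omega]
      exact one_dvd k
  · obtain ⟨hτ, h0⟩ := hcrit.1 hτ
    rw [h.basis.mInv_mult h.block hτ]
    obtain ⟨c, hc⟩ := Int.modEq_iff_dvd.1 (h.inverse τ hτ h0)
    exact ⟨s τ, c, by linear_combination -hc⟩
  · obtain ⟨hτ, h0⟩ := hcrit.1 hτ
    exact ht τ hτ h0
  · obtain ⟨hτ, h0⟩ := hcrit.1 hτ
    rw [h.basis.mInv_mult h.block hτ]
    exact hm τ hτ h0

end MultBasis

end CRQ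

end

/-! ### Assembly of the theorem. -/

theorem theorem3p3 {G : Type*} [AddCommGroup G] (hG : CRQ.InA0 G) :
    -- `Mult G` is in the class, with regulator `Hom(G ⊗ G, A)`
    (CRQ.InA0 (CRQ.Mult G) ∧ CRQ.regulator (CRQ.Mult G) = CRQ.regulatorMult G) ∧
    -- critical types
    (CRQ.critTypes (CRQ.Mult G) = CRQ.critTypes G ∧
      CRQ.critTypes0 (CRQ.Mult G) = CRQ.critTypes0 G) ∧
    -- near-isomorphism invariants and regulator index
    ((∀ τ ∈ CRQ.critTypes G, CRQ.mInv (CRQ.Mult G) τ = CRQ.mInv G τ) ∧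
      CRQ.regIndex (CRQ.Mult G) = CRQ.regIndex G) ∧
    -- ranks
    (∀ τ ∈ CRQ.critTypes G, Module.finrank ℤ (CRQ.regPart (CRQ.Mult G) τ) =
      Module.finrank ℤ (CRQ.regPart G τ) ^ 3) ∧
    -- for every main decomposition, standard representation and `A`-basis of `G`,
    -- and all inverses `t τ` of `s τ` modulo `m_τ`
    ∀ (G₁ C : AddSubgroup G) (d : G) (s : CRQ.GType → ℤ) (E : CRQ.GType → ℕ → G)
      (t : CRQ.GType → ℤ),
      CRQ.IsMainDecomposition G G₁ C → CRQ.IsABasis G₁ C d s E →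
      (∀ τ ∈ CRQ.critTypes0 G, s τ * t τ ≡ 1 [ZMOD (CRQ.mInv G τ : ℤ)]) →
      -- identification of `Mult G` with the matrix group `⟨X, M⁽²⁾⟩`, and of the regulator
      -- with `M⁽²⁾`
      (Function.Injective (CRQ.multMatrix G₁ C E) ∧
        (CRQ.multMatrix G₁ C E).range = CRQ.MGroup G₁ C t E ∧
        CRQ.regulator (CRQ.Mult G) = CRQ.multOf G₁ C E (CRQ.M2 G₁ C)) ∧
      -- main decomposition `Mult G = M' ⊕ M''`, with `T(M') = T₀(G)` and `Reg M' = K`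
      (CRQ.IsMainDecomposition (CRQ.Mult G) (CRQ.multOf G₁ C E (CRQ.MPrime G₁ C t E))
          (CRQ.multOf G₁ C E (CRQ.MDoublePrime G₁ C)) ∧
        CRQ.critTypes (CRQ.multOf G₁ C E (CRQ.MPrime G₁ C t E)) = CRQ.critTypes0 G ∧
        (CRQ.regulator (CRQ.multOf G₁ C E (CRQ.MPrime G₁ C t E))).map
            (CRQ.multOf G₁ C E (CRQ.MPrime G₁ C t E)).subtype =
          CRQ.multOf G₁ C E (CRQ.K G₁ C)) ∧
      -- `B`-basis and standard representation of `Mult G`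
      ((∀ τ ∈ CRQ.critTypes0 G, CRQ.IsP0Integer τ (t τ)) →
        ∃ (X' : CRQ.Mult G) (F : CRQ.GType → CRQ.Mult G),
          CRQ.multMatrix G₁ C E X' = CRQ.X G₁ C t E ∧
          (∀ τ ∈ CRQ.critTypes0 G, CRQ.multMatrix G₁ C E (F τ) = CRQ.basisMatrix G₁ C E τ) ∧
          CRQ.IsBBasis (CRQ.multOf G₁ C E (CRQ.MPrime G₁ C t E)) X' t F) := by
  classical
  have htf := hG.torsionFree
  obtain ⟨T, hB, hT⟩ := hG.exists_blockData
  obtain ⟨d₀, hd₀⟩ := CRQ.exists_generatesQuotient hG.cyclic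
  -- The assertions about Mult G as an abstract group use an adapted basis built from any generator,
  -- so they presuppose no main decomposition. The matrix statements below use the given A-basis.
  obtain ⟨I₀, e₀, s₀, d₁, hE₀⟩ := hB.exists_adaptedBasis hd₀
  refine ⟨⟨hE₀.inA0_mult hB hG.reduced, hE₀.regulator_mult hB⟩,
    ⟨hE₀.critTypes_mult hB, hE₀.critTypes0_mult hB⟩,
    ⟨fun τ hτ => hE₀.mInv_mult hB ((hT τ).1 hτ), hE₀.regIndex_mult hB⟩, fun τ hτ => ?_, ?_⟩
  · rw [hB.regPart_eq ((hT τ).1 hτ), (hE₀.blockData_mult hB).regPart_eq ((hT τ).1 hτ)]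
    exact hE₀.rank_mult hB ((hT τ).1 hτ)
  intro G₁ C d s E t hM hE ht
  have hA := CRQ.IsABasis.adaptedBasis hG hB hT hM hE
  have hzero : ∀ τ ∈ T, 0 ∈ CRQ.idx G₁ C τ → τ ∈ CRQ.critTypes0 G := fun τ _ h0 =>
    (hM.types τ).1 (CRQ.zero_mem_idx.1 h0)
  have h : CRQ.MainData T G₁ C E s t d := {
    block := hB
    crit := hT
    basis := hA
    compl := hM.compl
    corner_mem := fun τ hτ h0 => (CRQ.IsABasis.exists_zsmul_eq hG hB hT hM hE hτ h0).1
    corner_span := fun τ hτ h0 => (CRQ.IsABasis.exists_zsmul_eq hG hB hT hM hE hτ h0).2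
    inverse := fun τ hτ h0 => ht τ (hzero τ hτ h0) }
  refine ⟨⟨h.multMatrix_injective, h.range_multMatrix, h.regulator_mult⟩,
    ⟨h.isMainDecomposition_mult, h.critTypes_MPrime, h.map_regulator_MPrime⟩, fun htP => ?_⟩
  obtain ⟨X', hX, hd⟩ := hA.exists_mult_generator hB h.inverse
  obtain ⟨F, hF⟩ := hA.exists_cornerUnits hB
  refine ⟨X', F, ?_, fun τ hτ => ?_, h.isBBasis_mult hX hd hF
    (fun τ hτ h0 => htP τ (hzero τ hτ h0))
    fun τ hτ h0 => hE.bbasis.m_int τ (CRQ.zero_mem_idx.1 h0)⟩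
  · ext τ i j
    exact hX τ ((hT τ).1 τ.2) i i.2 j j.2
  · obtain ⟨hτT, h0⟩ := h.mem_critTypes0_iff.1 hτ
    ext σ i j
    refine ((hF τ hτT h0).hasCorner hB hA hτT σ ((hT σ).1 σ.2) i i.2 j j.2).trans ?_
    rw [CRQ.basisMatrix, Matrix.of_apply, ← ite_and]
    simp only [and_comm]
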